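/- Let $G$ be a simply connected solvable real Lie group with Lie algebra $\mathfrak g$, $\Gamma\subset G$ a discrete subgroup with $G/\Gamma$ compact, and $\tilde\Gamma\subset\Gamma$ a subgroup of finite index. For a subgroup $H\subset G$ let $\mathcal A(\mathrm{Ad}_G(H))$ be the almost Zariski closure of $\mathrm{Ad}_G(H)$ in $GL(\mathfrak g)$, i.e. the smallest subgroup $K\supset \mathrm{Ad}_G(H)$ with $B^0\subset K\subset B$ for some real algebraic group $B$, where $B^0$ is the Euclidean identity component of $B$. Assume that $\mathcal A(\mathrm{Ad}_G(\tilde\Gamma))$ is connected. Choose - a maximal compact torus $T_{cpt}$ of $\mathcal A(\mathrm{Ad}_G(G))$ containing a maximal compact torus $S_{cpt}^\perp$ of $\mathcal A(\mathrm{Ad}_G(\tilde\Gamma))$; - a subtorus $S_{cpt}\subset T_{cpt}$ with $T_{cpt}=S_{cpt}\times S_{cpt}^\perp$; - a splitting $\mathcal A(\mathrm{Ad}_G(G))=(A\times T_{cpt})\ltimes U$ with $A$ a maximal (connected) $\mathbb R$-split torus and $U$ the unipotent radical, i.e. the subgroup of all unipotent elements. Let $\pi:G\to S_{cpt}$ be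 the composition of $\mathrm{Ad}:G\to\mathcal A(\mathrm{Ad}_G(G))$ with the projections $\mathcal A(\mathrm{Ad}_G(G))\to T_{cpt}\to S_{cpt}$, and let $\sigma(g)=\pi(g)^{-1}$. Then the action of $S_{cpt}\subset\mathrm{Aut}(\mathfrak g)$ on $\mathfrak g$ lifts to an action on $G$ by Lie group automorphisms. In $S_{cpt}\ltimes G$, where $(s,a)(t,b)=(st,\,t^{-1}(a)\,b)$, put $\Delta(g)=(\sigma(g),g)$ and $\tilde G=\Delta(G)$. The set $\tilde G$ is a subgroup and, with the manifold structure carried over from $G$ by $\Delta$, a Lie group embedded in $S_{cpt}\ltimes G$; the map $\sigma$ is smooth, and $\sigma_*$ takes values in the Lie algebra $\mathfrak s\subset\mathrm{End}(\mathfrak g)$ of $S_{cpt}$. The differential at the identity of the inclusion $\tilde G\subset S_{cpt}\ltimes G$ identifies the Lie algebra $\tilde{\mathfrak g}$ of $\tilde G$ with $$\tilde{\mathfrak g}=\{(\sigma_*(X),X)\mid X\in\mathfrak g\}\subset\mathfrak s\oplus\mathfrak g ,$$ and the Lie bracket is $$[(\sigma_*X,X),(\sigma_*Y,Y)]=\bigl(0,\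 [X,Y]+\mathrm{ad}(\sigma_*X)(Y)-\mathrm{ad}(\sigma_*Y)(X)\bigr),$$ where $\mathrm{ad}(A)(Y)=A(Y)$ for $A\in\mathfrak s\subset\mathrm{End}(\mathfrak g)$ and $Y\in\mathfrak g$. Equivalently, with $X_{\mathfrak s}:=\pi_*(X)=-\sigma_*(X)$ one has $\tilde{\mathfrak g}=\{(-X_{\mathfrak s},X)\mid X\in\mathfrak g\}$ with $$[(-X_{\mathfrak s},X),(-Y_{\mathfrak s},Y)]=\bigl(0,\ [X,Y]-\mathrm{ad}(X_{\mathfrak s})(Y)+\mathrm{ad}(Y_{\mathfrak s})(X)\bigr).$$ -/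

import Mathlib

open scoped Manifold ContDiff

noncomputable section

set_option linter.unusedSectionVars false

namespace Nilshadow

/-! ### Real algebraic groups, almost Zariski closures, tori -/

section Linear

variable {V : Type*} [NormedAddCommGroup V] [NormedSpace ℝ V]

/-- The matrix of a linear automorphism with respect to a fixed basis of `V`. -/
def matrixOf [FiniteDimensional ℝ V] (g : (V →L[ℝ] V)ˣ) :
    Matrix (Fin (Module.finrank ℝ V)) (Fin (Module.finrank ℝ V)) ℝ :=
  LinearMap.toMatrix (Module.finBasis ℝ V) (Module.finBasis ℝ V) ((g : V →L[ℝ] V) : V →ₗ[ℝ] V)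

/-- The value at `g ∈ GL(V)` of the regular function given by a polynomial in the `n ^ 2` matrix
entries (variables `some (i, j)`) and in `1 / det g` (variable `none`). -/
def regularValue [FiniteDimensional ℝ V]
    (p : MvPolynomial (Option (Fin (Module.finrank ℝ V) × Fin (Module.finrank ℝ V))) ℝ)
    (g : (V →L[ℝ] V)ˣ) : ℝ :=
  MvPolynomial.eval
    (fun o => Option.elim o (matrixOf g).det⁻¹ (fun ij => matrixOf g ij.1 ij.2)) p

/-- `B` is Zariski closed in `GL(V)`. -/
def IsRealAlgebraic [FiniteDimensional ℝ V] (B : Subgroup (V →L[ℝ] V)ˣ) : Prop :=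
  ∃ P : Set (MvPolynomial
      (Option (Fin (Module.finrank ℝ V) × Fin (Module.finrank ℝ V))) ℝ),
    ∀ g : (V →L[ℝ] V)ˣ, g ∈ B ↔ ∀ p ∈ P, regularValue p g = 0

/-- `B⁰ ⊆ K ⊆ B` for a real algebraic group `B`, where `B⁰` is the identity component of `B` in the
Euclidean topology. -/
def IsAlmostAlgebraic [FiniteDimensional ℝ V] (K : Subgroup (V →L[ℝ] V)ˣ) : Prop :=
  ∃ B : Subgroup (V →L[ℝ] V)ˣ, IsRealAlgebraic B ∧ K ≤ B ∧
    connectedComponentIn (B : Set (V →L[ℝ] V)ˣ) 1 ⊆ K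

/-- The (almost) Zariski closure: the smallest almost algebraic subgroup containing `H`. -/
def algClosure [FiniteDimensional ℝ V] (H : Subgroup (V →L[ℝ] V)ˣ) : Subgroup (V →L[ℝ] V)ˣ :=
  sInf {K | IsAlmostAlgebraic K ∧ H ≤ K}

def IsUnipotentElt (g : (V →L[ℝ] V)ˣ) : Prop := IsNilpotent ((g : V →L[ℝ] V) - 1)

/-- Diagonalizable over `ℝ`. -/
def IsRealDiagonalizable (g : (V →L[ℝ] V)ˣ) : Prop :=
  ⨆ c : ℝ, Module.End.eigenspace ((g : V →L[ℝ] V) : V →ₗ[ℝ] V) c = ⊤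

/-- A compact torus: a compact connected abelian subgroup. -/
def IsCompactTorus (T : Subgroup (V →L[ℝ] V)ˣ) : Prop :=
  IsCompact (T : Set (V →L[ℝ] V)ˣ) ∧ IsConnected (T : Set (V →L[ℝ] V)ˣ) ∧
    ∀ s ∈ T, ∀ t ∈ T, s * t = t * s

def IsMaxCompactTorus (T H : Subgroup (V →L[ℝ] V)ˣ) : Prop :=
  Maximal (fun K => IsCompactTorus K ∧ K ≤ H) T

/-- A (connected) `ℝ`-split torus, i.e. the identity component of a real algebraic torus all of
whose elements are diagonalizable over `ℝ`. -/
def IsSplitTorus [FiniteDimensional ℝ V] (A : Subgroup (V →L[ℝ] V)ˣ) : Prop :=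
  IsAlmostAlgebraic A ∧ IsConnected (A : Set (V →L[ℝ] V)ˣ) ∧
    (∀ s ∈ A, ∀ t ∈ A, s * t = t * s) ∧ ∀ s ∈ A, IsRealDiagonalizable s

def IsMaxSplitTorus [FiniteDimensional ℝ V] (A H : Subgroup (V →L[ℝ] V)ˣ) : Prop :=
  Maximal (fun K => IsSplitTorus K ∧ K ≤ H) A

/-- `U` is the unipotent radical of the (connected solvable) group `H`: the subgroup of all
unipotent elements of `H`. -/
def IsUnipotentRadical (U H : Subgroup (V →L[ℝ] V)ˣ) : Prop :=
  ∀ u, u ∈ U ↔ u ∈ H ∧ IsUnipotentElt u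

/-- The Lie algebra of a closed linear group. -/
def linearLieAlgebra (S : Subgroup (V →L[ℝ] V)ˣ) : Set (V →L[ℝ] V) :=
  {A | ∀ t : ℝ, ∃ s ∈ S, (s : V →L[ℝ] V) = NormedSpace.exp (t • A)}

theorem IsUnipotentElt.conj {u : (V →L[ℝ] V)ˣ} (hu : IsUnipotentElt u) (g : (V →L[ℝ] V)ˣ) :
    IsUnipotentElt (g⁻¹ * u * g) := by
  obtain ⟨n, hn⟩ := hu
  refine ⟨n, ?_⟩
  have h : (((g⁻¹ * u * g : (V →L[ℝ] V)ˣ) : V →L[ℝ] V) - 1)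
      = ((g⁻¹ : (V →L[ℝ] V)ˣ) : V →L[ℝ] V) * ((u : V →L[ℝ] V) - 1) * (g : V →L[ℝ] V) := by
    rw [mul_sub, sub_mul]
    simp
  rw [h, Units.conj_pow', hn]
  simp

end Linear

/-! ### Differentials and the adjoint representation -/

section Differential

variable {E : Type*} [NormedAddCommGroup E] [NormedSpace ℝ E]
  {E' : Type*} [NormedAddCommGroup E'] [NormedSpace ℝ E']
  {E'' : Type*} [NormedAddCommGroup E''] [NormedSpace ℝ E'']
  {M : Type*} [TopologicalSpace M] [ChartedSpace E M]
  {M' : Type*} [TopologicalSpace M'] [ChartedSpace E' M']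
  {M'' : Type*} [TopologicalSpace M''] [ChartedSpace E'' M'']

/-- The differential of `f` at `x`; every tangent space of a manifold modelled on `E` is, by
definition, a copy of `E`. -/
def differential (f : M → M') (x : M) : E →L[ℝ] E' := mfderiv 𝓘(ℝ, E) 𝓘(ℝ, E') f x

theorem differential_comp {f : M' → M''} {g : M → M'} {x : M}
    (hf : MDifferentiableAt 𝓘(ℝ, E') 𝓘(ℝ, E'') f (g x))
    (hg : MDifferentiableAt 𝓘(ℝ, E) 𝓘(ℝ, E') g x) :
    (differential (f ∘ g) x : E →L[ℝ] E'')
      = (differential f (g x) : E' →L[ℝ] E'').comp (differential g x : E →L[ℝ] E') :=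
  mfderiv_comp x hf hg

end Differential

section LieGroup

variable {E : Type*} [NormedAddCommGroup E] [NormedSpace ℝ E] [FiniteDimensional ℝ E]
  {G : Type*} [TopologicalSpace G] [ChartedSpace E G] [Group G] [LieGroup 𝓘(ℝ, E) ∞ G]

theorem mdifferentiable_conj (g : G) :
    MDifferentiable 𝓘(ℝ, E) 𝓘(ℝ, E) (fun x : G => g * x * g⁻¹) :=
  ((contMDiff_mul_right (I := 𝓘(ℝ, E)) (n := ∞) (a := g⁻¹)).comp
    (contMDiff_mul_left (I := 𝓘(ℝ, E)) (n := ∞) (a := g))).mdifferentiable (by simp)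

variable (E) in
/-- The adjoint representation of `G` on its Lie algebra `𝔤 = T₁G` (a copy of `E`): the
differential at `1` of the conjugations. -/
def Ad : G →* (E →L[ℝ] E)ˣ :=
  MonoidHom.toHomUnits
    { toFun := fun g => differential (fun x : G => g * x * g⁻¹) 1
      map_one' := by
        have h : (fun x : G => 1 * x * 1⁻¹) = id := by funext x; simp
        rw [h]
        exact mfderiv_id
      map_mul' := fun g h => by
        have hc : (fun x : G => g * h * x * (g * h)⁻¹)
            = (fun x : G => g * x * g⁻¹) ∘ (fun x : G => h * x * h⁻¹) := by
          funext x; simp [mul_assoc]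
        rw [hc, differential_comp (mdifferentiable_conj g _) (mdifferentiable_conj h _)]
        have h1 : h * 1 * h⁻¹ = 1 := by simp
        simp only [h1]
        rfl }

theorem Ad_val (g : G) :
    ((Ad E g : (E →L[ℝ] E)ˣ) : E →L[ℝ] E) = differential (fun x : G => g * x * g⁻¹) 1 := rfl

variable (E G) in
/-- `𝒜(Ad_G(G))`. -/
def adHull : Subgroup (E →L[ℝ] E)ˣ := algClosure (Ad E : G →* (E →L[ℝ] E)ˣ).range

variable (E) in
/-- `𝒜(Ad_G(Γ))`. -/
def adHullOf (Γ : Subgroup G) : Subgroup (E →L[ℝ] E)ˣ := algClosure (Γ.map (Ad E))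

theorem Ad_mem_adHull (g : G) : Ad E g ∈ adHull E G := by
  unfold adHull algClosure
  rw [Subgroup.mem_sInf]
  exact fun K hK => hK.2 ⟨g, rfl⟩

/-! ### The subtorus to be killed and the homomorphism `σ` -/

variable (E) in
/-- The choices made in killing a compact torus: a maximal compact torus `T` of `𝒜(Ad_G(G))`
containing a maximal compact torus `Sperp` of `𝒜(Ad_G(Γ'))`, a subtorus `S` of `T` complementary to
`Sperp`, and a splitting `𝒜(Ad_G(G)) = (A × T) ⋉ U` with `A` a maximal `ℝ`-split torus and `U` the
unipotent radical. -/
structure KillingData (Γ' : Subgroup G) where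
  T : Subgroup (E →L[ℝ] E)ˣ
  Sperp : Subgroup (E →L[ℝ] E)ˣ
  S : Subgroup (E →L[ℝ] E)ˣ
  A : Subgroup (E →L[ℝ] E)ˣ
  U : Subgroup (E →L[ℝ] E)ˣ
  T_max : IsMaxCompactTorus T (adHull E G)
  Sperp_max : IsMaxCompactTorus Sperp (adHullOf E Γ')
  Sperp_le : Sperp ≤ T
  S_torus : IsCompactTorus S
  S_le : S ≤ T
  T_eq_prod : ∀ t ∈ T, ∃! p : S × Sperp, t = p.1 * p.2
  A_max : IsMaxSplitTorus A (adHull E G)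
  A_comm_T : ∀ a ∈ A, ∀ t ∈ T, a * t = t * a
  U_rad : IsUnipotentRadical U (adHull E G)
  splitting : ∀ x ∈ adHull E G, ∃! p : A × T × U, x = p.1 * p.2.1 * p.2.2

namespace KillingData

variable {Γ' : Subgroup G} (D : KillingData E Γ')

theorem T_comm {s t : (E →L[ℝ] E)ˣ} (hs : s ∈ D.T) (ht : t ∈ D.T) : s * t = t * s :=
  D.T_max.prop.1.2.2 s hs t ht

/-- The projection `𝒜(Ad_G(G)) = (A × T) ⋉ U → T`. -/
def projTFun (x : adHull E G) : D.T := (D.splitting x.1 x.2).choose.2.1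

theorem projTFun_eq {x : adHull E G} {a t u : (E →L[ℝ] E)ˣ} (ha : a ∈ D.A) (ht : t ∈ D.T)
    (hu : u ∈ D.U) (h : (x : (E →L[ℝ] E)ˣ) = a * t * u) : D.projTFun x = ⟨t, ht⟩ := by
  have := (D.splitting x.1 x.2).choose_spec.2 (⟨a, ha⟩, ⟨t, ht⟩, ⟨u, hu⟩) h
  rw [projTFun, ← this]

theorem exists_eq (x : adHull E G) : ∃ a ∈ D.A, ∃ u ∈ D.U,
    (x : (E →L[ℝ] E)ˣ) = a * (D.projTFun x : (E →L[ℝ] E)ˣ) * u :=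
  ⟨_, (D.splitting x.1 x.2).choose.1.2, _, (D.splitting x.1 x.2).choose.2.2.2,
    (D.splitting x.1 x.2).choose_spec.1⟩

theorem conj_mem_U {u g : (E →L[ℝ] E)ˣ} (hu : u ∈ D.U) (hg : g ∈ adHull E G) :
    g⁻¹ * u * g ∈ D.U := by
  have h := (D.U_rad u).1 hu
  exact (D.U_rad _).2 ⟨mul_mem (mul_mem (inv_mem hg) h.1) hg, h.2.conj g⟩

/-- The projection `𝒜(Ad_G(G)) = (A × T) ⋉ U → T` as a homomorphism. -/
def projT : adHull E G →* D.T where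
  toFun := D.projTFun
  map_one' := D.projTFun_eq (one_mem _) (one_mem _) (one_mem _) (by simp)
  map_mul' x y := by
    obtain ⟨a, ha, u, hu, hx⟩ := D.exists_eq x
    obtain ⟨b, hb, v, hv, hy⟩ := D.exists_eq y
    set s := D.projTFun x
    set t := D.projTFun y
    have hbH : b ∈ adHull E G := D.A_max.prop.2 hb
    have htH : (t : (E →L[ℝ] E)ˣ) ∈ adHull E G := D.T_max.prop.2 t.2
    refine D.projTFun_eq (t := s * t) (mul_mem ha hb) (mul_mem s.2 t.2)
      (mul_mem (D.conj_mem_U hu (mul_mem hbH htH)) hv) ?_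
    have hc : b * (s : (E →L[ℝ] E)ˣ) = s * b := D.A_comm_T b hb s s.2
    rw [Subgroup.coe_mul, hx, hy]
    calc a * (s : (E →L[ℝ] E)ˣ) * u * (b * t * v)
        = a * (s * b) * t * ((b * t)⁻¹ * u * (b * t) * v) := by group
      _ = a * b * (s * t) * ((b * t)⁻¹ * u * (b * t) * v) := by rw [← hc]; group

/-- The projection `T = S × Sperp → S`. -/
def projSFun (t : D.T) : D.S := (D.T_eq_prod t.1 t.2).choose.1

theorem projSFun_eq {t : D.T} {s r : (E →L[ℝ] E)ˣ} (hs : s ∈ D.S) (hr : r ∈ D.Sperp)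
    (h : (t : (E →L[ℝ] E)ˣ) = s * r) : D.projSFun t = ⟨s, hs⟩ := by
  have := (D.T_eq_prod t.1 t.2).choose_spec.2 (⟨s, hs⟩, ⟨r, hr⟩) h
  rw [projSFun, ← this]

theorem exists_eq_S (t : D.T) : ∃ r ∈ D.Sperp,
    (t : (E →L[ℝ] E)ˣ) = (D.projSFun t : (E →L[ℝ] E)ˣ) * r :=
  ⟨_, (D.T_eq_prod t.1 t.2).choose.2.2, (D.T_eq_prod t.1 t.2).choose_spec.1⟩

/-- The projection `T = S × Sperp → S` as a homomorphism. -/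
def projS : D.T →* D.S where
  toFun := D.projSFun
  map_one' := D.projSFun_eq (one_mem _) (one_mem _) (by simp)
  map_mul' x y := by
    obtain ⟨q, hq, hx⟩ := D.exists_eq_S x
    obtain ⟨r, hr, hy⟩ := D.exists_eq_S y
    set s := D.projSFun x
    set t := D.projSFun y
    refine D.projSFun_eq (s := s * t) (mul_mem s.2 t.2) (mul_mem hq hr) ?_
    have hc : q * (t : (E →L[ℝ] E)ˣ) = t * q := D.T_comm (D.Sperp_le hq) (D.S_le t.2)
    rw [Subgroup.coe_mul, hx, hy]
    calc (s : (E →L[ℝ] E)ˣ) * q * (t * r) = s * (q * t) * r := by group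
      _ = s * t * (q * r) := by rw [hc]; group

/-- The homomorphism `G → 𝒜(Ad_G(G)) → T → S` onto the torus to be killed. -/
def proj : G →* D.S :=
  (D.projS.comp D.projT).comp ((Ad E).codRestrict (adHull E G) Ad_mem_adHull)

/-- `σ : G → 𝒜(Ad_G(G)) → T → S → S`, the last map being `x ↦ x⁻¹`. -/
def sigma : G →* D.S where
  toFun g := (D.proj g)⁻¹
  map_one' := by simp
  map_mul' a b := by
    rw [map_mul, mul_inv_rev]
    refine Subtype.ext ?_
    simp only [Subgroup.coe_mul]
    exact D.T_comm (D.S_le (D.proj b)⁻¹.2) (D.S_le (D.proj a)⁻¹.2)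

/-! ### The action of `S` on `G`, the map `Δ` and the group `G̃ = Δ(G)` -/

/-- `φ` is the action of `S ⊆ Aut(𝔤)` on `G` by Lie group automorphisms with the prescribed
differentials at `1`. -/
def IsLift (φ : D.S →* MulAut G) : Prop :=
  ∀ s : D.S, ContMDiff 𝓘(ℝ, E) 𝓘(ℝ, E) ∞ (φ s : G → G) ∧
    (differential (φ s : G → G) 1 : E →L[ℝ] E) = ((s : (E →L[ℝ] E)ˣ) : E →L[ℝ] E)

open Classical in
/-- The action of `S` on `G`: the one that lifts the action on `𝔤` (`G` being connected, there is
at most one; where there is none, the trivial action stands in). -/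
def action : D.S →* MulAut G := if h : ∃ φ, D.IsLift φ then h.choose else 1

theorem sigma_action (s : D.S) (g : G) : D.sigma (D.action s g) = D.sigma g := by
  unfold action
  split_ifs with h
  · have hL := h.choose_spec
    set φ := h.choose
    suffices hp : D.proj (φ s g) = D.proj g by
      change (D.proj (φ s g))⁻¹ = (D.proj g)⁻¹
      rw [hp]
    have hd : ∀ r : D.S, MDifferentiable 𝓘(ℝ, E) 𝓘(ℝ, E) (φ r : G → G) := fun r =>
      (hL r).1.mdifferentiable (by simp)
    have key : Ad E (φ s g) * (s : (E →L[ℝ] E)ˣ) = s * Ad E g := by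
      refine Units.ext ?_
      rw [Units.val_mul, Units.val_mul, Ad_val, Ad_val, ← (hL s).2]
      have e : (fun x : G => φ s g * x * (φ s g)⁻¹) ∘ (φ s : G → G)
          = (φ s : G → G) ∘ (fun x : G => g * x * g⁻¹) := by
        funext x; simp
      have h1 := differential_comp (E := E) (E' := E) (E'' := E) (x := (1 : G))
        (mdifferentiable_conj (φ s g) _) (hd s 1)
      have h2 := differential_comp (E := E) (E' := E) (E'' := E) (x := (1 : G))
        (hd s _) (mdifferentiable_conj g 1)
      rw [e, h2] at h1
      have h3 : g * 1 * g⁻¹ = 1 := by simp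
      simp only [map_one, h3] at h1
      exact h1.symm
    have hsT : (s : (E →L[ℝ] E)ˣ) ∈ D.T := D.S_le s.2
    have hsH : (s : (E →L[ℝ] E)ˣ) ∈ adHull E G := D.T_max.prop.2 hsT
    have key' : D.projT ⟨Ad E (φ s g), Ad_mem_adHull _⟩ * D.projT ⟨s, hsH⟩
        = D.projT ⟨s, hsH⟩ * D.projT ⟨Ad E g, Ad_mem_adHull _⟩ := by
      rw [← map_mul, ← map_mul]
      congr 1
      exact Subtype.ext key
    have hcomm : D.projT ⟨s, hsH⟩ * D.projT ⟨Ad E g, Ad_mem_adHull _⟩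
        = D.projT ⟨Ad E g, Ad_mem_adHull _⟩ * D.projT ⟨s, hsH⟩ :=
      Subtype.ext (D.T_comm (D.projT _).2 (D.projT _).2)
    rw [hcomm] at key'
    exact congrArg D.projS (mul_right_cancel key')
  · rfl

/-- The semidirect product `S ⋉ G`; the pair `(s, g)` is the element `s · g`. -/
abbrev Ambient : Type _ := G ⋊[D.action] D.S

/-- The element `(s, g) = s · g` of `S ⋉ G`. -/
def pair (s : D.S) (g : G) : D.Ambient := SemidirectProduct.inr s * SemidirectProduct.inl g

/-- The coordinate `g` of `(s, g) = s · g`. -/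
def coordG (x : D.Ambient) : G := (D.action x.right)⁻¹ x.left

/-- `Δ : G → S ⋉ G`, `g ↦ (σ(g), g)`. -/
def Delta (g : G) : D.Ambient := D.pair (D.sigma g) g

theorem pair_mul_pair (s t : D.S) (a b : G) :
    D.pair s a * D.pair t b = D.pair (s * t) ((D.action t)⁻¹ a * b) := by
  unfold pair
  ext <;> simp

theorem Delta_mul_Delta (a b : G) :
    D.Delta a * D.Delta b = D.Delta ((D.action (D.sigma b))⁻¹ a * b) := by
  unfold Delta
  rw [pair_mul_pair, map_mul, ← map_inv, sigma_action]

theorem Delta_one : D.Delta 1 = 1 := by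
  unfold Delta pair
  simp

/-- The subgroup `Δ(G)` of `S ⋉ G`. -/
def imageSubgroup : Subgroup D.Ambient where
  carrier := Set.range D.Delta
  one_mem' := ⟨1, D.Delta_one⟩
  mul_mem' := by
    rintro _ _ ⟨a, rfl⟩ ⟨b, rfl⟩
    exact ⟨_, (D.Delta_mul_Delta a b).symm⟩
  inv_mem' := by
    rintro _ ⟨a, rfl⟩
    refine ⟨D.action (D.sigma a) a⁻¹, ?_⟩
    rw [eq_inv_iff_mul_eq_one, Delta_mul_Delta]
    simp [Delta_one]

/-- The group `G̃ = Δ(G) ⊆ S ⋉ G`. -/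
def Gt : Type _ := D.imageSubgroup

instance : Group D.Gt := inferInstanceAs (Group D.imageSubgroup)

/-- The component in `S ⊆ GL(𝔤) ⊆ End(𝔤)` of an element `(s, g)` of `G̃`. -/
def toEnd (x : D.Gt) : E →L[ℝ] E := ((x.1.right : (E →L[ℝ] E)ˣ) : E →L[ℝ] E)

/-- The component in `G` of an element `(s, g)` of `G̃`. -/
def toG (x : D.Gt) : G := D.coordG x.1

theorem coordG_Delta (g : G) : D.coordG (D.Delta g) = g := by
  simp [coordG, Delta, pair]

/-- The bijection `Δ : G → G̃`, with inverse `(s, g) ↦ g`. -/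
def equivG : D.Gt ≃ G where
  toFun := D.toG
  invFun g := ⟨D.Delta g, g, rfl⟩
  left_inv := by
    rintro ⟨_, g, rfl⟩
    exact Subtype.ext (congrArg D.Delta (D.coordG_Delta g))
  right_inv g := D.coordG_Delta g

/-- The topology of `G̃ = Δ(G)`, carried over from `G` by the bijection `Δ`. -/
instance : TopologicalSpace D.Gt := TopologicalSpace.induced D.equivG inferInstance

def homeoG : D.Gt ≃ₜ G := D.equivG.toHomeomorphOfIsInducing ⟨rfl⟩

/-- The manifold structure of `G̃ = Δ(G)` that makes `Δ : G → G̃` a diffeomorphism. -/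
instance : ChartedSpace E D.Gt where
  atlas := {e | ∃ c ∈ atlas E G, e = D.homeoG.toOpenPartialHomeomorph.trans c}
  chartAt x := D.homeoG.toOpenPartialHomeomorph.trans (chartAt E (D.homeoG x))
  mem_chart_source x := by simp
  chart_mem_atlas x := ⟨_, chart_mem_atlas E _, rfl⟩

/-- `π_* : 𝔤 → End(𝔤)` for the projection `π : G → S ⊆ GL(𝔤)`; here `X_𝔰 = π_*(X)`. -/
def projStar : E →L[ℝ] (E →L[ℝ] E) :=
  differential (fun g : G => ((D.proj g : (E →L[ℝ] E)ˣ) : E →L[ℝ] E)) 1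

/-- `σ_* : 𝔤 → End(𝔤)`. -/
def sigmaStar : E →L[ℝ] (E →L[ℝ] E) :=
  differential (fun g : G => ((D.sigma g : (E →L[ℝ] E)ˣ) : E →L[ℝ] E)) 1

/-- The differential at `1` of the inclusion `G̃ ⊆ S ⋉ G`, in the coordinates `(s, g)`. -/
def inclStar (v : GroupLieAlgebra 𝓘(ℝ, E) D.Gt) :
    (E →L[ℝ] E) × GroupLieAlgebra 𝓘(ℝ, E) G :=
  ((differential D.toEnd 1 : E →L[ℝ] (E →L[ℝ] E)) v, (differential D.toG 1 : E →L[ℝ] E) v)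

end KillingData

/-- `ad(A)(Y)` for `A ∈ 𝔰 ⊆ End(𝔤)` and `Y ∈ 𝔤`: since `s ∈ S` acts on `𝔤` by the linear map `s`
itself, `ad(A)` is the endomorphism `A` of `𝔤`. -/
def adAct (A : E →L[ℝ] E) (Y : GroupLieAlgebra 𝓘(ℝ, E) G) : GroupLieAlgebra 𝓘(ℝ, E) G :=
  A Y

end LieGroup

end Nilshadow

end

/-! The formal core is short. Since `S` is abelian, `σ` is a homomorphism that is invariant under
conjugation, and by `sigma_action` it is invariant under the action of `S`. In the coordinate `g` of
`(σ(g), g)` the product of `G̃` is therefore `a * b = π(b)(a) · b`. Everything else is calculus on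
this formula, plus two facts that the algebraic data do not supply directly: the action of `S`
exists on `G`, and `π` is smooth.

Existence of the action. Being an automorphism of `𝔤` is a polynomial condition satisfied by every
`Ad g`, so it holds on the whole almost Zariski closure and in particular on `S`
(`adHull_le_bilinAut`). A Lie algebra endomorphism `h` gives the local homomorphism `exp ∘ h ∘ log`
(`exists_isOpen_lieExp_lieLog_mul`), which extends to the simply connected group `G` by lifting the
identity through a covering (`exists_monoidHom_eventuallyEq`). The Lie group exponential is built
here from integral curves of left invariant fields; its differential, computed in
`hasLogDerivAt_lieExp`, is natural in `h`, and that naturality makes the local homomorphism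
multiplicative.

Smoothness of `π`. The splitting is only a unique factorisation of group elements, so no continuity
comes with it. But `A`, `Sperp` and unipotence are closed conditions, which makes the graph of `π`
σ-compact; the open mapping theorem for groups gives continuity (`continuous_proj`), and continuous
homomorphisms into a Banach algebra are smooth (`contMDiff_of_continuous`). Hence the action twisted
by `π` is smooth and `G̃` is a Lie group.

The bracket. In the preferred chart at the identity the bracket is the antisymmetrised mixed second
derivative of the multiplication (`bracket_eq_mulHessian`). Differentiating `π(b)(a) · b` adds one
term `π_*(Y)(X)` to the mixed derivative (`mulHessian_Gt`); antisymmetrising gives the twisted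
bracket. Its first coordinate vanishes because the two invariance properties of `σ` say that `σ_*`
kills `[X, Y]` and `σ_*(X)(Y)`. -/

noncomputable section

set_option linter.unusedSectionVars false

namespace Nilshadow

open Filter Topology

/-! ### The preferred chart at the identity -/

section Chart

variable {E : Type*} [NormedAddCommGroup E] [NormedSpace ℝ E] [FiniteDimensional ℝ E]
  {G : Type*} [TopologicalSpace G] [ChartedSpace E G] [Group G]
  {F : Type*} [NormedAddCommGroup F] [NormedSpace ℝ F]

variable (E G) in
/-- The preferred chart at the identity. -/
def oneChart : PartialEquiv G E := extChartAt 𝓘(ℝ, E) (1 : G)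

variable (E G) in
/-- The coordinates of the identity in the preferred chart. -/
def oneCoord : E := oneChart E G 1

theorem oneChart_symm_oneCoord : (oneChart E G).symm (oneCoord E G) = 1 :=
  extChartAt_to_inv (I := 𝓘(ℝ, E)) (1 : G)

theorem oneChart_source_mem_nhds : (oneChart E G).source ∈ 𝓝 (1 : G) :=
  extChartAt_source_mem_nhds (I := 𝓘(ℝ, E)) (1 : G)

theorem isOpen_oneChart_source : IsOpen (oneChart E G).source :=
  isOpen_extChartAt_source (I := 𝓘(ℝ, E)) (1 : G)

theorem oneChart_target_mem_nhds : (oneChart E G).target ∈ 𝓝 (oneCoord E G) :=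
  extChartAt_target_mem_nhds (I := 𝓘(ℝ, E)) (1 : G)

theorem isOpen_oneChart_target : IsOpen (oneChart E G).target :=
  isOpen_extChartAt_target (I := 𝓘(ℝ, E)) (1 : G)

theorem eventually_oneChart_left_inv :
    ∀ᶠ g in 𝓝 (1 : G), (oneChart E G).symm (oneChart E G g) = g := by
  filter_upwards [oneChart_source_mem_nhds (E := E)] with g hg using (oneChart E G).left_inv hg

theorem continuousAt_oneChart : ContinuousAt (oneChart E G) 1 :=
  continuousAt_extChartAt (I := 𝓘(ℝ, E)) (1 : G)

theorem continuousAt_oneChart_symm : ContinuousAt (oneChart E G).symm (oneCoord E G) :=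
  continuousAt_extChartAt_symm (I := 𝓘(ℝ, E)) (1 : G)

theorem tendsto_oneChart_symm : Tendsto (oneChart E G).symm (𝓝 (oneCoord E G)) (𝓝 1) := by
  have := continuousAt_oneChart_symm (E := E) (G := G)
  rwa [ContinuousAt, oneChart_symm_oneCoord] at this

theorem tendsto_oneChart : Tendsto (oneChart E G) (𝓝 1) (𝓝 (oneCoord E G)) :=
  continuousAt_oneChart

section Smooth

variable [IsManifold 𝓘(ℝ, E) ∞ G]

theorem contMDiffAt_oneChart {g : G} (hg : g ∈ (oneChart E G).source) :
    ContMDiffAt 𝓘(ℝ, E) 𝓘(ℝ, E) ∞ (oneChart E G) g :=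
  contMDiffAt_extChartAt' (by simpa [oneChart] using hg)

theorem contMDiffAt_oneChart_symm {z : E} (hz : z ∈ (oneChart E G).target) :
    ContMDiffAt 𝓘(ℝ, E) 𝓘(ℝ, E) ∞ (oneChart E G).symm z :=
  (contMDiffOn_extChartAt_symm (I := 𝓘(ℝ, E)) (n := ∞) (1 : G)).contMDiffAt
    (isOpen_oneChart_target.mem_nhds hz)

theorem one_mem_oneChart_source : (1 : G) ∈ (oneChart E G).source :=
  mem_extChartAt_source (I := 𝓘(ℝ, E)) (1 : G)

theorem oneCoord_mem_target : oneCoord E G ∈ (oneChart E G).target :=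
  mem_extChartAt_target (I := 𝓘(ℝ, E)) (1 : G)

theorem contDiffAt_oneChart_comp {f : F → G} {x : F} {n : WithTop ℕ∞} (hn : n ≤ ∞)
    (hf : ContMDiffAt 𝓘(ℝ, F) 𝓘(ℝ, E) n f x) (hx : f x ∈ (oneChart E G).source) :
    ContDiffAt ℝ n (fun y => oneChart E G (f y)) x :=
  contMDiffAt_iff_contDiffAt.1 (((contMDiffAt_oneChart hx).of_le hn).comp x hf)

theorem contMDiffAt_oneChart_symm_comp {f : F → E} {x : F} {n : WithTop ℕ∞} (hn : n ≤ ∞)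
    (hf : ContDiffAt ℝ n f x) (hx : f x ∈ (oneChart E G).target) :
    ContMDiffAt 𝓘(ℝ, F) 𝓘(ℝ, E) n (fun y => (oneChart E G).symm (f y)) x :=
  ((contMDiffAt_oneChart_symm hx).of_le hn).comp x hf.contMDiffAt

/-- The differential at the identity in the preferred chart. -/
theorem differential_one_eq_fderiv {f : G → G} (hf : MDifferentiableAt 𝓘(ℝ, E) 𝓘(ℝ, E) f 1)
    (h1 : f 1 = 1) : (differential f 1 : E →L[ℝ] E)
      = fderiv ℝ (fun z => oneChart E G (f ((oneChart E G).symm z))) (oneCoord E G) := by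
  have h2 : writtenInExtChartAt 𝓘(ℝ, E) 𝓘(ℝ, E) 1 f
      = fun z => oneChart E G (f ((oneChart E G).symm z)) := by
    unfold writtenInExtChartAt
    rw [h1]
    rfl
  refine (hf.mfderiv : differential f 1 = _).trans ?_
  rw [h2]
  simp only [modelWithCornersSelf_coe, Set.range_id, fderivWithin_univ]
  rfl

theorem differential_one_eq_fderiv' {f : G → F} (hf : MDifferentiableAt 𝓘(ℝ, E) 𝓘(ℝ, F) f 1) :
    (differential f 1 : E →L[ℝ] F)
      = fderiv ℝ (fun z => f ((oneChart E G).symm z)) (oneCoord E G) := by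
  have h2 : writtenInExtChartAt 𝓘(ℝ, E) 𝓘(ℝ, F) 1 f
      = fun z => f ((oneChart E G).symm z) := rfl
  refine (hf.mfderiv : differential f 1 = _).trans ?_
  rw [h2]
  simp only [modelWithCornersSelf_coe, Set.range_id, fderivWithin_univ]
  rfl

end Smooth

end Chart

/-! ### First and second order expansion of the multiplication -/

section Mul

variable {E : Type*} [NormedAddCommGroup E] [NormedSpace ℝ E] [FiniteDimensional ℝ E]
  {G : Type*} [TopologicalSpace G] [ChartedSpace E G] [Group G] [LieGroup 𝓘(ℝ, E) ∞ G]
  {F : Type*} [NormedAddCommGroup F] [NormedSpace ℝ F]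

variable (E G) in
/-- The multiplication in the preferred chart at the identity. -/
def chartMul (p : E × E) : E :=
  oneChart E G ((oneChart E G).symm p.1 * (oneChart E G).symm p.2)

theorem contDiffAt_chartMul' {p : E × E} (h1 : p.1 ∈ (oneChart E G).target)
    (h2 : p.2 ∈ (oneChart E G).target)
    (h : (oneChart E G).symm p.1 * (oneChart E G).symm p.2 ∈ (oneChart E G).source) :
    ContDiffAt ℝ ∞ (chartMul E G) p :=
  contDiffAt_oneChart_comp le_rfl
    ((contMDiffAt_oneChart_symm_comp le_rfl contDiffAt_fst h1).mul
      (contMDiffAt_oneChart_symm_comp le_rfl contDiffAt_snd h2)) h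

theorem contDiffAt_chartMul : ContDiffAt ℝ ∞ (chartMul E G) (oneCoord E G, oneCoord E G) := by
  refine contDiffAt_chartMul' oneCoord_mem_target oneCoord_mem_target ?_
  simp only [oneChart_symm_oneCoord, mul_one]
  exact one_mem_oneChart_source

theorem chartMul_oneCoord_right {z : E} (hz : z ∈ (oneChart E G).target) :
    chartMul E G (z, oneCoord E G) = z := by
  simp [chartMul, oneChart_symm_oneCoord, (oneChart E G).right_inv hz]

theorem chartMul_oneCoord_left {z : E} (hz : z ∈ (oneChart E G).target) :
    chartMul E G (oneCoord E G, z) = z := by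
  simp [chartMul, oneChart_symm_oneCoord, (oneChart E G).right_inv hz]

/-- Multiplying by the identity on either side fixes points, so the derivative restricts to the
identity on each of the two axes of `E × E`. -/
theorem hasFDerivAt_chartMul : HasFDerivAt (chartMul E G)
    (ContinuousLinearMap.fst ℝ E E + ContinuousLinearMap.snd ℝ E E)
    (oneCoord E G, oneCoord E G) := by
  have hd : HasFDerivAt (chartMul E G) _ (oneCoord E G, oneCoord E G) :=
    ((contDiffAt_chartMul (E := E) (G := G)).differentiableAt (by simp)).hasFDerivAt
  convert! hd using 1
  set D := fderiv ℝ (chartMul E G) (oneCoord E G, oneCoord E G)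
  have hl : D.comp (ContinuousLinearMap.inl ℝ E E) = ContinuousLinearMap.id ℝ E := by
    have h1 : HasFDerivAt (fun z : E => chartMul E G (z, oneCoord E G))
        (D.comp (ContinuousLinearMap.inl ℝ E E)) (oneCoord E G) :=
      HasFDerivAt.comp (g := chartMul E G) (f := fun z : E => (z, oneCoord E G)) (oneCoord E G) hd
        (hasFDerivAt_prodMk_left (oneCoord E G) (oneCoord E G))
    refine h1.unique ((hasFDerivAt_id (𝕜 := ℝ) (oneCoord E G)).congr_of_eventuallyEq ?_)
    filter_upwards [oneChart_target_mem_nhds (E := E) (G := G)] with z hz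
    exact chartMul_oneCoord_right hz
  have hr : D.comp (ContinuousLinearMap.inr ℝ E E) = ContinuousLinearMap.id ℝ E := by
    have h1 : HasFDerivAt (fun z : E => chartMul E G (oneCoord E G, z))
        (D.comp (ContinuousLinearMap.inr ℝ E E)) (oneCoord E G) :=
      HasFDerivAt.comp (g := chartMul E G) (f := fun z : E => (oneCoord E G, z)) (oneCoord E G) hd
        (hasFDerivAt_prodMk_right (oneCoord E G) (oneCoord E G))
    refine h1.unique ((hasFDerivAt_id (𝕜 := ℝ) (oneCoord E G)).congr_of_eventuallyEq ?_)
    filter_upwards [oneChart_target_mem_nhds (E := E) (G := G)] with z hz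
    exact chartMul_oneCoord_left hz
  ext x
  · simpa using (congrArg (fun T => T x) hl).symm
  · simpa using (congrArg (fun T => T x) hr).symm

variable (E G) in
/-- The second derivative at the identity of the multiplication in the preferred chart. -/
def mulHessian : E × E →L[ℝ] E × E →L[ℝ] E :=
  fderiv ℝ (fderiv ℝ (chartMul E G)) (oneCoord E G, oneCoord E G)

theorem hasFDerivAt_fderiv_chartMul : HasFDerivAt (fderiv ℝ (chartMul E G))
    (mulHessian E G) (oneCoord E G, oneCoord E G) :=
  (((contDiffAt_chartMul (E := E) (G := G)).fderiv_right (m := 1) (by norm_cast)).differentiableAt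
    (by simp)).hasFDerivAt

theorem mulHessian_symm (p q : E × E) : mulHessian E G p q = mulHessian E G q p :=
  (contDiffAt_chartMul (E := E) (G := G)).isSymmSndFDerivAt (by simp; norm_cast) p q

end Mul

/-! ### The Lie bracket as an antisymmetrised second derivative -/

section Bracket

variable {E : Type*} [NormedAddCommGroup E] [NormedSpace ℝ E] [FiniteDimensional ℝ E]
  {G : Type*} [TopologicalSpace G] [ChartedSpace E G] [Group G] [LieGroup 𝓘(ℝ, E) ∞ G]

theorem differentiableAt_chartMul_right {z : E} (hz : z ∈ (oneChart E G).target) :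
    DifferentiableAt ℝ (chartMul E G) (z, oneCoord E G) := by
  refine (contDiffAt_chartMul' (p := (z, oneCoord E G)) hz oneCoord_mem_target ?_).differentiableAt
    (by simp)
  simpa [oneChart_symm_oneCoord] using (oneChart E G).map_target hz

theorem differentiableAt_chartMul_left {z : E} (hz : z ∈ (oneChart E G).target) :
    DifferentiableAt ℝ (chartMul E G) (oneCoord E G, z) := by
  refine (contDiffAt_chartMul' (p := (oneCoord E G, z)) oneCoord_mem_target hz ?_).differentiableAt
    (by simp)
  simpa [oneChart_symm_oneCoord] using (oneChart E G).map_target hz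

theorem hasFDerivAt_chartMul_right {z : E} (hz : z ∈ (oneChart E G).target) :
    HasFDerivAt (fun w => chartMul E G (z, w))
      ((fderiv ℝ (chartMul E G) (z, oneCoord E G)).comp (ContinuousLinearMap.inr ℝ E E))
      (oneCoord E G) :=
  HasFDerivAt.comp (g := chartMul E G) (f := fun w : E => (z, w)) (oneCoord E G)
    (differentiableAt_chartMul_right hz).hasFDerivAt (hasFDerivAt_prodMk_right z (oneCoord E G))

theorem hasFDerivAt_chartMul_left {z : E} (hz : z ∈ (oneChart E G).target) :
    HasFDerivAt (fun w => chartMul E G (w, z))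
      ((fderiv ℝ (chartMul E G) (oneCoord E G, z)).comp (ContinuousLinearMap.inl ℝ E E))
      (oneCoord E G) :=
  HasFDerivAt.comp (g := chartMul E G) (f := fun w : E => (w, z)) (oneCoord E G)
    (differentiableAt_chartMul_left hz).hasFDerivAt (hasFDerivAt_prodMk_left (oneCoord E G) z)

theorem mdifferentiableAt_mul_left (g x : G) :
    MDifferentiableAt 𝓘(ℝ, E) 𝓘(ℝ, E) (fun y => g * y) x :=
  (contMDiff_mul_left (I := 𝓘(ℝ, E)) (n := ∞) (a := g)).mdifferentiable (by simp) x

theorem mdifferentiableAt_oneChart {g : G} (hg : g ∈ (oneChart E G).source) :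
    MDifferentiableAt 𝓘(ℝ, E) 𝓘(ℝ, E) (oneChart E G) g :=
  (contMDiffAt_oneChart hg).mdifferentiableAt (by simp)

/-- Left invariant vector fields in the preferred chart. -/
theorem differential_oneChart_mulInvariantVectorField {z : E} (hz : z ∈ (oneChart E G).target)
    (X : E) :
    (differential (oneChart E G) ((oneChart E G).symm z) : E →L[ℝ] E)
      ((differential (fun y : G => (oneChart E G).symm z * y) 1 : E →L[ℝ] E) X)
      = fderiv ℝ (chartMul E G) (z, oneCoord E G) (0, X) := by
  set g := (oneChart E G).symm z with hg
  have hgs : g * 1 ∈ (oneChart E G).source := by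
    rw [mul_one]; exact (oneChart E G).map_target hz
  have h1 := differential_comp (E := E) (E' := E) (E'' := E) (x := (1 : G))
    (f := oneChart E G) (g := fun y : G => g * y)
    (mdifferentiableAt_oneChart hgs) (mdifferentiableAt_mul_left g 1)
  have h2 := differential_one_eq_fderiv' (E := E) (G := G) (F := E)
    (f := (oneChart E G) ∘ fun y : G => g * y)
    ((mdifferentiableAt_oneChart hgs).comp (1 : G) (mdifferentiableAt_mul_left g 1))
  have h3 := (hasFDerivAt_chartMul_right hz).fderiv
  rw [h2] at h1
  have h4 : fderiv ℝ (fun w => chartMul E G (z, w)) (oneCoord E G) = _ := h1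
  rw [h3] at h4
  simp only [mul_one] at h4
  simpa using (congrArg (fun T : E →L[ℝ] E => T X) h4).symm

/-- Pulling back by the inverse chart applies the inverse of its differential, which is the
differential of the chart; this turns the left invariant field into an explicit map `E → E` that can
be differentiated. -/
theorem mpullbackWithin_mulInvariantVectorField {z : E} (hz : z ∈ (oneChart E G).target)
    (X : GroupLieAlgebra 𝓘(ℝ, E) G) :
    VectorField.mpullbackWithin 𝓘(ℝ, E) 𝓘(ℝ, E) (extChartAt 𝓘(ℝ, E) (1 : G)).symm
      (mulInvariantVectorField X) (Set.range 𝓘(ℝ, E)) z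
      = fderiv ℝ (chartMul E G) (z, oneCoord E G) (0, X) := by
  rw [VectorField.mpullbackWithin_apply]
  have h1 : (mfderivWithin 𝓘(ℝ, E) 𝓘(ℝ, E) (extChartAt 𝓘(ℝ, E) (1 : G)).symm
      (Set.range 𝓘(ℝ, E)) z).inverse
      = mfderiv 𝓘(ℝ, E) 𝓘(ℝ, E) (extChartAt 𝓘(ℝ, E) (1 : G))
        ((extChartAt 𝓘(ℝ, E) (1 : G)).symm z) :=
    ContinuousLinearMap.inverse_eq
      (mfderivWithin_extChartAt_symm_comp_mfderiv_extChartAt hz)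
      (mfderiv_extChartAt_comp_mfderivWithin_extChartAt_symm hz)
  rw [h1]
  exact differential_oneChart_mulInvariantVectorField hz X

/-- The bracket of a Lie group in terms of the second derivative of the multiplication. -/
theorem bracket_eq_mulHessian (X Y : GroupLieAlgebra 𝓘(ℝ, E) G) :
    ⁅X, Y⁆ = mulHessian E G ((X : E), 0) (0, (Y : E)) - mulHessian E G ((Y : E), 0) (0, (X : E)) := by
  rw [GroupLieAlgebra.bracket_def, ← VectorField.mlieBracketWithin_univ,
    VectorField.mlieBracketWithin_apply, mfderiv_extChartAt_self]
  -- The tangent space at `1` is identified with `E` by this very chart, so the outer pullback is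
  -- the identity.
  change (ContinuousLinearMap.id ℝ E).inverse _ = _
  rw [ContinuousLinearMap.inverse_id, ContinuousLinearMap.id_apply]
  simp only [Set.preimage_univ, Set.univ_inter, modelWithCornersSelf_coe, Set.range_id]
  have key : ∀ X : E, (VectorField.mpullbackWithin 𝓘(ℝ, E) 𝓘(ℝ, E)
      (extChartAt 𝓘(ℝ, E) (1 : G)).symm
      (mulInvariantVectorField (I := 𝓘(ℝ, E)) (G := G) X) (Set.univ : Set E) : E → E)
      =ᶠ[𝓝 (oneCoord E G)] fun z => fderiv ℝ (chartMul E G) (z, oneCoord E G) (0, X) := by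
    intro X
    filter_upwards [oneChart_target_mem_nhds (E := E) (G := G)] with z hz
    have := mpullbackWithin_mulInvariantVectorField hz X
    rwa [modelWithCornersSelf_coe, Set.range_id] at this
  have hD : ∀ X : E, HasFDerivAt
      (fun z => fderiv ℝ (chartMul E G) (z, oneCoord E G) ((0, X) : E × E))
      ((((mulHessian E G).flip ((0, X) : E × E)).comp (ContinuousLinearMap.inl ℝ E E)))
      (oneCoord E G) := by
    intro X
    have h := HasFDerivAt.comp (g := fderiv ℝ (chartMul E G))
      (f := fun z : E => (z, oneCoord E G)) (oneCoord E G)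
      (hasFDerivAt_fderiv_chartMul (E := E) (G := G))
      (hasFDerivAt_prodMk_left (oneCoord E G) (oneCoord E G))
    have h' := h.clm_apply (hasFDerivAt_const ((0, X) : E × E) (oneCoord E G))
    convert! h' using 1
    ext v
    simp
  have hv : ∀ X : E, fderiv ℝ (chartMul E G) (oneCoord E G, oneCoord E G) (0, X) = X := by
    intro X
    rw [(hasFDerivAt_chartMul (E := E) (G := G)).fderiv]
    simp
  -- Stated for plain maps `E → E`, which keeps tangent space types out of the rewriting.
  have gen : ∀ (X Y : E) (V W : E → E),
      V =ᶠ[𝓝 (oneCoord E G)] (fun z => fderiv ℝ (chartMul E G) (z, oneCoord E G) (0, X)) →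
      W =ᶠ[𝓝 (oneCoord E G)] (fun z => fderiv ℝ (chartMul E G) (z, oneCoord E G) (0, Y)) →
      VectorField.lieBracketWithin ℝ V W Set.univ (oneCoord E G)
        = mulHessian E G (X, 0) (0, Y) - mulHessian E G (Y, 0) (0, X) := by
    intro X Y V W hV hW
    rw [VectorField.lieBracketWithin_univ, VectorField.lieBracket_eq]
    simp only
    rw [hV.fderiv_eq, hW.fderiv_eq, hV.eq_of_nhds, hW.eq_of_nhds, (hD X).fderiv, (hD Y).fderiv,
      hv, hv]
    rfl
  exact gen X Y _ _ (key X) (key Y)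

end Bracket

/-! ### The adjoint representation and its differential -/

section Adjoint

variable {E : Type*} [NormedAddCommGroup E] [NormedSpace ℝ E] [FiniteDimensional ℝ E]
  {G : Type*} [TopologicalSpace G] [ChartedSpace E G] [Group G] [LieGroup 𝓘(ℝ, E) ∞ G]

/-- Conjugation in the preferred chart. -/
theorem hasFDerivAt_conj (g : G) : HasFDerivAt
    (fun z => oneChart E G (g * (oneChart E G).symm z * g⁻¹)) ((Ad E g : (E →L[ℝ] E)ˣ) : E →L[ℝ] E)
    (oneCoord E G) := by
  rw [Ad_val, differential_one_eq_fderiv (mdifferentiable_conj g 1) (by simp)]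
  refine (ContDiffAt.differentiableAt (n := ∞) ?_ (by simp)).hasFDerivAt
  refine contDiffAt_oneChart_comp le_rfl ?_ ?_
  · exact (contMDiffAt_const.mul (contMDiffAt_oneChart_symm oneCoord_mem_target)).mul
      contMDiffAt_const
  · rw [oneChart_symm_oneCoord]
    simpa using one_mem_oneChart_source (E := E) (G := G)

/-- Differentiate `g x = (g x g⁻¹) g` at `x = 1`: left translation by `g` is right translation by
`g` after `Ad g`. -/
theorem fderiv_chartMul_Ad {z : E} (hz : z ∈ (oneChart E G).target) (Y : E) :
    fderiv ℝ (chartMul E G) (oneCoord E G, z)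
      (((Ad E ((oneChart E G).symm z) : (E →L[ℝ] E)ˣ) : E →L[ℝ] E) Y, 0)
      = fderiv ℝ (chartMul E G) (z, oneCoord E G) (0, Y) := by
  have : IsTopologicalGroup G := topologicalGroup_of_lieGroup 𝓘(ℝ, E) ∞
  set g := (oneChart E G).symm z
  have h1 := hasFDerivAt_chartMul_right (G := G) hz
  have he : oneChart E G (g * (oneChart E G).symm (oneCoord E G) * g⁻¹) = oneCoord E G := by
    rw [oneChart_symm_oneCoord]; simp [oneCoord]
  have h2 : HasFDerivAt (fun w => chartMul E G (w, z))
      ((fderiv ℝ (chartMul E G) (oneCoord E G, z)).comp (ContinuousLinearMap.inl ℝ E E))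
      (oneChart E G (g * (oneChart E G).symm (oneCoord E G) * g⁻¹)) := by
    rw [he]; exact hasFDerivAt_chartMul_left (G := G) hz
  have h3 := HasFDerivAt.comp (g := fun w => chartMul E G (w, z)) (oneCoord E G) h2
    (hasFDerivAt_conj g)
  have h4 : (fun w => chartMul E G (z, w)) =ᶠ[𝓝 (oneCoord E G)]
      (fun w => chartMul E G (w, z)) ∘
        (fun z => oneChart E G (g * (oneChart E G).symm z * g⁻¹)) := by
    have ht : Tendsto (fun w => g * (oneChart E G).symm w * g⁻¹) (𝓝 (oneCoord E G)) (𝓝 1) := by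
      have : Tendsto (fun x : G => g * x * g⁻¹) (𝓝 1) (𝓝 1) := by
        have hc : Continuous fun x : G => g * x * g⁻¹ := by fun_prop
        simpa using hc.tendsto 1
      exact this.comp tendsto_oneChart_symm
    filter_upwards [ht.eventually (eventually_oneChart_left_inv (E := E))] with w hw
    simp only [chartMul, Function.comp]
    rw [hw]
    simp [g]
  have h5 := h1.unique (h3.congr_of_eventuallyEq h4)
  simpa using (congrArg (fun T : E →L[ℝ] E => T Y) h5).symm

/-- Near the identity the differential `R` of right translation is invertible, being the identity at
the identity, and `Ad = R⁻¹ L` with `R` and `L` partial derivatives of the smooth multiplication. -/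
theorem contDiffAt_Ad_oneChart_symm : ContDiffAt ℝ ∞
    (fun z => ((Ad E ((oneChart E G).symm z) : (E →L[ℝ] E)ˣ) : E →L[ℝ] E)) (oneCoord E G) := by
  set R : E → E →L[ℝ] E := fun z =>
    (fderiv ℝ (chartMul E G) (oneCoord E G, z)).comp (ContinuousLinearMap.inl ℝ E E)
  set L : E → E →L[ℝ] E := fun z =>
    (fderiv ℝ (chartMul E G) (z, oneCoord E G)).comp (ContinuousLinearMap.inr ℝ E E)
  have hf : ContDiffAt ℝ ∞ (fderiv ℝ (chartMul E G)) (oneCoord E G, oneCoord E G) :=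
    contDiffAt_chartMul.fderiv_right (by norm_cast)
  have hR : ContDiffAt ℝ ∞ R (oneCoord E G) :=
    (ContDiffAt.comp (g := fderiv ℝ (chartMul E G)) (oneCoord E G) hf
      (contDiffAt_const.prodMk contDiffAt_id)).clm_comp contDiffAt_const
  have hL : ContDiffAt ℝ ∞ L (oneCoord E G) :=
    (ContDiffAt.comp (g := fderiv ℝ (chartMul E G)) (f := fun z : E => (z, oneCoord E G))
      (oneCoord E G) hf (contDiffAt_id.prodMk contDiffAt_const)).clm_comp contDiffAt_const
  have hRe : R (oneCoord E G) = ContinuousLinearEquiv.refl ℝ E := by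
    ext v
    simp [R, (hasFDerivAt_chartMul (E := E) (G := G)).fderiv]
  have hinv : ContDiffAt ℝ ∞ (fun z => (R z).inverse) (oneCoord E G) := by
    refine ContDiffAt.comp (g := ContinuousLinearMap.inverse) (oneCoord E G) ?_ hR
    rw [hRe]
    exact contDiffAt_map_inverse _
  refine (hinv.clm_comp hL).congr_of_eventuallyEq ?_
  have hunit : ∀ᶠ z in 𝓝 (oneCoord E G), (R z).IsInvertible := by
    have : (Set.range ((↑) : (E ≃L[ℝ] E) → E →L[ℝ] E)) ∈ 𝓝 (R (oneCoord E G)) := by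
      rw [hRe]; exact ContinuousLinearEquiv.nhds _
    exact hR.continuousAt.eventually this
  filter_upwards [hunit, oneChart_target_mem_nhds (E := E) (G := G)] with z hz hzt
  ext Y
  have := fderiv_chartMul_Ad hzt Y
  have h2 : R z (((Ad E ((oneChart E G).symm z) : (E →L[ℝ] E)ˣ) : E →L[ℝ] E) Y) = L z Y := by
    simpa [R, L] using this
  rw [ContinuousLinearMap.comp_apply, ← h2]
  exact ((hz.inverse_apply_eq).2 rfl).symm

variable (E G) in
/-- The differential of the adjoint representation. -/
def adCLM : E →L[ℝ] E →L[ℝ] E :=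
  fderiv ℝ (fun z => ((Ad E ((oneChart E G).symm z) : (E →L[ℝ] E)ˣ) : E →L[ℝ] E)) (oneCoord E G)

theorem hasFDerivAt_Ad_oneChart_symm : HasFDerivAt
    (fun z => ((Ad E ((oneChart E G).symm z) : (E →L[ℝ] E)ˣ) : E →L[ℝ] E)) (adCLM E G)
    (oneCoord E G) :=
  (contDiffAt_Ad_oneChart_symm.differentiableAt (by simp)).hasFDerivAt

/-- Differentiate `R (Ad Y) = L Y` (`fderiv_chartMul_Ad`) at the identity along `X`; symmetry of the
second derivative puts the `R` term in the form used for the bracket. -/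
theorem adCLM_apply_eq_mulHessian (X Y : E) :
    adCLM E G X Y = mulHessian E G (X, 0) (0, Y) - mulHessian E G (Y, 0) (0, X) := by
  have h1 := HasFDerivAt.comp (g := fderiv ℝ (chartMul E G))
      (f := fun z : E => (oneCoord E G, z)) (oneCoord E G)
      (hasFDerivAt_fderiv_chartMul (E := E) (G := G))
      (hasFDerivAt_prodMk_right (oneCoord E G) (oneCoord E G))
  have h2 := HasFDerivAt.comp (g := fderiv ℝ (chartMul E G))
      (f := fun z : E => (z, oneCoord E G)) (oneCoord E G)
      (hasFDerivAt_fderiv_chartMul (E := E) (G := G))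
      (hasFDerivAt_prodMk_left (oneCoord E G) (oneCoord E G))
  have h3 := h2.clm_apply (hasFDerivAt_const ((0, Y) : E × E) (oneCoord E G))
  have h4 := h1.clm_apply
    (((ContinuousLinearMap.inl ℝ E E).hasFDerivAt (x := ((Ad E ((oneChart E G).symm (oneCoord E G))
      : (E →L[ℝ] E)ˣ) : E →L[ℝ] E) Y)).comp (oneCoord E G)
    ((hasFDerivAt_Ad_oneChart_symm (E := E) (G := G)).clm_apply
      (hasFDerivAt_const (Y : E) (oneCoord E G))))
  have h5 := h3.unique (h4.congr_of_eventuallyEq (by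
    filter_upwards [oneChart_target_mem_nhds (E := E) (G := G)] with z hz
    simpa using (fderiv_chartMul_Ad hz Y).symm))
  have h6 := congrArg (fun T : E →L[ℝ] E => T X) h5
  simp [oneChart_symm_oneCoord, (hasFDerivAt_chartMul (E := E) (G := G)).fderiv] at h6
  rw [h6, mulHessian_symm (Y, 0), add_sub_cancel_right]

/-- The differential of the adjoint representation of the group is the adjoint representation of
the Lie algebra. -/
theorem adCLM_apply (X Y : GroupLieAlgebra 𝓘(ℝ, E) G) : adCLM E G X Y = ⁅X, Y⁆ :=
  (adCLM_apply_eq_mulHessian (E := E) (G := G) X Y).trans (bracket_eq_mulHessian X Y).symm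

end Adjoint

/-! ### Left logarithmic derivatives -/

section LogDeriv

variable {E : Type*} [NormedAddCommGroup E] [NormedSpace ℝ E] [FiniteDimensional ℝ E]
  {G : Type*} [TopologicalSpace G] [ChartedSpace E G] [Group G] [LieGroup 𝓘(ℝ, E) ∞ G]
  [IsTopologicalGroup G]
  {F : Type*} [NormedAddCommGroup F] [NormedSpace ℝ F]
  {F' : Type*} [NormedAddCommGroup F'] [NormedSpace ℝ F']

theorem tendsto_conj_one (g : G) : Tendsto (fun x : G => g * x * g⁻¹) (𝓝 1) (𝓝 1) := by
  have hc : Continuous fun x : G => g * x * g⁻¹ := by fun_prop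
  simpa using hc.tendsto 1

/-- `A` is the left logarithmic derivative of `f` at `x`. -/
structure HasLogDerivAt (f : F → G) (A : F →L[ℝ] E) (x : F) : Prop where
  continuousAt : ContinuousAt f x
  hasFDerivAt : HasFDerivAt (fun y => oneChart E G ((f x)⁻¹ * f y)) A x

/-- The continuity field of the structure is needed here: the chart takes arbitrary values outside
its source, so differentiability of the coordinates alone does not keep `f y` close to `f x`. -/
theorem HasLogDerivAt.tendsto {f : F → G} {A : F →L[ℝ] E} {x : F} (hf : HasLogDerivAt f A x) :
    Tendsto (fun y => (f x)⁻¹ * f y) (𝓝 x) (𝓝 1) := by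
  have h : ContinuousAt (fun y => (f x)⁻¹ * f y) x := continuousAt_const.mul hf.continuousAt
  simpa [ContinuousAt] using h

/-- Write `(f x g x)⁻¹ f y g y` as the conjugate of `(f x)⁻¹ f y` by `(g x)⁻¹`, times `(g x)⁻¹ g y`.
Conjugation contributes `Ad`, and the multiplication has derivative `+` at the identity. -/
theorem HasLogDerivAt.mul {f g : F → G} {A B : F →L[ℝ] E} {x : F} (hf : HasLogDerivAt f A x)
    (hg : HasLogDerivAt g B x) :
    HasLogDerivAt (fun y => f y * g y)
      (((Ad E (g x)⁻¹ : (E →L[ℝ] E)ˣ) : E →L[ℝ] E).comp A + B) x := by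
  refine ⟨hf.continuousAt.mul hg.continuousAt, ?_⟩
  set c : E → E := fun z => oneChart E G ((g x)⁻¹ * (oneChart E G).symm z * ((g x)⁻¹)⁻¹)
  have e1 : oneChart E G ((f x)⁻¹ * f x) = oneCoord E G := by simp [oneCoord]
  have e2 : oneChart E G ((g x)⁻¹ * g x) = oneCoord E G := by simp [oneCoord]
  have e3 : c (oneCoord E G) = oneCoord E G := by
    simp only [c, oneChart_symm_oneCoord]
    simp [oneCoord]
  have hc : HasFDerivAt c ((Ad E (g x)⁻¹ : (E →L[ℝ] E)ˣ) : E →L[ℝ] E)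
      (oneChart E G ((f x)⁻¹ * f x)) := by
    rw [e1]; exact hasFDerivAt_conj _
  have h1 := HasFDerivAt.comp (g := c) x hc hf.hasFDerivAt
  have h2 := h1.prodMk hg.hasFDerivAt
  have hm : HasFDerivAt (chartMul E G)
      (ContinuousLinearMap.fst ℝ E E + ContinuousLinearMap.snd ℝ E E)
      ((c ∘ fun y => oneChart E G ((f x)⁻¹ * f y)) x, oneChart E G ((g x)⁻¹ * g x)) := by
    simp only [Function.comp, e1, e2, e3]
    exact hasFDerivAt_chartMul
  have h3 := HasFDerivAt.comp (g := chartMul E G) x hm h2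
  have e4 : (ContinuousLinearMap.fst ℝ E E + ContinuousLinearMap.snd ℝ E E).comp
      ((((Ad E (g x)⁻¹ : (E →L[ℝ] E)ˣ) : E →L[ℝ] E).comp A).prod B)
      = ((Ad E (g x)⁻¹ : (E →L[ℝ] E)ˣ) : E →L[ℝ] E).comp A + B := by
    ext v; simp
  rw [e4] at h3
  refine h3.congr_of_eventuallyEq ?_
  filter_upwards [hf.tendsto.eventually (eventually_oneChart_left_inv (E := E)),
    hg.tendsto.eventually (eventually_oneChart_left_inv (E := E)),
    ((tendsto_conj_one (g x)⁻¹).comp hf.tendsto).eventually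
      (eventually_oneChart_left_inv (E := E))] with y h1 h2 h3
  simp only [Function.comp] at h3
  simp only [Function.comp, chartMul, c, h1, h2, h3]
  congr 1
  group

theorem HasLogDerivAt.comp {f : F → G} {k : F' → F} {A : F →L[ℝ] E} {K : F' →L[ℝ] F} {x : F'}
    (hf : HasLogDerivAt f A (k x)) (hk : HasFDerivAt k K x) :
    HasLogDerivAt (fun y => f (k y)) (A.comp K) x :=
  ⟨hf.continuousAt.comp hk.continuousAt, HasFDerivAt.comp x hf.hasFDerivAt hk⟩

theorem HasLogDerivAt.const_mul {f : F → G} {A : F →L[ℝ] E} {x : F} (hf : HasLogDerivAt f A x)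
    (g : G) : HasLogDerivAt (fun y => g * f y) A x := by
  refine ⟨continuousAt_const.mul hf.continuousAt, ?_⟩
  have : (fun y => oneChart E G ((g * f x)⁻¹ * (g * f y)))
      = fun y => oneChart E G ((f x)⁻¹ * f y) := by
    funext y; congr 1; group
  rw [this]
  exact hf.hasFDerivAt

theorem HasLogDerivAt.unique {f : F → G} {A B : F →L[ℝ] E} {x : F} (hA : HasLogDerivAt f A x)
    (hB : HasLogDerivAt f B x) : A = B :=
  hA.hasFDerivAt.unique hB.hasFDerivAt

theorem HasLogDerivAt.congr_of_eventuallyEq {f g : F → G} {A : F →L[ℝ] E} {x : F}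
    (hf : HasLogDerivAt f A x) (h : g =ᶠ[𝓝 x] f) : HasLogDerivAt g A x := by
  refine ⟨hf.continuousAt.congr h.symm, hf.hasFDerivAt.congr_of_eventuallyEq ?_⟩
  filter_upwards [h] with y hy
  rw [hy, h.eq_of_nhds]

/-- The derivative in the preferred chart of a map with a logarithmic derivative. -/
theorem HasLogDerivAt.hasFDerivAt_oneChart {f : F → G} {A : F →L[ℝ] E} {x : F}
    (hf : HasLogDerivAt f A x) (hx : f x ∈ (oneChart E G).source) :
    HasFDerivAt (fun y => oneChart E G (f y))
      (((fderiv ℝ (chartMul E G) (oneChart E G (f x), oneCoord E G)).comp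
        (ContinuousLinearMap.inr ℝ E E)).comp A) x := by
  have e : oneChart E G ((f x)⁻¹ * f x) = oneCoord E G := by simp [oneCoord]
  have h1 := hasFDerivAt_chartMul_right (G := G) ((oneChart E G).map_source hx)
  rw [← e] at h1
  have h2 := HasFDerivAt.comp (g := fun w => chartMul E G (oneChart E G (f x), w)) x h1
    hf.hasFDerivAt
  rw [e] at h2
  refine h2.congr_of_eventuallyEq ?_
  filter_upwards [hf.tendsto.eventually (eventually_oneChart_left_inv (E := E))] with y hy
  simp only [Function.comp, chartMul, hy, (oneChart E G).left_inv hx, mul_inv_cancel_left]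

theorem differential_oneChart_one :
    (differential (oneChart E G) (1 : G) : E →L[ℝ] E) = ContinuousLinearMap.id ℝ E :=
  mfderiv_extChartAt_self (I := 𝓘(ℝ, E)) (x := (1 : G))

theorem differential_oneChart_symm :
    (differential (oneChart E G).symm (oneCoord E G) : E →L[ℝ] E) = ContinuousLinearMap.id ℝ E := by
  have h := mfderivWithin_range_extChartAt_symm (I := 𝓘(ℝ, E)) (x := (1 : G))
  simp only [modelWithCornersSelf_coe, Set.range_id, mfderivWithin_univ] at h
  exact h

variable {γ : ℝ → G} {X : E} {t : ℝ}

/-- With its converse `HasLogDerivAt.hasMFDerivAt`, this identifies curves of constant logarithmic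
velocity with integral curves of left invariant fields, so that existence and uniqueness for
differential equations apply. Translating back by `(γ t)⁻¹` cancels the differential that defines
the field. -/
theorem HasLogDerivAt.of_hasMFDerivAt (h : HasMFDerivAt 𝓘(ℝ, ℝ) 𝓘(ℝ, E) γ t
      ((1 : ℝ →L[ℝ] ℝ).smulRight
        (mulInvariantVectorField (I := 𝓘(ℝ, E)) (G := G) X (γ t)))) :
    HasLogDerivAt γ ((1 : ℝ →L[ℝ] ℝ).smulRight X) t := by
  refine ⟨h.continuousAt, ?_⟩
  set g := γ t with hg
  set k : G → E := fun y => oneChart E G (g⁻¹ * y) with hk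
  have hkd : MDifferentiableAt 𝓘(ℝ, E) 𝓘(ℝ, E) k g := by
    refine MDifferentiableAt.comp (I' := 𝓘(ℝ, E)) (g := oneChart E G) g ?_
      (mdifferentiableAt_mul_left g⁻¹ g)
    rw [inv_mul_cancel]
    exact mdifferentiableAt_oneChart one_mem_oneChart_source
  have h1 := HasMFDerivAt.comp (g := k) t hkd.hasMFDerivAt h
  have h2 : (differential k g : E →L[ℝ] E).comp (differential (fun y : G => g * y) 1 : E →L[ℝ] E)
      = ContinuousLinearMap.id ℝ E := by
    have hkd' : MDifferentiableAt 𝓘(ℝ, E) 𝓘(ℝ, E) k (g * 1) := by rwa [mul_one]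
    have := differential_comp (E := E) (E' := E) (E'' := E) (x := (1 : G)) (f := k)
      (g := fun y : G => g * y) hkd' (mdifferentiableAt_mul_left g 1)
    have h3 : k ∘ (fun y : G => g * y) = oneChart E G := by
      funext y; simp [k]
    rw [h3, differential_oneChart_one] at this
    simp only [mul_one] at this
    exact this.symm
  have h4 : (differential k g : E →L[ℝ] E).comp ((1 : ℝ →L[ℝ] ℝ).smulRight
      ((differential (fun y : G => g * y) 1 : E →L[ℝ] E) X))
      = (1 : ℝ →L[ℝ] ℝ).smulRight X := by
    have := congrArg (fun T : E →L[ℝ] E => T X) h2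
    simp only [ContinuousLinearMap.comp_apply, ContinuousLinearMap.id_apply] at this
    ext
    simp [this]
  rw [← h4]
  exact hasMFDerivAt_iff_hasFDerivAt.1 h1

theorem HasLogDerivAt.hasMFDerivAt (h : HasLogDerivAt γ ((1 : ℝ →L[ℝ] ℝ).smulRight X) t) :
    HasMFDerivAt 𝓘(ℝ, ℝ) 𝓘(ℝ, E) γ t
      ((1 : ℝ →L[ℝ] ℝ).smulRight
        (mulInvariantVectorField (I := 𝓘(ℝ, E)) (G := G) X (γ t))) := by
  set g := γ t with hg
  set w : ℝ → E := fun s => oneChart E G (g⁻¹ * γ s) with hw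
  have hwt : w t = oneCoord E G := by simp [w, oneCoord, hg]
  set k : E → G := fun z => g * (oneChart E G).symm z with hk
  have hs : MDifferentiableAt 𝓘(ℝ, E) 𝓘(ℝ, E) (oneChart E G).symm (oneCoord E G) :=
    (contMDiffAt_oneChart_symm oneCoord_mem_target).mdifferentiableAt (by simp)
  have hkd : MDifferentiableAt 𝓘(ℝ, E) 𝓘(ℝ, E) k (oneCoord E G) :=
    MDifferentiableAt.comp (I' := 𝓘(ℝ, E)) (g := fun y : G => g * y) (oneCoord E G)
      (mdifferentiableAt_mul_left g _) hs
  have hd : (differential k (oneCoord E G) : E →L[ℝ] E)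
      = (differential (fun y : G => g * y) 1 : E →L[ℝ] E) := by
    have := differential_comp (E := E) (E' := E) (E'' := E) (x := oneCoord E G)
      (f := fun y : G => g * y) (g := (oneChart E G).symm) (mdifferentiableAt_mul_left g _) hs
    rw [differential_oneChart_symm, ContinuousLinearMap.comp_id] at this
    simp only [oneChart_symm_oneCoord] at this
    exact this
  have h1 : HasMFDerivAt 𝓘(ℝ, E) 𝓘(ℝ, E) k (w t)
      (differential (fun y : G => g * y) 1 : E →L[ℝ] E) := by
    rw [hwt, ← hd]; exact hkd.hasMFDerivAt
  have h2 := HasMFDerivAt.comp (g := k) t h1 (hasMFDerivAt_iff_hasFDerivAt.2 h.hasFDerivAt)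
  have h3 : γ =ᶠ[𝓝 t] k ∘ w := by
    filter_upwards [h.tendsto.eventually (eventually_oneChart_left_inv (E := E))] with s hs
    simp only [Function.comp, k, w]
    rw [hs, mul_inv_cancel_left]
  have h4 : (differential (fun y : G => g * y) 1 : E →L[ℝ] E).comp ((1 : ℝ →L[ℝ] ℝ).smulRight X)
      = (1 : ℝ →L[ℝ] ℝ).smulRight ((differential (fun y : G => g * y) 1 : E →L[ℝ] E) X) := by
    ext; simp
  exact Eq.mp (congrArg (fun T : ℝ →L[ℝ] E => HasMFDerivAt 𝓘(ℝ, ℝ) 𝓘(ℝ, E) γ t T) h4)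
    (h2.congr_of_eventuallyEq h3)

end LogDeriv

/-! ### One-parameter groups in a Banach algebra -/

section OneParameter

variable {𝔸 : Type*} [NormedRing 𝔸] [NormedAlgebra ℝ 𝔸] [CompleteSpace 𝔸]

/-- The product `f t * exp (-t A)` has zero derivative. -/
theorem eq_exp_of_hasDerivAt {f : ℝ → 𝔸} {A : 𝔸} (h0 : f 0 = 1)
    (hf : ∀ t, HasDerivAt f (f t * A) t) (t : ℝ) : f t = NormedSpace.exp (t • A) := by
  have h1 : ∀ t, HasDerivAt (fun t => f t * NormedSpace.exp (t • (-A))) 0 t := by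
    intro t
    have := (hf t).mul (hasDerivAt_exp_smul_const' (𝕂 := ℝ) (-A) t)
    convert! this using 1
    simp [mul_assoc]
  have h2 := is_const_of_deriv_eq_zero (fun t => (h1 t).differentiableAt)
    (fun t => (h1 t).deriv) t 0
  simp only [zero_smul, NormedSpace.exp_zero, h0, mul_one] at h2
  have h3 : NormedSpace.exp (t • (-A)) * NormedSpace.exp (t • A) = 1 := by
    let _ : NormedAlgebra ℚ 𝔸 := .restrictScalars ℚ ℝ 𝔸
    rw [← NormedSpace.exp_add_of_commute]
    · simp
    · simp
  calc f t = f t * (NormedSpace.exp (t • (-A)) * NormedSpace.exp (t • A)) := by rw [h3, mul_one]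
    _ = NormedSpace.exp (t • A) := by rw [← mul_assoc, h2, one_mul]

theorem eq_exp_of_map_add {f : ℝ → 𝔸} {A : 𝔸} (h0 : f 0 = 1) (hadd : ∀ s t, f (s + t) = f s * f t)
    (hf : HasDerivAt f A 0) (t : ℝ) : f t = NormedSpace.exp (t • A) := by
  refine eq_exp_of_hasDerivAt h0 (fun t => ?_) t
  have h1 : HasDerivAt f A (t - t) := by rwa [sub_self]
  have h2 : HasDerivAt (fun s => f (s - t)) A t := by simpa using h1.comp_sub_const t t
  have h3 := h2.const_mul (f t)
  refine h3.congr_of_eventuallyEq (Eventually.of_forall fun s => ?_)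
  simp only [← hadd, add_sub_cancel]

end OneParameter

/-! ### The exponential map of a Lie group -/

section Exp

variable {E : Type*} [NormedAddCommGroup E] [NormedSpace ℝ E] [FiniteDimensional ℝ E]
  {G : Type*} [TopologicalSpace G] [ChartedSpace E G] [Group G] [LieGroup 𝓘(ℝ, E) ∞ G]
  [IsTopologicalGroup G] [T2Space G]

theorem contMDiff_one_mulInvariantVectorField (X : GroupLieAlgebra 𝓘(ℝ, E) G) :
    ContMDiff 𝓘(ℝ, E) 𝓘(ℝ, E).tangent 1
      (fun g : G => (⟨g, mulInvariantVectorField X g⟩ : TangentBundle 𝓘(ℝ, E) G)) := by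
  have : LieGroup 𝓘(ℝ, E) (minSmoothness ℝ 3) G := by
    rw [minSmoothness_of_isRCLikeNormedField]; infer_instance
  refine (contMDiff_mulInvariantVectorField X).of_le ?_
  rw [minSmoothness_of_isRCLikeNormedField]
  norm_num

/-- The one-dimensional logarithmic derivative. -/
abbrev HasLogVelocityAt (γ : ℝ → G) (X : E) (t : ℝ) : Prop :=
  HasLogDerivAt γ ((1 : ℝ →L[ℝ] ℝ).smulRight X) t

theorem eqOn_of_hasLogVelocityAt {γ γ' : ℝ → G} {X : E} {a b t₀ : ℝ} (ht₀ : t₀ ∈ Set.Ioo a b)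
    (h : ∀ t ∈ Set.Ioo a b, HasLogVelocityAt γ X t) (h' : ∀ t ∈ Set.Ioo a b, HasLogVelocityAt γ' X t)
    (h0 : γ t₀ = γ' t₀) : Set.EqOn γ γ' (Set.Ioo a b) :=
  isMIntegralCurveOn_Ioo_eqOn_of_contMDiff_boundaryless (I := 𝓘(ℝ, E)) ht₀
    (contMDiff_one_mulInvariantVectorField X)
    (fun t ht => (h t ht).hasMFDerivAt.hasMFDerivWithinAt)
    (fun t ht => (h' t ht).hasMFDerivAt.hasMFDerivWithinAt) h0

theorem eq_of_hasLogVelocityAt {γ γ' : ℝ → G} {X : E} (h : ∀ t, HasLogVelocityAt γ X t)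
    (h' : ∀ t, HasLogVelocityAt γ' X t) (h0 : γ 0 = γ' 0) : γ = γ' := by
  funext t
  refine eqOn_of_hasLogVelocityAt (a := -(|t| + 1)) (b := |t| + 1) (t₀ := 0) ?_
    (fun t _ => h t) (fun t _ => h' t) h0 ?_
  · constructor <;> linarith [abs_nonneg t]
  · constructor <;> linarith [neg_abs_le t, le_abs_self t]

/-- Left translates of one local integral curve through `1` are integral curves through every other
point, on the same time interval; a uniform existence time gives a global curve. -/
theorem exists_hasLogVelocityAt (X : E) :
    ∃ γ : ℝ → G, γ 0 = 1 ∧ ∀ t, HasLogVelocityAt γ X t := by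
  have hv := contMDiff_one_mulInvariantVectorField (E := E) (G := G) X
  obtain ⟨γ, h0, hγ⟩ := exists_isMIntegralCurveAt_of_contMDiffAt_boundaryless (I := 𝓘(ℝ, E)) 0
    (hv (1 : G))
  obtain ⟨ε, hε, hε'⟩ := Metric.eventually_nhds_iff.1 hγ
  obtain ⟨γ', h0', hγ'⟩ := exists_isMIntegralCurve_of_isMIntegralCurveOn (I := 𝓘(ℝ, E)) hv hε
    (fun x => ⟨fun t => x * γ t, by simp [h0], fun t ht => by
      have h1 := hε' (y := t) (by simpa [Real.dist_eq, abs_lt] using ht)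
      exact ((HasLogDerivAt.of_hasMFDerivAt h1).const_mul x).hasMFDerivAt.hasMFDerivWithinAt⟩)
    (1 : G)
  exact ⟨γ', h0', fun t => .of_hasMFDerivAt (hγ' t)⟩

/-- The exponential map of a Lie group. -/
def lieExp (X : E) : G := (exists_hasLogVelocityAt X).choose 1

theorem hasLogVelocityAt_comp_mul {γ : ℝ → G} {X : E} {s t : ℝ}
    (h : HasLogVelocityAt γ X (s * t)) : HasLogVelocityAt (fun t => γ (s * t)) (s • X) t := by
  have h1 : HasFDerivAt (fun t : ℝ => s * t) (s • ContinuousLinearMap.id ℝ ℝ) t :=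
    (hasFDerivAt_id t).const_smul s
  have h2 : (1 : ℝ →L[ℝ] ℝ).smulRight (s • X)
      = ((1 : ℝ →L[ℝ] ℝ).smulRight X).comp (s • ContinuousLinearMap.id ℝ ℝ) := by
    ext
    simp
  rw [HasLogVelocityAt, h2]
  exact HasLogDerivAt.comp h h1

/-- The curve for `X` run at speed `t` has velocity `t • X`; compare at time `1`. -/
theorem choose_eq_lieExp (X : E) (t : ℝ) :
    (exists_hasLogVelocityAt (G := G) X).choose t = lieExp (t • X) := by
  obtain ⟨h0, h1⟩ := (exists_hasLogVelocityAt (G := G) X).choose_spec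
  obtain ⟨k0, k1⟩ := (exists_hasLogVelocityAt (G := G) (t • X)).choose_spec
  have := eq_of_hasLogVelocityAt (fun s => hasLogVelocityAt_comp_mul (s := t) (h1 (t * s))) k1
    (by simp [h0, k0])
  have h2 := congrFun this 1
  simp only [mul_one] at h2
  exact h2

theorem hasLogVelocityAt_lieExp (X : E) (t : ℝ) :
    HasLogVelocityAt (fun t : ℝ => (lieExp (t • X) : G)) X t := by
  have := (exists_hasLogVelocityAt (G := G) X).choose_spec.2 t
  simpa only [← choose_eq_lieExp] using this

@[simp]
theorem lieExp_zero : (lieExp (0 : E) : G) = 1 := by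
  have := choose_eq_lieExp (G := G) (0 : E) 0
  rw [(exists_hasLogVelocityAt (G := G) (0 : E)).choose_spec.1, smul_zero] at this
  exact this.symm

theorem eq_mul_lieExp {γ : ℝ → G} {X : E} (h : ∀ t, HasLogVelocityAt γ X t) (t : ℝ) :
    γ t = γ 0 * lieExp (t • X) :=
  congrFun (eq_of_hasLogVelocityAt h (fun t => (hasLogVelocityAt_lieExp X t).const_mul (γ 0))
    (by simp)) t

theorem lieExp_add_smul (X : E) (s t : ℝ) :
    (lieExp ((s + t) • X) : G) = lieExp (s • X) * lieExp (t • X) := by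
  have h : ∀ t, HasLogVelocityAt (fun t : ℝ => (lieExp ((s + t) • X) : G)) X t := fun t => by
    have h1 : HasFDerivAt (fun t : ℝ => s + t) (ContinuousLinearMap.id ℝ ℝ) t :=
      (hasFDerivAt_id t).const_add s
    simpa using (hasLogVelocityAt_lieExp (G := G) X (s + t)).comp h1
  simpa using eq_mul_lieExp h t

theorem lieExp_neg (X : E) : (lieExp (-X) : G) = (lieExp X)⁻¹ := by
  have := lieExp_add_smul (G := G) X (-1) 1
  rw [neg_add_cancel, zero_smul, lieExp_zero, neg_one_smul, one_smul] at this
  exact (eq_inv_of_mul_eq_one_left this.symm)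

theorem lieExp_nsmul (X : E) (n : ℕ) : (lieExp ((n : ℝ) • X) : G) = lieExp X ^ n := by
  induction n with
  | zero => simp
  | succ n ih => rw [Nat.cast_succ, lieExp_add_smul, ih, one_smul, pow_succ]

theorem hasDerivAt_Ad_comp {γ : ℝ → G} {X : E} (h : HasLogVelocityAt γ X 0) (h0 : γ 0 = 1) :
    HasDerivAt (fun t => ((Ad E (γ t) : (E →L[ℝ] E)ˣ) : E →L[ℝ] E)) (adCLM E G X) 0 := by
  have h1 : HasFDerivAt (fun t => oneChart E G (γ t)) ((1 : ℝ →L[ℝ] ℝ).smulRight X) 0 := by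
    simpa [h0] using h.hasFDerivAt
  have e : oneChart E G (γ 0) = oneCoord E G := by rw [h0]; rfl
  have h2 : HasFDerivAt (fun z => ((Ad E ((oneChart E G).symm z) : (E →L[ℝ] E)ˣ) : E →L[ℝ] E))
      (adCLM E G) (oneChart E G (γ 0)) := by
    rw [e]; exact hasFDerivAt_Ad_oneChart_symm
  have h3 := (HasFDerivAt.comp (0 : ℝ) h2 h1).hasDerivAt
  simp only [ContinuousLinearMap.comp_apply, ContinuousLinearMap.smulRight_apply,
    one_apply_eq_self, one_smul] at h3
  refine h3.congr_of_eventuallyEq ?_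
  have ht : Tendsto γ (𝓝 0) (𝓝 1) := by
    have := h.continuousAt.tendsto
    rwa [h0] at this
  filter_upwards [ht.eventually (eventually_oneChart_left_inv (E := E))] with t ht
  simp only [Function.comp, ht]

theorem Ad_lieExp_smul (X : E) (t : ℝ) :
    ((Ad E (lieExp (t • X) : G) : (E →L[ℝ] E)ˣ) : E →L[ℝ] E)
      = NormedSpace.exp (t • adCLM E G X) := by
  refine eq_exp_of_map_add (f := fun t : ℝ => ((Ad E (lieExp (t • X) : G) : (E →L[ℝ] E)ˣ) :
    E →L[ℝ] E)) (by simp) (fun s t => ?_) ?_ t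
  · simp only [lieExp_add_smul, map_mul, Units.val_mul]
  · exact hasDerivAt_Ad_comp (hasLogVelocityAt_lieExp X 0) (by simp)

theorem Ad_lieExp (X : E) :
    ((Ad E (lieExp X : G) : (E →L[ℝ] E)ˣ) : E →L[ℝ] E) = NormedSpace.exp (adCLM E G X) := by
  simpa using Ad_lieExp_smul (G := G) X 1

end Exp

/-! ### Continuity of the adjoint representation -/

section AdContinuous

variable {E : Type*} [NormedAddCommGroup E] [NormedSpace ℝ E] [FiniteDimensional ℝ E]
  {G : Type*} [TopologicalSpace G] [ChartedSpace E G] [Group G] [LieGroup 𝓘(ℝ, E) ∞ G]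
  [IsTopologicalGroup G]

theorem continuous_Ad : Continuous (Ad E : G →* (E →L[ℝ] E)ˣ) := by
  have hval : Continuous fun g : G => ((Ad E g : (E →L[ℝ] E)ˣ) : E →L[ℝ] E) := by
    have h1 : ContinuousAt (fun g : G => ((Ad E g : (E →L[ℝ] E)ˣ) : E →L[ℝ] E)) 1 := by
      have := ContinuousAt.comp (f := oneChart E G) (x := 1)
        (contDiffAt_Ad_oneChart_symm (E := E) (G := G)).continuousAt continuousAt_oneChart
      refine this.congr ?_
      filter_upwards [eventually_oneChart_left_inv (E := E) (G := G)] with g hg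
      simp only [Function.comp, hg]
    refine continuous_iff_continuousAt.2 fun g₀ => ?_
    have h2 : ContinuousAt (fun g : G => g₀⁻¹ * g) g₀ := by fun_prop
    have h3 : ContinuousAt (fun g : G => ((Ad E g : (E →L[ℝ] E)ˣ) : E →L[ℝ] E)) (g₀⁻¹ * g₀) := by
      rwa [inv_mul_cancel]
    have h4 := (continuousAt_const (y := ((Ad E g₀ : (E →L[ℝ] E)ˣ) : E →L[ℝ] E))).mul
      (ContinuousAt.comp (f := fun g : G => g₀⁻¹ * g) h3 h2)
    refine h4.congr (Eventually.of_forall fun g => ?_)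
    simp [Function.comp, ← Units.val_mul, ← map_mul]
  refine Units.continuous_iff.2 ⟨hval, ?_⟩
  have : (fun g : G => ((Ad E g)⁻¹ : (E →L[ℝ] E)ˣ).val) = fun g => (Ad E g⁻¹).val := by
    funext g; rw [map_inv]
  rw [this]
  exact hval.comp continuous_inv

end AdContinuous

/-! ### Intertwining operators and exponentials -/

section Intertwine

variable {E : Type*} [NormedAddCommGroup E] [NormedSpace ℝ E] [CompleteSpace E]
  {F : Type*} [NormedAddCommGroup F] [NormedSpace ℝ F] [CompleteSpace F]

theorem comp_exp_eq_exp_comp {T : E →L[ℝ] F} {A : E →L[ℝ] E} {B : F →L[ℝ] F}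
    (h : T.comp A = B.comp T) :
    T.comp (NormedSpace.exp A) = (NormedSpace.exp B).comp T := by
  have hpow : ∀ n : ℕ, T.comp (A ^ n) = (B ^ n).comp T := by
    intro n
    induction n with
    | zero => rfl
    | succ n ih =>
      calc T.comp (A ^ (n + 1)) = (T.comp (A ^ n)).comp A := by rw [pow_succ]; rfl
        _ = (B ^ n).comp (T.comp A) := by rw [ih]; rfl
        _ = (B ^ (n + 1)).comp T := by rw [h, pow_succ]; rfl
  have h1 := (ContinuousLinearMap.compL ℝ E E F T).hasSum
    (NormedSpace.exp_series_hasSum_exp' (𝕂 := ℝ) A)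
  have h2 := ((ContinuousLinearMap.compL ℝ E F F).flip T).hasSum
    (NormedSpace.exp_series_hasSum_exp' (𝕂 := ℝ) B)
  refine h1.unique ?_
  convert! h2 using 1
  funext n
  simp [hpow]

end Intertwine

/-! ### A quadratic estimate for curves of small logarithmic velocity -/

section DExp

variable {E : Type*} [NormedAddCommGroup E] [NormedSpace ℝ E] [FiniteDimensional ℝ E]
  {G : Type*} [TopologicalSpace G] [ChartedSpace E G] [Group G] [LieGroup 𝓘(ℝ, E) ∞ G]

variable (E G) in
/-- The differential at the identity of the left translation by the point with coordinates `z`, in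
the preferred chart. -/
def chartLeft (z : E) : E →L[ℝ] E :=
  (fderiv ℝ (chartMul E G) (z, oneCoord E G)).comp (ContinuousLinearMap.inr ℝ E E)

theorem contDiffOn_chartLeft : ContDiffOn ℝ ∞ (chartLeft E G) (oneChart E G).target := by
  intro z hz
  refine ContDiffAt.contDiffWithinAt ?_
  have h1 : ContDiffAt ℝ ∞ (chartMul E G) (z, oneCoord E G) := by
    refine contDiffAt_chartMul' (p := (z, oneCoord E G)) hz oneCoord_mem_target ?_
    simpa [oneChart_symm_oneCoord] using (oneChart E G).map_target hz
  have h2 : ContDiffAt ℝ ∞ (fderiv ℝ (chartMul E G)) (z, oneCoord E G) :=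
    h1.fderiv_right (by norm_cast)
  exact (ContDiffAt.comp (g := fderiv ℝ (chartMul E G)) (f := fun z : E => (z, oneCoord E G))
    z h2 (contDiffAt_id.prodMk contDiffAt_const)).clm_comp contDiffAt_const

theorem chartLeft_oneCoord : chartLeft E G (oneCoord E G) = ContinuousLinearMap.id ℝ E := by
  ext v
  simp [chartLeft, (hasFDerivAt_chartMul (E := E) (G := G)).fderiv]

variable [IsTopologicalGroup G] [T2Space G]

/-- A curve in the group starting at the identity with small logarithmic velocity is, in the
preferred chart, close to the primitive of its logarithmic velocity. -/
theorem exists_norm_oneChart_sub_le : ∃ C > 0, ∃ ε₀ > 0, ∀ (k : ℝ → G) (y p : ℝ → E) (ε : ℝ),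
    ε ≤ ε₀ → k 0 = 1 → (∀ t, HasLogVelocityAt k (y t) t) → (∀ t, HasDerivAt p (y t) t) → p 0 = 0 →
    (∀ t ∈ Set.Icc (0 : ℝ) 1, ‖y t‖ ≤ ε) →
    k 1 ∈ (oneChart E G).source ∧
      ‖oneChart E G (k 1) - oneCoord E G - p 1‖ ≤ C * ε ^ 2 := by
  have hL : ContDiffAt ℝ 1 (chartLeft E G) (oneCoord E G) :=
    ((contDiffOn_chartLeft (E := E) (G := G)).contDiffAt oneChart_target_mem_nhds).of_le
      (by norm_cast)
  obtain ⟨K, s, hs, hK⟩ := hL.exists_lipschitzOnWith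
  obtain ⟨r₀, hr₀, hball⟩ := Metric.mem_nhds_iff.1
    (inter_mem hs (oneChart_target_mem_nhds (E := E) (G := G)))
  -- The bound `1 / (K + 1)` gives `K ‖z - e‖ ≤ 1` on the ball of radius `r` about the identity
  -- coordinate `e`, so `chartLeft` has norm at most `2` there.
  set r : ℝ := min r₀ (1 / (K + 1)) with hr
  have hrpos : 0 < r := lt_min hr₀ (by positivity)
  have hLip : ∀ z, ‖z - oneCoord E G‖ < r →
      ‖chartLeft E G z - ContinuousLinearMap.id ℝ E‖ ≤ K * ‖z - oneCoord E G‖ := by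
    intro z hz
    have hzs : z ∈ s := (hball (by
      rw [Metric.mem_ball, dist_eq_norm]; exact hz.trans_le (min_le_left _ _))).1
    have := hK.dist_le_mul z hzs (oneCoord E G) (mem_of_mem_nhds hs)
    rwa [chartLeft_oneCoord, dist_eq_norm, dist_eq_norm] at this
  have hL2 : ∀ z, ‖z - oneCoord E G‖ < r → ∀ v, ‖chartLeft E G z v‖ ≤ 2 * ‖v‖ := by
    intro z hz v
    have h1 : (K : ℝ) * ‖z - oneCoord E G‖ ≤ 1 := by
      have h2 : ‖z - oneCoord E G‖ ≤ 1 / (K + 1) := hz.le.trans (min_le_right _ _)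
      calc (K : ℝ) * ‖z - oneCoord E G‖ ≤ K * (1 / (K + 1)) := by gcongr
        _ ≤ 1 := by rw [mul_one_div, div_le_one (by positivity)]; linarith
    have h3 : chartLeft E G z v = (chartLeft E G z - ContinuousLinearMap.id ℝ E) v + v := by simp
    rw [h3]
    calc _ ≤ ‖chartLeft E G z - ContinuousLinearMap.id ℝ E‖ * ‖v‖ + ‖v‖ :=
          (norm_add_le _ _).trans (by gcongr; exact ContinuousLinearMap.le_opNorm _ _)
      _ ≤ 1 * ‖v‖ + ‖v‖ := by gcongr; exact (hLip z hz).trans h1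
      _ = 2 * ‖v‖ := by ring
  have hsub : ∀ z, ‖z - oneCoord E G‖ < r → z ∈ (oneChart E G).target := fun z hz =>
    (hball (by rw [Metric.mem_ball, dist_eq_norm]; exact hz.trans_le (min_le_left _ _))).2
  -- Velocity at most `ε` moves the coordinates by at most `2 ε ≤ r / 2`, which keeps the curve
  -- inside the ball; the error in the derivative is then at most `K (2 ε) ε`.
  refine ⟨2 * (K + 1), by positivity, r / 4, by positivity, ?_⟩
  intro k y p ε hε hk0 hk hp hp0 hy
  have hε0 : 0 ≤ ε := (norm_nonneg _).trans (hy 0 (by simp))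
  have hkc : Continuous k := continuous_iff_continuousAt.2 fun t => (hk t).continuousAt
  set U : Set G := (oneChart E G).source ∩ oneChart E G ⁻¹' Metric.ball (oneCoord E G) r with hU
  have hUo : IsOpen U :=
    (continuousOn_extChartAt (I := 𝓘(ℝ, E)) (1 : G)).isOpen_inter_preimage isOpen_oneChart_source
      Metric.isOpen_ball
  have hder : ∀ t, k t ∈ U →
      HasDerivAt (fun t => oneChart E G (k t)) (chartLeft E G (oneChart E G (k t)) (y t)) t := by
    intro t ht
    have := ((hk t).hasFDerivAt_oneChart ht.1).hasDerivAt
    simpa [chartLeft] using this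
  have hnorm : ∀ {t}, k t ∈ U → ‖oneChart E G (k t) - oneCoord E G‖ < r := fun ht => by
    have := ht.2
    rwa [Set.mem_preimage, Metric.mem_ball, dist_eq_norm] at this
  have hest : ∀ T, T ≤ 1 → (∀ t ∈ Set.Icc 0 T, k t ∈ U) → ∀ t ∈ Set.Icc 0 T,
      ‖oneChart E G (k t) - oneCoord E G‖ ≤ 2 * ε := by
    intro T hT hTU t ht
    have h1 := norm_image_sub_le_of_norm_deriv_le_segment' (C := 2 * ε)
      (fun x hx => (hder x (hTU x hx)).hasDerivWithinAt) (fun x hx => by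
        have hx' := Set.Ico_subset_Icc_self hx
        refine (hL2 _ (hnorm (hTU x hx')) _).trans ?_
        have := hy x ⟨hx'.1, hx'.2.trans hT⟩
        linarith) t ht
    rw [hk0, sub_zero] at h1
    refine h1.trans ?_
    have : t ≤ 1 := ht.2.trans hT
    nlinarith [ht.1]
  -- Continuity argument at the first exit time `T`. Coordinates mean nothing once the curve leaves
  -- the chart, so the contradiction is found in `G`: before `T` the curve lies in `C`, the image of
  -- the closed half-ball, which is compact, hence closed, and contained in `U`.
  have hall : ∀ t ∈ Set.Icc (0 : ℝ) 1, k t ∈ U := by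
    by_contra hcon
    push Not at hcon
    set Z : Set ℝ := Set.Icc 0 1 ∩ k ⁻¹' Uᶜ
    have hZc : IsCompact Z := isCompact_Icc.inter_right (hUo.isClosed_compl.preimage hkc)
    obtain ⟨T, hT, hTmin⟩ := hZc.exists_isLeast (by
      obtain ⟨t, ht, ht'⟩ := hcon; exact ⟨t, ht, ht'⟩)
    have h1U : (1 : G) ∈ U := ⟨one_mem_oneChart_source, by
      simpa [oneCoord] using hrpos⟩
    have hT0 : 0 < T := by
      rcases hT.1.1.lt_or_eq with h | h
      · exact h
      · exact absurd (by rw [← h, hk0]; exact h1U) hT.2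
    have hlt : ∀ t, 0 ≤ t → t < T → k t ∈ U := fun t h0 h1 => by
      by_contra hn
      exact absurd (hTmin ⟨⟨h0, h1.le.trans hT.1.2⟩, hn⟩) (not_le.2 h1)
    set C : Set G := (oneChart E G).symm '' Metric.closedBall (oneCoord E G) (r / 2)
    have hsubC : Metric.closedBall (oneCoord E G) (r / 2) ⊆ (oneChart E G).target := fun z hz => by
      rw [Metric.mem_closedBall, dist_eq_norm] at hz
      exact hsub z (by linarith)
    have hC : IsClosed C := by
      refine IsCompact.isClosed (IsCompact.image_of_continuousOn (isCompact_closedBall _ _) ?_)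
      exact (continuousOn_extChartAt_symm (I := 𝓘(ℝ, E)) (1 : G)).mono hsubC
    have hmem : ∀ t, 0 ≤ t → t < T → k t ∈ C := fun t h0 h1 => by
      have h2 := hest t (h1.le.trans hT.1.2) (fun u hu => hlt u hu.1 (hu.2.trans_lt h1)) t
        ⟨h0, le_rfl⟩
      refine ⟨oneChart E G (k t), ?_, (oneChart E G).left_inv (hlt t h0 h1).1⟩
      rw [Metric.mem_closedBall, dist_eq_norm]
      linarith
    have hTC : k T ∈ C := by
      have hcl : T ∈ closure (Set.Ico 0 T) := by
        rw [closure_Ico hT0.ne]; exact ⟨hT0.le, le_rfl⟩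
      have h3 : Set.Ico 0 T ⊆ k ⁻¹' C := fun t ht => hmem t ht.1 ht.2
      exact closure_minimal h3 (hC.preimage hkc) hcl
    obtain ⟨z, hz, hzk⟩ := hTC
    refine hT.2 ?_
    rw [← hzk]
    refine ⟨(oneChart E G).map_target (hsubC hz), ?_⟩
    rw [Set.mem_preimage, (oneChart E G).right_inv (hsubC hz)]
    exact Metric.closedBall_subset_ball (by linarith) hz
  refine ⟨(hall 1 (by simp)).1, ?_⟩
  have h1 := norm_image_sub_le_of_norm_deriv_le_segment' (C := 2 * (K + 1) * ε ^ 2)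
    (f := fun t => oneChart E G (k t) - p t) (a := 0) (b := 1)
    (fun x hx => ((hder x (hall x hx)).sub (hp x)).hasDerivWithinAt) (fun x hx => by
      have hx' := Set.Ico_subset_Icc_self hx
      have h2 : chartLeft E G (oneChart E G (k x)) (y x) - y x
          = (chartLeft E G (oneChart E G (k x)) - ContinuousLinearMap.id ℝ E) (y x) := by simp
      rw [h2]
      calc _ ≤ ‖chartLeft E G (oneChart E G (k x)) - ContinuousLinearMap.id ℝ E‖ * ‖y x‖ :=
            ContinuousLinearMap.le_opNorm _ _
        _ ≤ (K * (2 * ε)) * ε := by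
            gcongr
            · exact (hLip _ (hnorm (hall x hx'))).trans
                (by gcongr; exact hest 1 le_rfl hall x hx')
            · exact hy x hx'
        _ ≤ 2 * (K + 1) * ε ^ 2 := by nlinarith [sq_nonneg ε]) 1 (by simp)
  simp only [hk0, hp0, sub_zero, mul_one] at h1
  have h3 : oneChart E G (k 1) - oneCoord E G - p 1 = oneChart E G (k 1) - p 1 - oneChart E G 1 := by
    rw [oneCoord]; abel
  rw [h3]
  exact h1

end DExp

/-! ### The differential of the exponential map, and its smoothness -/

section ExpSmooth

variable {E : Type*} [NormedAddCommGroup E] [NormedSpace ℝ E] [FiniteDimensional ℝ E]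
  {G : Type*} [TopologicalSpace G] [ChartedSpace E G] [Group G] [LieGroup 𝓘(ℝ, E) ∞ G]
  [IsTopologicalGroup G] [T2Space G]

/-- The block operator `(u, v) ↦ (A u + v, 0)`. -/
def blockOp (A : E →L[ℝ] E) : E × E →L[ℝ] E × E :=
  (ContinuousLinearMap.inl ℝ E E).comp
    (A.comp (ContinuousLinearMap.fst ℝ E E) + ContinuousLinearMap.snd ℝ E E)

/-- The operator `∫₀¹ exp (t • A) dt`. -/
def expMean (A : E →L[ℝ] E) : E →L[ℝ] E :=
  (ContinuousLinearMap.fst ℝ E E).comp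
    ((NormedSpace.exp (blockOp A)).comp (ContinuousLinearMap.inr ℝ E E))

theorem contDiff_normedSpace_exp {𝔸 : Type*} [NormedRing 𝔸] [NormedAlgebra ℝ 𝔸] [CompleteSpace 𝔸]
    {n : WithTop ℕ∞} : ContDiff ℝ n (NormedSpace.exp : 𝔸 → 𝔸) :=
  contDiff_iff_contDiffAt.2 fun x => (NormedSpace.exp_analytic (𝕂 := ℝ) x).contDiffAt

/-- The block form pays off here: it exhibits the integral as an entry of an operator exponential,
so no differentiation under the integral is needed. -/
theorem contDiff_expMean : ContDiff ℝ ∞ (expMean : (E →L[ℝ] E) → E →L[ℝ] E) := by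
  have h1 : ContDiff ℝ ∞ (blockOp : (E →L[ℝ] E) → E × E →L[ℝ] E × E) :=
    contDiff_const.clm_comp ((contDiff_id.clm_comp contDiff_const).add contDiff_const)
  exact contDiff_const.clm_comp ((contDiff_normedSpace_exp.comp h1).clm_comp contDiff_const)

theorem exp_blockOp_inl (A : E →L[ℝ] E) (t : ℝ) (Y : E) :
    NormedSpace.exp (t • blockOp A) (Y, 0) = (NormedSpace.exp (t • A) Y, 0) := by
  have h : (ContinuousLinearMap.inl ℝ E E).comp (t • A)
      = (t • blockOp A).comp (ContinuousLinearMap.inl ℝ E E) := by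
    ext v <;> simp [blockOp]
  have := congrArg (fun T : E →L[ℝ] E × E => T Y) (comp_exp_eq_exp_comp h)
  simpa using this.symm

/-- `t ↦ ∫₀ᵗ exp (s • A) Y ds`. -/
theorem hasDerivAt_fst_exp_blockOp (A : E →L[ℝ] E) (Y : E) (t : ℝ) :
    HasDerivAt (fun t : ℝ => (NormedSpace.exp (t • blockOp A) (0, Y)).1)
      (NormedSpace.exp (t • A) Y) t := by
  have h1 := hasDerivAt_exp_smul_const (𝕂 := ℝ) (blockOp A) t
  have h2 := h1.clm_apply (hasDerivAt_const t ((0, Y) : E × E))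
  have h3 := ((ContinuousLinearMap.fst ℝ E E).hasFDerivAt).comp_hasDerivAt t h2
  have h4 : blockOp A ((0, Y) : E × E) = (Y, 0) := by simp [blockOp]
  simpa [Function.comp_def, h4, exp_blockOp_inl] using h3

/-- The map `h × h` intertwines the two block operators, hence their exponentials. -/
theorem expMean_comp {A B h : E →L[ℝ] E} (hh : h.comp A = B.comp h) :
    h.comp (expMean A) = (expMean B).comp h := by
  set H : E × E →L[ℝ] E × E := h.prodMap h with hH
  have h1 : H.comp (blockOp A) = (blockOp B).comp H := by
    have h2 : ∀ v, h (A v) = B (h v) := fun v => congrArg (fun T : E →L[ℝ] E => T v) hh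
    ext v <;> simp [blockOp, H, h2]
  have h3 := comp_exp_eq_exp_comp h1
  ext v
  have h4 := congrArg (fun T : E × E →L[ℝ] E × E => (T (0, v)).1) h3
  simpa [expMean, H] using h4

/-- Apply the product rule to `exp (tX) exp (-tX) = 1`. -/
theorem Ad_lieExp_self (X : E) (t : ℝ) :
    ((Ad E (lieExp (t • X) : G) : (E →L[ℝ] E)ˣ) : E →L[ℝ] E) X = X := by
  have h1 := (hasLogVelocityAt_lieExp (G := G) X t).mul (hasLogVelocityAt_lieExp (G := G) (-X) t)
  have h2 : (fun t : ℝ => (lieExp (t • X) * lieExp (t • -X) : G)) = fun _ => 1 := by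
    funext t; simp [lieExp_neg]
  have h3 : HasLogDerivAt (fun _ : ℝ => (1 : G)) (0 : ℝ →L[ℝ] E) t :=
    ⟨continuousAt_const, by simpa using hasFDerivAt_const _ _⟩
  rw [h2] at h1
  have h4 := congrArg (fun T : ℝ →L[ℝ] E => T 1) (h1.unique h3)
  simp only [smul_neg, lieExp_neg, inv_inv] at h4
  simp at h4
  exact (eq_of_sub_eq_zero (by rw [sub_eq_add_neg]; exact h4))

variable (E G) in
/-- The left logarithmic derivative of the exponential map. -/
def logDerivExp (X : E) : E →L[ℝ] E :=
  (NormedSpace.exp (-adCLM E G X)).comp (expMean (adCLM E G X))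

theorem contDiff_logDerivExp : ContDiff ℝ ∞ (logDerivExp E G) :=
  (contDiff_normedSpace_exp.comp (adCLM E G).contDiff.neg).clm_comp
    (contDiff_expMean.comp (adCLM E G).contDiff)

/-- Naturality of the differential of `exp`: a Lie algebra endomorphism `h` intertwines `ad X` with
`ad (h X)`, hence everything built from them by exponentials. -/
theorem logDerivExp_comp {h : E →L[ℝ] E} (hh : ∀ X Y, h (adCLM E G X Y) = adCLM E G (h X) (h Y))
    (X : E) : h.comp (logDerivExp E G X) = (logDerivExp E G (h X)).comp h := by
  have h1 : h.comp (adCLM E G X) = (adCLM E G (h X)).comp h := by ext v; simp [hh]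
  have h2 : h.comp (-adCLM E G X) = (-adCLM E G (h X)).comp h := by ext v; simp [hh]
  rw [logDerivExp, logDerivExp, ← ContinuousLinearMap.comp_assoc, comp_exp_eq_exp_comp h2,
    ContinuousLinearMap.comp_assoc, expMean_comp h1, ContinuousLinearMap.comp_assoc]

/-- The curve `t ↦ exp (t(X + Y)) exp (-tX)` has logarithmic velocity exactly `exp (t ad X) Y`,
because `Ad (exp (tX))` fixes `X`. By the quadratic estimate its endpoint has coordinates `e +
expMean (ad X) Y + O(‖Y‖²)`, where `e` is the coordinate of the identity; conjugating by `exp (-X)`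
moves the factor `exp (-X)` to the left. -/
theorem hasLogDerivAt_lieExp (X : E) :
    HasLogDerivAt (lieExp : E → G) (logDerivExp E G X) X := by
  obtain ⟨C, hC, ε₀, hε₀, H⟩ := exists_norm_oneChart_sub_le (E := E) (G := G)
  obtain ⟨M, hM⟩ : ∃ M : ℝ, ∀ t ∈ Set.Icc (0 : ℝ) 1,
      ‖NormedSpace.exp (t • adCLM E G X)‖ ≤ M := by
    have hc : Continuous fun t : ℝ => ‖NormedSpace.exp (t • adCLM E G X)‖ := by
      have := (contDiff_normedSpace_exp (𝔸 := E →L[ℝ] E) (n := 0)).continuous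
      fun_prop
    obtain ⟨M, hM⟩ := (isCompact_Icc (a := (0 : ℝ)) (b := 1)).bddAbove_image hc.continuousOn
    exact ⟨M, fun t ht => hM ⟨t, ht, rfl⟩⟩
  have hM0 : 0 ≤ M := (norm_nonneg _).trans (hM 0 (by simp))
  set k : E → G := fun Y => lieExp (X + Y) * lieExp (-X) with hk
  have key : ∀ Y : E, M * ‖Y‖ ≤ ε₀ → k Y ∈ (oneChart E G).source ∧
      ‖oneChart E G (k Y) - oneCoord E G - expMean (adCLM E G X) Y‖ ≤ C * (M * ‖Y‖) ^ 2 := by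
    intro Y hY
    have h := H (fun t => lieExp (t • (X + Y)) * lieExp (t • (-X)))
      (fun t => NormedSpace.exp (t • adCLM E G X) Y)
      (fun t => (NormedSpace.exp (t • blockOp (adCLM E G X)) (0, Y)).1) (M * ‖Y‖) hY (by simp)
      (fun t => by
        have h1 := (hasLogVelocityAt_lieExp (G := G) (X + Y) t).mul
          (hasLogVelocityAt_lieExp (G := G) (-X) t)
        have h2 : ((Ad E (lieExp (t • -X) : G)⁻¹ : (E →L[ℝ] E)ˣ) : E →L[ℝ] E).comp
            ((1 : ℝ →L[ℝ] ℝ).smulRight (X + Y)) + (1 : ℝ →L[ℝ] ℝ).smulRight (-X)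
            = (1 : ℝ →L[ℝ] ℝ).smulRight (NormedSpace.exp (t • adCLM E G X) Y) := by
          ext
          rw [smul_neg, lieExp_neg, inv_inv]
          simp [Ad_lieExp_self (G := G) X t]
          rw [Ad_lieExp_smul]
        rw [HasLogVelocityAt, ← h2]
        exact h1)
      (fun t => hasDerivAt_fst_exp_blockOp _ _ t) (by simp)
      (fun t ht => (ContinuousLinearMap.le_opNorm _ _).trans (by gcongr; exact hM t ht))
    simpa [expMean, k] using h
  have hsmall : ∀ᶠ Y in 𝓝 (0 : E), M * ‖Y‖ ≤ ε₀ := by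
    have : Tendsto (fun Y : E => M * ‖Y‖) (𝓝 0) (𝓝 0) := by
      have hc : Continuous fun Y : E => M * ‖Y‖ := by fun_prop
      simpa using hc.tendsto 0
    exact (this.eventually (gt_mem_nhds hε₀)).mono fun _ h => h.le
  have hk0 : k 0 = 1 := by simp [k, lieExp_neg]
  have hfd : HasFDerivAt (fun Y => oneChart E G (k Y)) (expMean (adCLM E G X)) 0 := by
    rw [hasFDerivAt_iff_isLittleO_nhds_zero]
    have hO : (fun Y : E => oneChart E G (k (0 + Y)) - oneChart E G (k 0)
        - expMean (adCLM E G X) Y) =O[𝓝 0] fun Y : E => ‖Y‖ ^ 2 := by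
      refine Asymptotics.IsBigO.of_bound (C * M ^ 2) ?_
      filter_upwards [hsmall] with Y hY
      have := (key Y hY).2
      rw [zero_add, hk0]
      refine this.trans (le_of_eq ?_)
      rw [norm_pow, norm_norm]; ring
    exact hO.trans_isLittleO (by
      simpa using (Asymptotics.isLittleO_norm_pow_id (E' := E) one_lt_two))
  have htend : Tendsto k (𝓝 0) (𝓝 1) := by
    have h1 : Tendsto (fun Y => oneChart E G (k Y)) (𝓝 0) (𝓝 (oneCoord E G)) := by
      have := hfd.continuousAt.tendsto
      simpa only [hk0, oneCoord] using this
    refine (tendsto_oneChart_symm.comp h1).congr' ?_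
    filter_upwards [hsmall] with Y hY
    exact (oneChart E G).left_inv (key Y hY).1
  have hsub : Tendsto (fun Z : E => Z - X) (𝓝 X) (𝓝 0) := by
    have hc : Continuous fun Z : E => Z - X := by fun_prop
    simpa using hc.tendsto X
  have hexp : ∀ Z : E, (lieExp Z : G) = k (Z - X) * lieExp X := fun Z => by
    simp [k, lieExp_neg]
  refine ⟨?_, ?_⟩
  · have h1 : Tendsto (fun Z => k (Z - X) * lieExp X) (𝓝 X) (𝓝 (1 * lieExp X)) :=
      (htend.comp hsub).mul tendsto_const_nhds
    simpa only [ContinuousAt, ← hexp, one_mul] using h1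
  · have h1 : HasFDerivAt (fun Z => oneChart E G (k (Z - X))) (expMean (adCLM E G X)) X := by
      have h2 : HasFDerivAt (fun Y => oneChart E G (k Y)) (expMean (adCLM E G X)) (X - X) := by
        rwa [sub_self]
      exact HasFDerivAt.comp (g := fun Y => oneChart E G (k Y)) (f := fun Z : E => Z - X) X h2
        ((hasFDerivAt_id X).sub_const X)
    have h2 := hasFDerivAt_conj (E := E) (lieExp (-X) : G)
    have e : oneChart E G (k (X - X)) = oneCoord E G := by rw [sub_self, hk0]; rfl
    rw [← e] at h2
    have h3 := HasFDerivAt.comp X h2 h1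
    have h4 : ((Ad E (lieExp (-X) : G) : (E →L[ℝ] E)ˣ) : E →L[ℝ] E).comp (expMean (adCLM E G X))
        = logDerivExp E G X := by
      rw [logDerivExp, Ad_lieExp, map_neg]
    rw [h4] at h3
    refine h3.congr_of_eventuallyEq ?_
    filter_upwards [(htend.comp hsub).eventually (eventually_oneChart_left_inv (E := E))] with Z hZ
    simp only [Function.comp] at hZ ⊢
    rw [hZ, hexp Z, lieExp_neg]
    congr 1
    group

theorem continuous_lieExp : Continuous (lieExp : E → G) :=
  continuous_iff_continuousAt.2 fun X => (hasLogDerivAt_lieExp X).continuousAt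

/-- Bootstrap: the derivative is a smooth expression in `X` and in the map itself, so class `C^n`
improves to `C^(n+1)`. -/
theorem contDiffOn_oneChart_lieExp : ContDiffOn ℝ ∞ (fun X : E => oneChart E G (lieExp X))
    (lieExp ⁻¹' (oneChart E G).source) := by
  set U : Set E := lieExp ⁻¹' (oneChart E G).source with hU
  have hUo : IsOpen U := isOpen_oneChart_source.preimage continuous_lieExp
  have hder : ∀ X ∈ U, HasFDerivAt (fun X : E => oneChart E G (lieExp X))
      ((chartLeft E G (oneChart E G (lieExp X))).comp (logDerivExp E G X)) X := fun X hX =>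
    (hasLogDerivAt_lieExp X).hasFDerivAt_oneChart hX
  refine contDiffOn_infty.2 fun n => ?_
  induction n with
  | zero =>
    exact contDiffOn_zero.2 fun X hX => (hder X hX).continuousAt.continuousWithinAt
  | succ n ih =>
    rw [Nat.cast_succ, contDiffOn_succ_iff_fderiv_of_isOpen hUo]
    refine ⟨fun X hX => (hder X hX).differentiableAt.differentiableWithinAt, by simp, ?_⟩
    have h1 : ContDiffOn ℝ n (fun X : E =>
        (chartLeft E G (oneChart E G (lieExp X))).comp (logDerivExp E G X)) U := by
      refine ContDiffOn.clm_comp ?_ ((contDiff_logDerivExp.of_le (by norm_cast; simp)).contDiffOn)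
      exact ((contDiffOn_chartLeft (E := E) (G := G)).of_le (by norm_cast; simp)).comp ih
        fun X hX => (oneChart E G).map_source hX
    exact h1.congr fun X hX => (hder X hX).fderiv

theorem lieExp_preimage_mem_nhds : lieExp ⁻¹' (oneChart E G).source ∈ 𝓝 (0 : E) :=
  (isOpen_oneChart_source.preimage continuous_lieExp).mem_nhds
    (by simpa using one_mem_oneChart_source (E := E) (G := G))

theorem contMDiffOn_lieExp : ContMDiffOn 𝓘(ℝ, E) 𝓘(ℝ, E) ∞ (lieExp : E → G)
    (lieExp ⁻¹' (oneChart E G).source) := by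
  have h1 : ContMDiffOn 𝓘(ℝ, E) 𝓘(ℝ, E) ∞
      (fun X : E => (oneChart E G).symm (oneChart E G (lieExp X)))
      (lieExp ⁻¹' (oneChart E G).source) :=
    (contMDiffOn_extChartAt_symm (I := 𝓘(ℝ, E)) (n := ∞) (1 : G)).comp
      (contDiffOn_oneChart_lieExp.contMDiffOn) fun X hX => (oneChart E G).map_source hX
  exact h1.congr fun X hX => ((oneChart E G).left_inv hX).symm

theorem contMDiffAt_lieExp_zero : ContMDiffAt 𝓘(ℝ, E) 𝓘(ℝ, E) ∞ (lieExp : E → G) 0 :=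
  contMDiffOn_lieExp.contMDiffAt lieExp_preimage_mem_nhds

theorem hasFDerivAt_oneChart_lieExp_zero :
    HasFDerivAt (fun X : E => oneChart E G (lieExp X)) (ContinuousLinearMap.id ℝ E) 0 := by
  have h := (hasLogDerivAt_lieExp (G := G) (0 : E)).hasFDerivAt
  simp only [lieExp_zero, inv_one, one_mul] at h
  -- Test on the lines `t ↦ t • Y`, along which the velocity at `0` is known to be `Y`.
  have h2 : logDerivExp E G 0 = ContinuousLinearMap.id ℝ E := by
    ext Y
    have h3 := (hasLogVelocityAt_lieExp (G := G) Y 0)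
    have h4 : HasLogDerivAt (lieExp : E → G) (logDerivExp E G 0) ((0 : ℝ) • Y) := by
      rw [zero_smul]; exact hasLogDerivAt_lieExp 0
    have h5 := h4.comp (k := fun t : ℝ => t • Y)
      (((1 : ℝ →L[ℝ] ℝ).smulRight Y).hasFDerivAt (x := 0))
    have h6 := congrArg (fun T : ℝ →L[ℝ] E => T 1) (h5.unique h3)
    simpa using h6
  rwa [h2] at h

end ExpSmooth

/-! ### Extending local homomorphisms from a simply connected group -/

section LocalHom

variable {G : Type*} [TopologicalSpace G] [Group G] [IsTopologicalGroup G] {H : Type*} [Group H]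
  {f : G → H} {U : Set G}

theorem eventually_nhds_of_eventually_mul {P : G → Prop} {g : G}
    (h : ∀ᶠ w in 𝓝 (1 : G), P (g * w)) : ∀ᶠ x in 𝓝 g, P x := by
  have ht : Tendsto (fun x : G => g⁻¹ * x) (𝓝 g) (𝓝 1) := by
    have hc : Continuous fun x : G => g⁻¹ * x := by fun_prop
    simpa using hc.tendsto g
  filter_upwards [ht.eventually h] with x hx
  simpa using hx

theorem eventually_mul_of_eventually_nhds {P : G → Prop} {g : G}
    (h : ∀ᶠ x in 𝓝 g, P x) : ∀ᶠ w in 𝓝 (1 : G), P (g * w) := by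
  have ht : Tendsto (fun x : G => g * x) (𝓝 1) (𝓝 g) := by
    have hc : Continuous fun x : G => g * x := by fun_prop
    simpa using hc.tendsto 1
  exact ht.eventually h

/-- The bundle with fibre `H` over `G` whose flat sections are the maps `φ` such that
`φ (g * w) = φ g * f w` for `w` close to `1`. -/
def localHomBundle [TopologicalSpace H] [DiscreteTopology H] (hU : IsOpen U) (h1 : (1 : G) ∈ U)
    (hf : ∀ x ∈ U, ∀ y ∈ U, f (x * y) = f x * f y) : FiberBundleCore G G H where
  baseSet g := {x | g⁻¹ * x ∈ U}
  isOpen_baseSet g := hU.preimage (by fun_prop : Continuous fun x : G => g⁻¹ * x)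
  indexAt x := x
  mem_baseSet_at x := by simpa using h1
  coordChange g g' x h := h * f (g⁻¹ * x) * (f (g'⁻¹ * x))⁻¹
  coordChange_self g x _ v := by group
  continuousOn_coordChange g g' := by
    rintro ⟨x, h⟩ ⟨⟨hx, hx'⟩, -⟩
    refine ContinuousAt.continuousWithinAt ?_
    refine (continuousAt_const (y := h * f (g⁻¹ * x) * (f (g'⁻¹ * x))⁻¹)).congr ?_
    -- Replacing `x` by `x w` with `w ∈ U` multiplies both values of `f` on the right by `f w`,
    -- which cancels: the transition functions are locally constant.
    have e1 : ∀ᶠ y in 𝓝 x, h * f (g⁻¹ * x) * (f (g'⁻¹ * x))⁻¹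
        = h * f (g⁻¹ * y) * (f (g'⁻¹ * y))⁻¹ := by
      refine eventually_nhds_of_eventually_mul ?_
      filter_upwards [hU.mem_nhds h1] with w hw
      rw [← mul_assoc, ← mul_assoc, hf _ hx w hw, hf _ hx' w hw]
      group
    have e2 : ∀ᶠ k in 𝓝 h, k = h := by
      rw [nhds_discrete]; exact eventually_pure.2 rfl
    rw [nhds_prod_eq]
    filter_upwards [e1.prod_mk e2] with p hp
    rw [hp.2]
    exact hp.1
  coordChange_comp i j k x _ v := by group

/-- With `H` discrete the bundle is a covering of `G`, and simple connectedness lifts the identity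
to a section through `(1, 1)`. Its fibre coordinate `ψ` satisfies `ψ (g w) = ψ g * f w` for `w` near
`1`, so `b ↦ ψ (a b) (ψ b)⁻¹` is locally constant, hence equal to `ψ a`. -/
theorem exists_monoidHom_eventuallyEq [SimplyConnectedSpace G] [LocallyPathConnectedSpace G]
    (hU : IsOpen U) (h1 : (1 : G) ∈ U) (hf : ∀ x ∈ U, ∀ y ∈ U, f (x * y) = f x * f y) :
    ∃ φ : G →* H, φ =ᶠ[𝓝 1] f := by
  let _ : TopologicalSpace H := ⊥
  have : DiscreteTopology H := ⟨rfl⟩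
  have hf1 : f 1 = 1 := by simpa using hf 1 h1 1 h1
  let Z := localHomBundle hU h1 hf
  have hcov : IsCoveringMap (Bundle.TotalSpace.proj : Bundle.TotalSpace H Z.Fiber → G) :=
    FiberBundle.isCoveringMap (F := H) (E := Z.Fiber)
  let e₀ : Bundle.TotalSpace H Z.Fiber := ⟨1, (1 : H)⟩
  obtain ⟨F, ⟨hF1, hF⟩, -⟩ := hcov.existsUnique_continuousMap_lifts (ContinuousMap.id G) 1 e₀ rfl
  have hFx : ∀ x, (F x).1 = x := fun x => congrFun hF x
  let ψ : G → H := fun x => (F x).2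
  have hψ1 : ψ 1 = 1 := by
    let q : Bundle.TotalSpace H Z.Fiber → H := fun p => p.2
    exact congrArg q hF1
  have hloc : ∀ g, ∀ᶠ w in 𝓝 (1 : G), ψ (g * w) = ψ g * f w := by
    intro g
    have hg : F g ∈ (Z.localTriv g).source := by
      rw [Z.mem_localTriv_source, hFx]
      exact Z.mem_baseSet_at g
    have hc : ContinuousAt (fun x => ((Z.localTriv g) (F x)).2) g :=
      continuousAt_snd.comp (((Z.localTriv g).continuousAt hg).comp F.continuous.continuousAt)
    -- The point over `x` is stored in the trivialisation indexed by `x`; reading it in that of `g`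
    -- applies the coordinate change. Continuity into a discrete space then makes this locally
    -- constant.
    have h2 : ∀ x, ((Z.localTriv g) (F x)).2 = ψ x * (f (g⁻¹ * x))⁻¹ := by
      intro x
      have : ((Z.localTriv g) (F x)).2 = ψ x * f ((F x).1⁻¹ * (F x).1) * (f (g⁻¹ * (F x).1))⁻¹ :=
        rfl
      rw [this, hFx, inv_mul_cancel, hf1, mul_one]
    simp only [h2] at hc
    have h3 := hc.tendsto
    rw [nhds_discrete H, tendsto_pure] at h3
    filter_upwards [eventually_mul_of_eventually_nhds h3] with w hw
    simp only [inv_mul_cancel, hf1, inv_one, mul_one, inv_mul_cancel_left] at hw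
    rw [← hw, inv_mul_cancel_right]
  refine ⟨MonoidHom.mk' ψ fun a b => ?_, ?_⟩
  · have hlc : IsLocallyConstant fun b => ψ (a * b) * (ψ b)⁻¹ := by
      refine (IsLocallyConstant.iff_eventually_eq _).2 fun b => ?_
      refine eventually_nhds_of_eventually_mul ?_
      filter_upwards [hloc b, hloc (a * b)] with w hw hw'
      rw [← mul_assoc, hw, hw']
      group
    have h2 := hlc.apply_eq_of_preconnectedSpace b 1
    simp only [mul_one, hψ1, inv_one] at h2
    exact (mul_inv_eq_iff_eq_mul.1 h2)
  · have := hloc 1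
    simp only [one_mul, hψ1] at this
    exact this

theorem monoidHom_eq_of_eventuallyEq_one [PreconnectedSpace G] {φ ψ : G →* H}
    (h : φ =ᶠ[𝓝 1] ψ) : φ = ψ := by
  have hlc : IsLocallyConstant fun b => φ b * (ψ b)⁻¹ := by
    refine (IsLocallyConstant.iff_eventually_eq _).2 fun b => ?_
    refine eventually_nhds_of_eventually_mul ?_
    filter_upwards [h] with w hw
    rw [map_mul, map_mul, hw]
    group
  ext b
  have h2 := hlc.apply_eq_of_preconnectedSpace b 1
  simp only [map_one, inv_one, mul_one] at h2
  exact mul_inv_eq_one.1 h2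

end LocalHom

/-! ### Local logarithm and integration of Lie algebra endomorphisms -/

section Log

variable {E : Type*} [NormedAddCommGroup E] [NormedSpace ℝ E] [FiniteDimensional ℝ E]
  {G : Type*} [TopologicalSpace G] [ChartedSpace E G] [Group G] [LieGroup 𝓘(ℝ, E) ∞ G]

/-- The inverse function theorem for maps `E → G` with derivative `id` at the identity. -/
theorem exists_local_inverse {Ψ : E → G} (h0 : Ψ 0 = 1) (hΨ : ContMDiffAt 𝓘(ℝ, E) 𝓘(ℝ, E) ∞ Ψ 0)
    (hd : HasFDerivAt (fun X => oneChart E G (Ψ X)) (ContinuousLinearMap.id ℝ E) 0) :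
    ∃ l : G → E, l 1 = 0 ∧ ContMDiffAt 𝓘(ℝ, E) 𝓘(ℝ, E) ∞ l 1 ∧
      (∀ᶠ g in 𝓝 1, Ψ (l g) = g) ∧ ∀ᶠ X in 𝓝 0, l (Ψ X) = X := by
  have hc : ContDiffAt ℝ ∞ (fun X => oneChart E G (Ψ X)) 0 :=
    contDiffAt_oneChart_comp le_rfl hΨ (by rw [h0]; exact one_mem_oneChart_source)
  have hd' : HasFDerivAt (fun X => oneChart E G (Ψ X))
      ((ContinuousLinearEquiv.refl ℝ E : E ≃L[ℝ] E) : E →L[ℝ] E) 0 := hd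
  have hs := hc.hasStrictFDerivAt' hd' (by simp)
  have e : oneChart E G (Ψ 0) = oneCoord E G := by rw [h0]; rfl
  set k : E → E := hc.localInverse hd' (by simp) with hk
  have hk0 : k (oneCoord E G) = 0 := by
    rw [← e]; exact hc.localInverse_apply_image hd' (by simp)
  have hkc : ContDiffAt ℝ ∞ k (oneCoord E G) := by
    rw [← e]; exact hc.to_localInverse hd' (by simp)
  have ht : Tendsto Ψ (𝓝 0) (𝓝 1) := by
    have := hΨ.continuousAt.tendsto
    rwa [h0] at this
  have hkt : Tendsto (fun g => Ψ (k (oneChart E G g))) (𝓝 1) (𝓝 1) := by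
    refine ht.comp (Tendsto.comp ?_ tendsto_oneChart)
    have := hkc.continuousAt.tendsto
    rwa [hk0] at this
  refine ⟨fun g => k (oneChart E G g), hk0, ?_, ?_, ?_⟩
  · exact ContMDiffAt.comp (g := k) (f := oneChart E G) (1 : G) (I' := 𝓘(ℝ, E)) hkc.contMDiffAt
      (contMDiffAt_oneChart one_mem_oneChart_source)
  · have h1 : ∀ᶠ y in 𝓝 (oneCoord E G), oneChart E G (Ψ (k y)) = y := by
      rw [← e]; exact hs.eventually_right_inverse
    filter_upwards [tendsto_oneChart.eventually h1, hkt.eventually (oneChart_source_mem_nhds (E := E)),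
      oneChart_source_mem_nhds (E := E) (G := G)] with g h2 h3 h4
    exact (oneChart E G).injOn h3 h4 h2
  · exact hs.eventually_left_inverse

theorem eventually_differentiableAt_comp_oneChart_symm {F : Type*} [NormedAddCommGroup F] [NormedSpace ℝ F]
    {f : G → F} (hf : ContMDiffAt 𝓘(ℝ, E) 𝓘(ℝ, F) ∞ f 1) :
    ∀ᶠ g in 𝓝 (1 : G), DifferentiableAt ℝ (fun z => f ((oneChart E G).symm z))
      (oneChart E G g) := by
  have h1 : ContDiffAt ℝ ∞ (fun z => f ((oneChart E G).symm z)) (oneCoord E G) := by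
    rw [← contMDiffAt_iff_contDiffAt]
    refine ContMDiffAt.comp (g := f) (f := (oneChart E G).symm) (I' := 𝓘(ℝ, E)) (oneCoord E G)
      ?_ (contMDiffAt_oneChart_symm oneCoord_mem_target)
    rwa [oneChart_symm_oneCoord]
  have h2 := (h1.of_le (m := 1) (by norm_cast)).eventually (by simp)
  exact (tendsto_oneChart.eventually h2).mono fun g hg => hg.differentiableAt (by simp)

variable [IsTopologicalGroup G] [T2Space G]

variable (E G) in
theorem exists_lieLog : ∃ l : G → E, l 1 = 0 ∧ ContMDiffAt 𝓘(ℝ, E) 𝓘(ℝ, E) ∞ l 1 ∧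
      (∀ᶠ g in 𝓝 1, lieExp (l g) = g) ∧ ∀ᶠ X in 𝓝 0, l (lieExp X) = X :=
  exists_local_inverse lieExp_zero contMDiffAt_lieExp_zero hasFDerivAt_oneChart_lieExp_zero

/-- A local inverse of the exponential map. -/
def lieLog (g : G) : E := (exists_lieLog E G).choose g

theorem lieLog_one : (lieLog (1 : G) : E) = 0 := (exists_lieLog E G).choose_spec.1

theorem contMDiffAt_lieLog : ContMDiffAt 𝓘(ℝ, E) 𝓘(ℝ, E) ∞ (lieLog : G → E) 1 :=
  (exists_lieLog E G).choose_spec.2.1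

theorem eventually_lieExp_lieLog : ∀ᶠ g in 𝓝 (1 : G), lieExp (lieLog g : E) = g :=
  (exists_lieLog E G).choose_spec.2.2.1

theorem eventually_lieLog_lieExp : ∀ᶠ X in 𝓝 (0 : E), lieLog (lieExp X : G) = X :=
  (exists_lieLog E G).choose_spec.2.2.2

theorem tendsto_lieLog : Tendsto (lieLog : G → E) (𝓝 1) (𝓝 0) := by
  have := (contMDiffAt_lieLog (E := E) (G := G)).continuousAt.tendsto
  rwa [lieLog_one] at this

theorem tendsto_lieExp : Tendsto (lieExp : E → G) (𝓝 0) (𝓝 1) := by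
  simpa using (continuous_lieExp (E := E) (G := G)).tendsto 0

variable {h : E →L[ℝ] E}

/-- A Lie algebra endomorphism carries, through the exponential map, curves of constant
logarithmic velocity to such curves. -/
theorem hasLogVelocityAt_lieExp_comp (hh : ∀ X Y, h (adCLM E G X Y) = adCLM E G (h X) (h Y))
    {Z : ℝ → E} {t : ℝ} {X : E} (hZ : DifferentiableAt ℝ Z t)
    (hX : HasLogVelocityAt (fun t => (lieExp (Z t) : G)) X t) :
    HasLogVelocityAt (fun t => (lieExp (h (Z t)) : G)) (h X) t := by
  have h1 := (hasLogDerivAt_lieExp (G := G) (Z t)).comp hZ.hasFDerivAt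
  have h2 := congrArg (fun T : ℝ →L[ℝ] E => h (T 1)) (h1.unique hX)
  have h3 := (hasLogDerivAt_lieExp (G := G) (h (Z t))).comp (k := fun t => h (Z t))
    (h.hasFDerivAt.comp t hZ.hasFDerivAt)
  rw [HasLogVelocityAt]
  convert! h3 using 1
  ext
  -- By naturality, applying `h` before `exp` or to the velocity afterwards gives the same vector.
  have h4 := congrArg (fun T : E →L[ℝ] E => T (fderiv ℝ Z t 1)) (logDerivExp_comp hh (Z t))
  simp only [ContinuousLinearMap.comp_apply, ContinuousLinearMap.smulRight_apply,
    one_apply_eq_self, one_smul] at h2 h4 ⊢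
  rw [← h4, h2]

/-- Put `f = exp ∘ h ∘ log` and `x = exp X`. The curve `t ↦ y exp (tX)` has velocity `X`, so its
image under `f` has velocity `h X`, like `t ↦ f y * exp (t h X)`. Both start at `f y`, and
uniqueness compares them at `t = 1`. -/
theorem exists_isOpen_lieExp_lieLog_mul
    (hh : ∀ X Y, h (adCLM E G X Y) = adCLM E G (h X) (h Y)) :
    ∃ U : Set G, IsOpen U ∧ 1 ∈ U ∧ ∀ x ∈ U, ∀ y ∈ U,
      (lieExp (h (lieLog (x * y))) : G) = lieExp (h (lieLog x)) * lieExp (h (lieLog y)) := by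
  set V : Set G := {g | g ∈ (oneChart E G).source ∧ lieExp (lieLog g : E) = g ∧
    DifferentiableAt ℝ (fun z => (lieLog ((oneChart E G).symm z) : E)) (oneChart E G g)} with hV
  have hV1 : V ∈ 𝓝 (1 : G) := by
    filter_upwards [oneChart_source_mem_nhds (E := E) (G := G),
      eventually_lieExp_lieLog (E := E) (G := G),
      eventually_differentiableAt_comp_oneChart_symm (contMDiffAt_lieLog (E := E) (G := G))] with g h1 h2 h3
    exact ⟨h1, h2, h3⟩
  obtain ⟨W, hWo, hW1, hWV⟩ := exists_open_nhds_one_mul_subset hV1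
  obtain ⟨r, hr, hrW⟩ := Metric.mem_nhds_iff.1
    (tendsto_lieExp (E := E) (G := G) (hWo.mem_nhds hW1))
  -- The half radius leaves room for `|t| < 2`, an open interval containing both `0` and `1`, as the
  -- uniqueness theorem requires.
  have hr2 : 0 < r / 2 := by linarith
  obtain ⟨U, hUs, hUo, hU1⟩ := mem_nhds_iff.1 (inter_mem (inter_mem (hWo.mem_nhds hW1) hV1)
    (tendsto_lieLog (E := E) (G := G) (Metric.ball_mem_nhds 0 hr2)))
  refine ⟨U, hUo, hU1, fun y hy x hx => ?_⟩
  obtain ⟨⟨hyW, hyV⟩, -⟩ := hUs hy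
  obtain ⟨⟨-, hxV⟩, hxr⟩ := hUs hx
  set X : E := lieLog x with hX
  set γ : ℝ → G := fun t => y * lieExp (t • X) with hγ
  have hγv : ∀ t, HasLogVelocityAt γ X t := fun t => (hasLogVelocityAt_lieExp X t).const_mul y
  have hγV : ∀ t ∈ Set.Ioo (-2 : ℝ) 2, γ t ∈ V := by
    intro t ht
    refine hWV (Set.mul_mem_mul hyW (hrW ?_))
    have hn : ‖X‖ < r / 2 := by simpa using hxr
    rw [Metric.mem_ball, dist_zero_right, norm_smul, Real.norm_eq_abs]
    have ht2 : |t| < 2 := abs_lt.2 ht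
    calc |t| * ‖X‖ ≤ 2 * ‖X‖ := by gcongr
      _ < r := by linarith
  set Z : ℝ → E := fun t => lieLog (γ t) with hZ
  have hZe : ∀ t ∈ Set.Ioo (-2 : ℝ) 2, lieExp (Z t) = γ t := fun t ht => (hγV t ht).2.1
  have hZd : ∀ t ∈ Set.Ioo (-2 : ℝ) 2, DifferentiableAt ℝ Z t := by
    intro t ht
    have h1 := ((hγv t).hasFDerivAt_oneChart (hγV t ht).1).differentiableAt
    have h2 := DifferentiableAt.comp (g := fun z => (lieLog ((oneChart E G).symm z) : E))
      (f := fun t => oneChart E G (γ t)) t (hγV t ht).2.2 h1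
    refine h2.congr_of_eventuallyEq ?_
    filter_upwards [isOpen_Ioo.mem_nhds ht] with s hs
    simp only [Function.comp, (oneChart E G).left_inv (hγV s hs).1, hZ]
  have hv : ∀ t ∈ Set.Ioo (-2 : ℝ) 2,
      HasLogVelocityAt (fun t => (lieExp (h (Z t)) : G)) (h X) t := by
    intro t ht
    refine hasLogVelocityAt_lieExp_comp hh (hZd t ht) ((hγv t).congr_of_eventuallyEq ?_)
    filter_upwards [isOpen_Ioo.mem_nhds ht] with s hs
    exact hZe s hs
  have hZ0 : Z 0 = lieLog y := by simp [hZ, hγ]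
  have hEq := eqOn_of_hasLogVelocityAt (t₀ := 0) (by norm_num) hv
    (fun t _ => (hasLogVelocityAt_lieExp (G := G) (h X) t).const_mul (lieExp (h (lieLog y))))
    (by simp [hZ0])
  have h1 := hEq (show (1 : ℝ) ∈ Set.Ioo (-2 : ℝ) 2 by norm_num)
  simp only [one_smul] at h1
  have hZ1 : Z 1 = lieLog (y * x) := by
    simp only [hZ, hγ, one_smul]
    rw [hX, hxV.2.1]
  rw [hZ1] at h1
  exact h1

/-- The extension of the local homomorphism has the right values on `exp` of small vectors; for the
others use `exp X = exp (X / n) ^ n`. -/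
theorem exists_monoidHom_lieExp [SimplyConnectedSpace G] [LocallyPathConnectedSpace G]
    (hh : ∀ X Y, h (adCLM E G X Y) = adCLM E G (h X) (h Y)) :
    ∃ φ : G →* G, ∀ X : E, φ (lieExp X) = lieExp (h X) := by
  obtain ⟨U, hUo, hU1, hU⟩ := exists_isOpen_lieExp_lieLog_mul (G := G) hh
  obtain ⟨φ, hφ⟩ := exists_monoidHom_eventuallyEq (f := fun g : G => (lieExp (h (lieLog g)) : G))
    hUo hU1 hU
  refine ⟨φ, fun X => ?_⟩
  have h1 : ∀ᶠ Y in 𝓝 (0 : E), φ (lieExp Y) = lieExp (h Y) := by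
    filter_upwards [tendsto_lieExp.eventually hφ, eventually_lieLog_lieExp (E := E) (G := G)]
      with Y h1 h2
    rw [h1, h2]
  have h2 : Tendsto (fun n : ℕ => ((n : ℝ)⁻¹) • X) atTop (𝓝 0) := by
    have := (tendsto_inv_atTop_nhds_zero_nat (𝕜 := ℝ)).smul_const X
    simpa using this
  obtain ⟨n, hn, hn0⟩ := ((h2.eventually h1).and (eventually_gt_atTop 0)).exists
  have h3 : (n : ℝ) • ((n : ℝ)⁻¹ • X) = X := by
    rw [smul_smul, mul_inv_cancel₀ (by positivity), one_smul]
  calc φ (lieExp X) = φ (lieExp ((n : ℝ) • ((n : ℝ)⁻¹ • X))) := by rw [h3]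
    _ = lieExp (h ((n : ℝ) • ((n : ℝ)⁻¹ • X))) := by
      rw [lieExp_nsmul, map_pow, hn, map_smul h (n : ℝ), lieExp_nsmul]
    _ = lieExp (h X) := by rw [h3]

/-- The image of `exp` contains a neighbourhood of `1`, and homomorphisms on a connected group are
determined by their germ at `1`. -/
theorem monoidHom_ext_lieExp [PreconnectedSpace G] {H : Type*} [Group H] {φ ψ : G →* H}
    (hφ : ∀ X : E, φ (lieExp X) = ψ (lieExp X)) : φ = ψ := by
  refine monoidHom_eq_of_eventuallyEq_one ?_
  filter_upwards [eventually_lieExp_lieLog (E := E) (G := G)] with g hg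
  rw [← hg, hφ]

theorem contMDiff_monoidHom {φ : G →* G} (hφ : ContMDiffAt 𝓘(ℝ, E) 𝓘(ℝ, E) ∞ φ 1) :
    ContMDiff 𝓘(ℝ, E) 𝓘(ℝ, E) ∞ φ := by
  intro g
  have h1 : ContMDiffAt 𝓘(ℝ, E) 𝓘(ℝ, E) ∞ (fun x : G => g⁻¹ * x) g :=
    (contMDiff_mul_left (I := 𝓘(ℝ, E)) (n := ∞) (a := g⁻¹)) g
  have h2 : ContMDiffAt 𝓘(ℝ, E) 𝓘(ℝ, E) ∞ φ (g⁻¹ * g) := by rwa [inv_mul_cancel]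
  have h3 := (contMDiff_mul_left (I := 𝓘(ℝ, E)) (n := ∞) (a := φ g)).contMDiffAt.comp g
    (h2.comp g h1)
  refine h3.congr_of_eventuallyEq (Eventually.of_forall fun x => ?_)
  simp [Function.comp]

theorem contMDiff_of_lieExp {φ : G →* G} (hφ : ∀ X : E, φ (lieExp X) = lieExp (h X)) :
    ContMDiff 𝓘(ℝ, E) 𝓘(ℝ, E) ∞ φ := by
  refine contMDiff_monoidHom ?_
  have h1 : ContMDiffAt 𝓘(ℝ, E) 𝓘(ℝ, E) ∞ (fun g : G => h (lieLog g)) 1 :=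
    h.contMDiff.contMDiffAt.comp (1 : G) contMDiffAt_lieLog
  have h2 : ContMDiffAt 𝓘(ℝ, E) 𝓘(ℝ, E) ∞ (lieExp : E → G) (h (lieLog (1 : G))) := by
    rw [lieLog_one, map_zero]; exact contMDiffAt_lieExp_zero
  refine (h2.comp (1 : G) h1).congr_of_eventuallyEq ?_
  filter_upwards [eventually_lieExp_lieLog (E := E) (G := G)] with g hg
  simp only [Function.comp]
  rw [← hφ, hg]

theorem hasFDerivAt_oneChart_monoidHom {φ : G →* G}
    (hφ : ContMDiff 𝓘(ℝ, E) 𝓘(ℝ, E) ∞ φ) :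
    HasFDerivAt (fun z => oneChart E G (φ ((oneChart E G).symm z)))
      (differential φ 1 : E →L[ℝ] E) (oneCoord E G) := by
  rw [differential_one_eq_fderiv (hφ.mdifferentiable (by simp) 1) (map_one φ)]
  refine DifferentiableAt.hasFDerivAt ?_
  refine ContDiffAt.differentiableAt (n := ∞) ?_ (by simp)
  refine contDiffAt_oneChart_comp le_rfl ?_ ?_
  · exact hφ.contMDiffAt.comp (oneCoord E G) (contMDiffAt_oneChart_symm oneCoord_mem_target)
  · rw [oneChart_symm_oneCoord, map_one]
    exact one_mem_oneChart_source

theorem hasLogVelocityAt_monoidHom {φ : G →* G} (hφ : ContMDiff 𝓘(ℝ, E) 𝓘(ℝ, E) ∞ φ) {γ : ℝ → G}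
    {X : E} {t : ℝ} (hγ : HasLogVelocityAt γ X t) :
    HasLogVelocityAt (fun t => φ (γ t)) ((differential φ 1 : E →L[ℝ] E) X) t := by
  refine ⟨ContinuousAt.comp (g := φ) hφ.continuous.continuousAt hγ.continuousAt, ?_⟩
  have e : oneChart E G ((γ t)⁻¹ * γ t) = oneCoord E G := by simp [oneCoord]
  have h1 := hasFDerivAt_oneChart_monoidHom hφ
  rw [← e] at h1
  have h2 := HasFDerivAt.comp t h1 hγ.hasFDerivAt
  have h3 : (differential φ 1 : E →L[ℝ] E).comp ((1 : ℝ →L[ℝ] ℝ).smulRight X)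
      = (1 : ℝ →L[ℝ] ℝ).smulRight ((differential φ 1 : E →L[ℝ] E) X) := by
    ext; simp
  rw [h3] at h2
  refine h2.congr_of_eventuallyEq ?_
  filter_upwards [hγ.tendsto.eventually (eventually_oneChart_left_inv (E := E))] with s hs
  simp only [Function.comp, hs, map_mul, map_inv]

theorem map_lieExp {φ : G →* G} (hφ : ContMDiff 𝓘(ℝ, E) 𝓘(ℝ, E) ∞ φ) (X : E) :
    φ (lieExp X) = lieExp ((differential φ 1 : E →L[ℝ] E) X) := by
  have := eq_mul_lieExp (fun t => hasLogVelocityAt_monoidHom hφ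
    (hasLogVelocityAt_lieExp (G := G) X t)) 1
  simpa using this

theorem differential_of_lieExp {φ : G →* G} (hφ : ∀ X : E, φ (lieExp X) = lieExp (h X)) :
    (differential φ 1 : E →L[ℝ] E) = h := by
  have hs := contMDiff_of_lieExp hφ
  ext X
  have h1 := hasLogVelocityAt_monoidHom hs (hasLogVelocityAt_lieExp (G := G) X 0)
  have h2 := hasLogVelocityAt_lieExp (G := G) (h X) 0
  simp only [hφ, map_smul] at h1
  simpa using congrArg (fun T : ℝ →L[ℝ] E => T 1) (h1.unique h2)

end Log

/-! ### Automorphisms of the Lie algebra form an algebraic group -/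

section Aut

variable {E : Type*} [NormedAddCommGroup E] [NormedSpace ℝ E] [FiniteDimensional ℝ E]

theorem repr_apply_eq_sum {ι : Type*} [Fintype ι] (b : Module.Basis ι ℝ E) (g : E →L[ℝ] E) (v : E)
    (k : ι) : b.repr (g v) k = ∑ l, b.repr v l * b.repr (g (b l)) k := by
  conv_lhs => rw [← b.sum_repr v]
  simp only [map_sum, map_smul, Finsupp.finsetSum_apply, Finsupp.smul_apply, smul_eq_mul]

/-- The group of automorphisms of a bilinear operation. -/
def bilinAut (β : E →L[ℝ] E →L[ℝ] E) : Subgroup (E →L[ℝ] E)ˣ where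
  carrier := {h | ∀ X Y, (h : E →L[ℝ] E) (β X Y) = β ((h : E →L[ℝ] E) X) ((h : E →L[ℝ] E) Y)}
  one_mem' X Y := by simp
  mul_mem' {g h} hg hh X Y := by
    simp only [Set.mem_ofPred_eq] at hg hh
    simp [hg, hh]
  inv_mem' {h} hh X Y := by
    simp only [Set.mem_ofPred_eq] at hh
    have e : ∀ Z : E, (h : E →L[ℝ] E) (((h⁻¹ : (E →L[ℝ] E)ˣ) : E →L[ℝ] E) Z) = Z := fun Z => by
      change ((h : E →L[ℝ] E) * ((h⁻¹ : (E →L[ℝ] E)ˣ) : E →L[ℝ] E)) Z = Z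
      simp
    have e' : ∀ Z : E, ((h⁻¹ : (E →L[ℝ] E)ˣ) : E →L[ℝ] E) ((h : E →L[ℝ] E) Z) = Z := fun Z => by
      change (((h⁻¹ : (E →L[ℝ] E)ˣ) : E →L[ℝ] E) * (h : E →L[ℝ] E)) Z = Z
      simp
    conv_lhs => rw [← e X, ← e Y, ← hh, e']

/-- On basis vectors, compatibility with `β` is a system of equations of degree at most two in the
matrix entries, with coefficients the structure constants. -/
theorem isRealAlgebraic_bilinAut (β : E →L[ℝ] E →L[ℝ] E) : IsRealAlgebraic (bilinAut β) := by
  let n := Module.finrank ℝ E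
  let b : Module.Basis (Fin n) ℝ E := Module.finBasis ℝ E
  let c : Fin n → Fin n → Fin n → ℝ := fun i j k => b.repr (β (b i) (b j)) k
  let P : Fin n → Fin n → Fin n → MvPolynomial (Option (Fin n × Fin n)) ℝ := fun i j k =>
    ∑ l, MvPolynomial.C (c i j l) * MvPolynomial.X (some (k, l))
      - ∑ p, ∑ q, MvPolynomial.X (some (p, i)) * MvPolynomial.X (some (q, j))
        * MvPolynomial.C (c p q k)
  have hM : ∀ (g : (E →L[ℝ] E)ˣ) (i j : Fin n),
      matrixOf g i j = b.repr ((g : E →L[ℝ] E) (b j)) i := fun g i j =>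
    LinearMap.toMatrix_apply _ _ _ _ _
  have hβ : ∀ (u w : E) (k : Fin n), b.repr (β u w) k
      = ∑ p, ∑ q, b.repr u p * b.repr w q * c p q k := by
    intro u w k
    conv_lhs => rw [← b.sum_repr u, ← b.sum_repr w]
    simp only [map_sum, map_smul, sum_apply, smul_apply,
      Finsupp.finsetSum_apply, Finsupp.smul_apply, smul_eq_mul, Finset.smul_sum, c, mul_assoc]
    rw [Finset.sum_comm]
    refine Finset.sum_congr rfl fun p _ => Finset.sum_congr rfl fun q _ => ?_
    ring
  have hP : ∀ (g : (E →L[ℝ] E)ˣ) (i j k : Fin n), regularValue (P i j k) g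
      = b.repr ((g : E →L[ℝ] E) (β (b i) (b j))) k
        - b.repr (β ((g : E →L[ℝ] E) (b i)) ((g : E →L[ℝ] E) (b j))) k := by
    intro g i j k
    rw [repr_apply_eq_sum, hβ]
    simp only [regularValue, P, map_sub, map_sum, map_mul, MvPolynomial.eval_C, MvPolynomial.eval_X,
      Option.elim_some, c]
    congr 1
    · refine Finset.sum_congr rfl fun l _ => ?_
      rw [hM g k l]
    · refine Finset.sum_congr rfl fun p _ => Finset.sum_congr rfl fun q _ => ?_
      rw [hM g p i, hM g q j]
  refine ⟨Set.range fun t : Fin n × Fin n × Fin n => P t.1 t.2.1 t.2.2, fun g => ?_⟩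
  simp only [Set.forall_mem_range, Prod.forall, hP, sub_eq_zero]
  constructor
  · intro hg i j k
    rw [hg]
  · intro hg
    let B₁ : E →ₗ[ℝ] E →ₗ[ℝ] E := LinearMap.mk₂ ℝ (fun X Y => (g : E →L[ℝ] E) (β X Y))
      (by simp) (by simp) (by simp) (by simp)
    let B₂ : E →ₗ[ℝ] E →ₗ[ℝ] E :=
      LinearMap.mk₂ ℝ (fun X Y => β ((g : E →L[ℝ] E) X) ((g : E →L[ℝ] E) Y))
      (by simp) (by simp) (by simp) (by simp)
    have hB : B₁ = B₂ := by
      refine LinearMap.ext_basis b b fun i j => ?_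
      refine b.repr.injective (Finsupp.ext fun k => ?_)
      exact hg i j k
    exact fun X Y => congrArg (fun B : E →ₗ[ℝ] E →ₗ[ℝ] E => B X Y) hB

theorem algClosure_le {H B : Subgroup (E →L[ℝ] E)ˣ} (hB : IsRealAlgebraic B) (hH : H ≤ B) :
    algClosure H ≤ B :=
  sInf_le ⟨⟨B, hB, le_rfl, connectedComponentIn_subset _ _⟩, hH⟩

variable {G : Type*} [TopologicalSpace G] [ChartedSpace E G] [Group G] [LieGroup 𝓘(ℝ, E) ∞ G]
  [IsTopologicalGroup G] [T2Space G]

theorem conj_lieExp (g : G) (X : E) :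
    g * lieExp X * g⁻¹ = lieExp (((Ad E g : (E →L[ℝ] E)ˣ) : E →L[ℝ] E) X) := by
  have h : ContMDiff 𝓘(ℝ, E) 𝓘(ℝ, E) ∞ ((MulAut.conj g : G ≃* G) : G →* G) :=
    (contMDiff_mul_right (I := 𝓘(ℝ, E)) (n := ∞) (a := g⁻¹)).comp
      (contMDiff_mul_left (I := 𝓘(ℝ, E)) (n := ∞) (a := g))
  exact map_lieExp h X

/-- Differentiate `Ad (g exp (tX) g⁻¹) = Ad g * Ad (exp (tX)) * Ad g⁻¹` at `t = 0`. -/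
theorem Ad_mem_bilinAut (g : G) : Ad E g ∈ bilinAut (adCLM E G) := by
  intro X Y
  have h1 := hasDerivAt_Ad_comp
    (hasLogVelocityAt_lieExp (G := G) (((Ad E g : (E →L[ℝ] E)ˣ) : E →L[ℝ] E) X) 0) (by simp)
  have h2 := ((hasDerivAt_Ad_comp (hasLogVelocityAt_lieExp (G := G) X 0) (by simp)).const_mul
    ((Ad E g : (E →L[ℝ] E)ˣ) : E →L[ℝ] E)).mul_const ((Ad E g⁻¹ : (E →L[ℝ] E)ˣ) : E →L[ℝ] E)
  have h3 : (fun t : ℝ => ((Ad E (lieExp (t • ((Ad E g : (E →L[ℝ] E)ˣ) : E →L[ℝ] E) X) : G) :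
      (E →L[ℝ] E)ˣ) : E →L[ℝ] E)) = fun t : ℝ => ((Ad E g : (E →L[ℝ] E)ˣ) : E →L[ℝ] E)
        * ((Ad E (lieExp (t • X) : G) : (E →L[ℝ] E)ˣ) : E →L[ℝ] E)
        * ((Ad E g⁻¹ : (E →L[ℝ] E)ˣ) : E →L[ℝ] E) := by
    funext t
    rw [← Units.val_mul, ← Units.val_mul, ← map_mul, ← map_mul, conj_lieExp, map_smul]
  rw [h3] at h1
  have h4 := h1.unique h2
  rw [h4, map_inv]
  have e' : ((Ad E g)⁻¹ : (E →L[ℝ] E)ˣ).val (((Ad E g : (E →L[ℝ] E)ˣ) : E →L[ℝ] E) Y) = Y := by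
    change (((Ad E g)⁻¹ : (E →L[ℝ] E)ˣ).val * ((Ad E g : (E →L[ℝ] E)ˣ) : E →L[ℝ] E)) Y = Y
    simp
  simp [e']

theorem adHull_le_bilinAut : adHull E G ≤ bilinAut (adCLM E G) :=
  algClosure_le (isRealAlgebraic_bilinAut _) (by rintro _ ⟨g, rfl⟩; exact Ad_mem_bilinAut g)

/-! ### Lifting the action of the torus to the group -/

namespace KillingData

variable {Γ' : Subgroup G} (D : KillingData E Γ')

theorem S_le_bilinAut : D.S ≤ bilinAut (adCLM E G) :=
  D.S_le.trans (D.T_max.prop.2.trans adHull_le_bilinAut)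

/-- Each `s ∈ S` integrates to an endomorphism of `G`; the values on `exp` determine it, which
forces multiplicativity in `s` and provides the inverses. -/
theorem exists_isLift [SimplyConnectedSpace G] [LocallyPathConnectedSpace G] :
    ∃ φ, D.IsLift φ := by
  choose φ hφ using fun s : D.S => exists_monoidHom_lieExp (G := G) (D.S_le_bilinAut s.2)
  have hone : φ 1 = MonoidHom.id G := monoidHom_ext_lieExp (E := E) fun X => by
    rw [hφ]; simp
  have hmul : ∀ s t, φ (s * t) = (φ s).comp (φ t) := fun s t =>
    monoidHom_ext_lieExp (E := E) fun X => by
      rw [MonoidHom.comp_apply, hφ, hφ, hφ]; simp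
  refine ⟨MonoidHom.mk' (fun s => (φ s).toMulEquiv (φ s⁻¹) (by rw [← hmul, inv_mul_cancel, hone])
    (by rw [← hmul, mul_inv_cancel, hone])) fun s t => MulEquiv.ext fun g => ?_, fun s => ?_⟩
  · exact congrArg (fun f : G →* G => f g) (hmul s t)
  exact ⟨contMDiff_of_lieExp (hφ s), differential_of_lieExp (hφ s)⟩

theorem isLift_action [SimplyConnectedSpace G] [LocallyPathConnectedSpace G] :
    D.IsLift D.action := by
  have h := D.exists_isLift
  rw [action, dif_pos h]
  exact h.choose_spec

end KillingData

end Aut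

/-! ### Continuous homomorphisms are smooth -/

section ContinuousHom

variable {𝔸 : Type*} [NormedRing 𝔸] [NormedAlgebra ℝ 𝔸] [CompleteSpace 𝔸]

/-- Continuous one-parameter subgroups of a Banach algebra are exponentials. -/
theorem exists_eq_exp_of_continuous {f : ℝ → 𝔸} (hf : Continuous f) (h0 : f 0 = 1)
    (hadd : ∀ s t, f (s + t) = f s * f t) : ∃ A : 𝔸, ∀ t, f t = NormedSpace.exp (t • A) := by
  set F : ℝ → 𝔸 := fun t => ∫ s in (0 : ℝ)..t, f s with hF
  have hFd : ∀ t, HasDerivAt F (f t) t := fun t =>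
    intervalIntegral.integral_hasDerivAt_right (hf.intervalIntegrable _ _)
      (hf.stronglyMeasurableAtFilter _ _) hf.continuousAt
  -- The averages `F t / t` tend to `f 0 = 1` and units are open. Once some `F δ` is invertible, `F
  -- (t + δ) - F t = f t * F δ` expresses `f` through the differentiable `F`.
  obtain ⟨δ, u, hδ, hu⟩ : ∃ (δ : ℝ) (u : 𝔸ˣ), δ ≠ 0 ∧ (u : 𝔸) = δ⁻¹ • F δ := by
    have h1 : Tendsto (fun t : ℝ => t⁻¹ • F t) (𝓝[≠] 0) (𝓝 1) := by
      have := (hFd 0).tendsto_slope_zero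
      simpa [hF, h0] using this
    have h2 : ∀ᶠ t in 𝓝[≠] (0 : ℝ), IsUnit (t⁻¹ • F t) :=
      h1.eventually (Units.isOpen.mem_nhds isUnit_one)
    obtain ⟨δ, ⟨u, hu⟩, hδ⟩ := (h2.and self_mem_nhdsWithin).exists
    exact ⟨δ, u, hδ, hu⟩
  have h1 : ∀ t, f t = δ⁻¹ • (F (t + δ) - F t) * (u⁻¹ : 𝔸ˣ) := by
    intro t
    have h2 : F (t + δ) - F t = f t * F δ := by
      simp only [hF]
      rw [intervalIntegral.integral_interval_sub_left (hf.intervalIntegrable _ _)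
        (hf.intervalIntegrable _ _)]
      have h4 := (ContinuousLinearMap.mul ℝ 𝔸 (f t)).intervalIntegral_comp_comm
        (hf.intervalIntegrable (μ := MeasureTheory.volume) 0 δ)
      simp only [ContinuousLinearMap.mul_apply'] at h4
      rw [← h4]
      have h3 : ∀ s, f t * f s = f (t + s) := fun s => (hadd t s).symm
      simp only [h3]
      rw [intervalIntegral.integral_comp_add_left (fun s => f s), add_zero]
    rw [h2, ← mul_smul_comm, ← hu, mul_assoc, Units.mul_inv, mul_one]
  have h2 : HasDerivAt f (δ⁻¹ • (f (0 + δ) - f 0) * (u⁻¹ : 𝔸ˣ)) 0 := by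
    have h3 := ((((hFd (0 + δ)).comp_add_const 0 δ).sub (hFd 0)).const_smul δ⁻¹).mul_const
      ((u⁻¹ : 𝔸ˣ) : 𝔸)
    exact h3.congr_of_eventuallyEq (Eventually.of_forall fun t => h1 t)
  exact ⟨_, eq_exp_of_map_add h0 hadd h2⟩

variable {E : Type*} [NormedAddCommGroup E] [NormedSpace ℝ E] [FiniteDimensional ℝ E]
  {G : Type*} [TopologicalSpace G] [ChartedSpace E G] [Group G] [LieGroup 𝓘(ℝ, E) ∞ G]
  [IsTopologicalGroup G] [T2Space G]

/-- The coordinates of the second kind: products of exponentials along a family of rank one maps. -/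
def expProd {ι : Type*} (P : ι → E →L[ℝ] E) (l : List ι) (x : E) : G :=
  (l.map fun i => lieExp (P i x)).prod

theorem expProd_zero {ι : Type*} (P : ι → E →L[ℝ] E) (l : List ι) : (expProd P l 0 : G) = 1 := by
  refine List.prod_eq_one fun x hx => ?_
  obtain ⟨i, -, rfl⟩ := List.mem_map.1 hx
  simp

theorem contMDiffAt_expProd {ι : Type*} (P : ι → E →L[ℝ] E) (l : List ι) :
    ContMDiffAt 𝓘(ℝ, E) 𝓘(ℝ, E) ∞ (expProd P l : E → G) 0 := by
  induction l with
  | nil => exact contMDiffAt_const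
  | cons i l ih =>
    have h1 : ContMDiffAt 𝓘(ℝ, E) 𝓘(ℝ, E) ∞ (lieExp : E → G) (P i 0) := by
      rw [map_zero]; exact contMDiffAt_lieExp_zero
    have h2 := (h1.comp (0 : E) (P i).contMDiff.contMDiffAt).mul ih
    exact h2.congr_of_eventuallyEq (Eventually.of_forall fun x => by
      simp [expProd])

theorem hasLogDerivAt_expProd {ι : Type*} (P : ι → E →L[ℝ] E) (l : List ι) :
    HasLogDerivAt (expProd P l : E → G) (l.map P).sum 0 := by
  induction l with
  | nil =>
    refine ⟨continuousAt_const, ?_⟩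
    simpa [expProd] using hasFDerivAt_const (𝕜 := ℝ) (oneChart E G 1) (0 : E)
  | cons i l ih =>
    have h1 : HasLogDerivAt (lieExp : E → G) (ContinuousLinearMap.id ℝ E) (P i 0) := by
      rw [map_zero]
      exact ⟨continuous_lieExp.continuousAt,
        by simpa using hasFDerivAt_oneChart_lieExp_zero (E := E) (G := G)⟩
    have h2 := (h1.comp (P i).hasFDerivAt).mul ih
    rw [expProd_zero] at h2
    have h3 : (((Ad E (1 : G)⁻¹ : (E →L[ℝ] E)ˣ) : E →L[ℝ] E).comp
        ((ContinuousLinearMap.id ℝ E).comp (P i)) + (l.map P).sum) = ((i :: l).map P).sum := by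
      rw [inv_one, map_one, List.map_cons, List.sum_cons]
      rfl
    rw [h3] at h2
    exact h2.congr_of_eventuallyEq (Eventually.of_forall fun x => by simp [expProd])

/-- Continuous homomorphisms from a Lie group to a Banach algebra are smooth. -/
theorem contMDiff_of_continuous {ρ : G →* 𝔸} (hρ : Continuous ρ) :
    ContMDiff 𝓘(ℝ, E) 𝓘(ℝ, 𝔸) ∞ ρ := by
  let n := Module.finrank ℝ E
  let b : Module.Basis (Fin n) ℝ E := Module.finBasis ℝ E
  let P : Fin n → E →L[ℝ] E := fun i =>
    (LinearMap.toContinuousLinearMap (b.coord i)).smulRight (b i)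
  let l := List.finRange n
  -- Hence `expProd P l` has derivative the identity at `0` and is a local diffeomorphism there. In
  -- these coordinates `ρ` is a product of exponentials of linear functions.
  have hsum : (l.map P).sum = ContinuousLinearMap.id ℝ E := by
    rw [← Fin.sum_univ_def]
    ext x
    simp [P, sum_apply, b.sum_repr]
  have hd := (hasLogDerivAt_expProd (G := G) P l).hasFDerivAt
  simp only [expProd_zero, inv_one, one_mul, hsum] at hd
  obtain ⟨k, hk1, hk, hkr, -⟩ := exists_local_inverse (expProd_zero P l)
    (contMDiffAt_expProd (G := G) P l) hd
  choose A hA using fun i => exists_eq_exp_of_continuous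
    (f := fun t : ℝ => ρ (lieExp (t • b i)))
    (hρ.comp (continuous_lieExp.comp (by fun_prop))) (by simp)
    (fun s t => by rw [lieExp_add_smul, map_mul])
  have hprod : ∀ l : List (Fin n), ContDiff ℝ ∞ fun x : E => ρ (expProd P l x) := by
    intro l
    induction l with
    | nil => simpa [expProd] using contDiff_const
    | cons i l ih =>
      have h1 : ContDiff ℝ ∞ fun x : E => ρ (lieExp (P i x)) := by
        have h2 : (fun x : E => ρ (lieExp (P i x))) = fun x => NormedSpace.exp
            ((LinearMap.toContinuousLinearMap (b.coord i)) x • A i) := by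
          funext x
          rw [← hA]
          rfl
        rw [h2]
        exact contDiff_normedSpace_exp.comp
          ((LinearMap.toContinuousLinearMap (b.coord i)).contDiff.smul contDiff_const)
      have h2 := h1.mul ih
      simpa [expProd] using h2
  have h1 : ContMDiffAt 𝓘(ℝ, E) 𝓘(ℝ, 𝔸) ∞ ρ 1 := by
    refine ((hprod l).contMDiff.contMDiffAt.comp (1 : G) hk).congr_of_eventuallyEq ?_
    filter_upwards [hkr] with g hg
    simp only [Function.comp]
    rw [hg]
  intro g
  have h2 : ContMDiffAt 𝓘(ℝ, E) 𝓘(ℝ, E) ∞ (fun x : G => g⁻¹ * x) g :=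
    (contMDiff_mul_left (I := 𝓘(ℝ, E)) (n := ∞) (a := g⁻¹)) g
  have h3 : ContMDiffAt 𝓘(ℝ, E) 𝓘(ℝ, 𝔸) ∞ ρ (g⁻¹ * g) := by rwa [inv_mul_cancel]
  have h4 : ContMDiff 𝓘(ℝ, 𝔸) 𝓘(ℝ, 𝔸) ∞ (fun a : 𝔸 => ρ g * a) :=
    (contDiff_const.mul contDiff_id).contMDiff
  refine (h4.contMDiffAt.comp g (h3.comp g h2)).congr_of_eventuallyEq
    (Eventually.of_forall fun x => ?_)
  simp [Function.comp, ← map_mul]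

end ContinuousHom

/-! ### A closed graph theorem for σ-compact groups -/

section SigmaCompact

open scoped Pointwise

/-- A connected locally compact group is `σ`-compact. -/
theorem sigmaCompactSpace_of_preconnectedSpace (G : Type*) [TopologicalSpace G] [Group G]
    [IsTopologicalGroup G] [LocallyCompactSpace G] [PreconnectedSpace G] : SigmaCompactSpace G := by
  obtain ⟨K, hK, hK1⟩ := exists_compact_mem_nhds (1 : G)
  have hint : (1 : G) ∈ interior K := mem_interior_iff_mem_nhds.2 hK1
  -- The factor `K` makes the union open, the factor `K⁻¹` makes it closed.
  set C : ℕ → Set G := fun n => Nat.rec {1} (fun _ c => c * (K ∪ K⁻¹)) n with hC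
  have hCs : ∀ n, C (n + 1) = C n * (K ∪ K⁻¹) := fun n => rfl
  have hCc : ∀ n, IsCompact (C n) := by
    intro n
    induction n with
    | zero => exact isCompact_singleton
    | succ n ih => exact ih.mul (hK.union hK.inv)
  have hopen : IsOpen (⋃ n, C n) := by
    rw [isOpen_iff_mem_nhds]
    intro x hx
    obtain ⟨n, hn⟩ := Set.mem_iUnion.1 hx
    refine mem_of_superset (x := {x} * interior K) ?_ ?_
    · exact (isOpen_interior.mul_left).mem_nhds ⟨x, rfl, 1, hint, mul_one x⟩
    · refine subset_trans ?_ (Set.subset_iUnion C (n + 1))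
      rw [hCs]
      exact Set.mul_subset_mul (Set.singleton_subset_iff.2 hn)
        (interior_subset.trans Set.subset_union_left)
  have hclosed : IsClosed (⋃ n, C n) := by
    refine isClosed_of_closure_subset fun x hx => ?_
    have hnhds : {x} * interior K ∈ 𝓝 x :=
      (isOpen_interior.mul_left).mem_nhds ⟨x, rfl, 1, hint, mul_one x⟩
    obtain ⟨y, hy, hyC⟩ := mem_closure_iff_nhds.1 hx _ hnhds
    obtain ⟨_, rfl, k, hk, rfl⟩ := hy
    obtain ⟨n, hn⟩ := Set.mem_iUnion.1 hyC
    refine Set.mem_iUnion.2 ⟨n + 1, ?_⟩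
    rw [hCs]
    exact ⟨_, hn, k⁻¹, Or.inr (Set.inv_mem_inv.2 (interior_subset hk)), by group⟩
  have huniv := IsClopen.eq_univ ⟨hclosed, hopen⟩
    ⟨(1 : G), Set.mem_iUnion.2 ⟨0, rfl⟩⟩
  rw [← isSigmaCompact_univ_iff, ← huniv]
  exact isSigmaCompact_iUnion_of_isCompact _ hCc

instance sigmaCompactSpace_units {𝔸 : Type*} [NormedRing 𝔸] [ProperSpace 𝔸] :
    SigmaCompactSpace 𝔸ˣ := by
  have : SigmaCompactSpace 𝔸ᵐᵒᵖ :=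
    (MulOpposite.opHomeomorph (M := 𝔸)).symm.isClosedEmbedding.sigmaCompactSpace
  exact Units.isClosedEmbedding_embedProduct.sigmaCompactSpace

/-- A homomorphism of groups whose graph is `σ`-compact, defined on a locally compact group, is
continuous. -/
theorem continuous_of_isSigmaCompact_graph {G H : Type*} [TopologicalSpace G] [Group G]
    [IsTopologicalGroup G] [LocallyCompactSpace G] [T2Space G] [TopologicalSpace H] [Group H]
    [IsTopologicalGroup H] (f : G →* H) (hf : IsSigmaCompact {p : G × H | f p.1 = p.2}) :
    Continuous f := by
  let K : Subgroup (G × H) := f.graph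
  have hK : (K : Set (G × H)) = {p : G × H | f p.1 = p.2} := by
    ext p
    exact MonoidHom.mem_graph
  have : SigmaCompactSpace K := by
    rw [← isSigmaCompact_univ_iff, Subtype.isSigmaCompact_iff, Set.image_univ, Subtype.range_coe]
    exact hK ▸ hf
  let q : K →* G := (MonoidHom.fst G H).comp K.subtype
  have hqc : Continuous q := continuous_fst.comp continuous_subtype_val
  have hqb : Function.Bijective q := by
    refine ⟨fun x y hxy => ?_, fun g => ⟨⟨(g, f g), MonoidHom.mem_graph.2 rfl⟩, rfl⟩⟩
    have hx := MonoidHom.mem_graph.1 x.2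
    have hy := MonoidHom.mem_graph.1 y.2
    refine Subtype.ext (Prod.ext hxy ?_)
    rw [← hx, ← hy]
    exact congrArg f hxy
  -- Open mapping theorem: the projection of the graph to `G` is a continuous bijection from a
  -- σ-compact group, so it is a homeomorphism, and `f` is its inverse followed by the second
  -- coordinate.
  have hqo : IsOpenMap q := MonoidHom.isOpenMap_of_sigmaCompact q hqb.2 hqc
  let e : K ≃ₜ G := (Equiv.ofBijective q hqb).toHomeomorphOfContinuousOpen hqc hqo
  have h1 : (f : G → H) = fun g => (e.symm g).1.2 := by
    funext g
    have h2 := MonoidHom.mem_graph.1 (e.symm g).2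
    have h3 : (e.symm g).1.1 = g := e.apply_symm_apply g
    rw [← h2, h3]
  rw [h1]
  exact continuous_snd.comp (continuous_subtype_val.comp e.symm.continuous)

end SigmaCompact

/-! ### Closedness of algebraic groups, split tori and unipotence -/

section Closed

variable {V : Type*} [NormedAddCommGroup V] [NormedSpace ℝ V] [FiniteDimensional ℝ V]

theorem continuous_matrixOf : Continuous (matrixOf : (V →L[ℝ] V)ˣ → _) := by
  let L : (V →L[ℝ] V) →ₗ[ℝ]
      Matrix (Fin (Module.finrank ℝ V)) (Fin (Module.finrank ℝ V)) ℝ :=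
    (LinearMap.toMatrix (Module.finBasis ℝ V) (Module.finBasis ℝ V)).toLinearMap ∘ₗ
      ContinuousLinearMap.coeLM ℝ
  exact (LinearMap.continuous_of_finiteDimensional L).comp Units.continuous_val

theorem det_matrixOf_ne_zero (g : (V →L[ℝ] V)ˣ) : (matrixOf g).det ≠ 0 := by
  rw [matrixOf, LinearMap.det_toMatrix]
  have h := ((g.isUnit.map (ContinuousLinearMap.toLinearMapRingHom (R₁ := ℝ) (M₁ := V))).map
    (LinearMap.det (M := V) (A := ℝ)))
  exact h.ne_zero

theorem continuous_regularValue
    (p : MvPolynomial (Option (Fin (Module.finrank ℝ V) × Fin (Module.finrank ℝ V))) ℝ) :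
    Continuous (regularValue p : (V →L[ℝ] V)ˣ → ℝ) := by
  refine p.continuous_eval.comp (continuous_pi fun o => ?_)
  cases o with
  | none => exact (continuous_matrixOf.matrix_det).inv₀ det_matrixOf_ne_zero
  | some ij => exact continuous_matrixOf.matrix_elem ij.1 ij.2

theorem IsRealAlgebraic.isClosed {B : Subgroup (V →L[ℝ] V)ˣ} (hB : IsRealAlgebraic B) :
    IsClosed (B : Set (V →L[ℝ] V)ˣ) := by
  obtain ⟨P, hP⟩ := hB
  have : (B : Set (V →L[ℝ] V)ˣ) = ⋂ p ∈ P, {g | regularValue p g = 0} := by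
    ext g
    simpa using hP g
  rw [this]
  exact isClosed_biInter fun p _ => isClosed_eq (continuous_regularValue p) continuous_const

/-- The closure of `A` is connected, contains `1` and stays in the closed group `B`, so it lies in
`B⁰`, which is contained in `A`. -/
theorem IsSplitTorus.isClosed {A : Subgroup (V →L[ℝ] V)ˣ} (hA : IsSplitTorus A) :
    IsClosed (A : Set (V →L[ℝ] V)ˣ) := by
  obtain ⟨⟨B, hB, hAB, hBA⟩, hc, -, -⟩ := hA
  refine isClosed_of_closure_subset (subset_trans ?_ hBA)
  exact hc.isPreconnected.closure.subset_connectedComponentIn (subset_closure (one_mem A))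
    (hB.isClosed.closure_subset_iff.2 hAB)

/-- The nilpotency index is bounded by the dimension; a single equation makes unipotence a closed
condition. -/
theorem isUnipotentElt_iff (g : (V →L[ℝ] V)ˣ) :
    IsUnipotentElt g ↔ ((g : V →L[ℝ] V) - 1) ^ Module.finrank ℝ V = 0 := by
  refine ⟨fun ⟨m, hm⟩ => ?_, fun h => ⟨_, h⟩⟩
  let R := ContinuousLinearMap.toLinearMapRingHom (R₁ := ℝ) (M₁ := V)
  have hR : Function.Injective R := ContinuousLinearMap.coe_injective
  apply hR
  have h1 : R ((g : V →L[ℝ] V) - 1) ^ m = 0 := by rw [← map_pow, hm, map_zero]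
  rw [map_pow, map_zero]
  have h2 := Module.End.ker_pow_le_ker_pow_finrank (R ((g : V →L[ℝ] V) - 1)) m
  rw [h1, LinearMap.ker_zero, top_le_iff, LinearMap.ker_eq_top] at h2
  exact h2

end Closed

/-! ### Continuity of the projection to the torus -/

namespace KillingData

variable {E : Type*} [NormedAddCommGroup E] [NormedSpace ℝ E] [FiniteDimensional ℝ E]
  {G : Type*} [TopologicalSpace G] [ChartedSpace E G] [Group G] [LieGroup 𝓘(ℝ, E) ∞ G]
  [IsTopologicalGroup G] [T2Space G] {Γ' : Subgroup G} (D : KillingData E Γ')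

/-- Describes the graph of `π` by closed conditions only. Neither `U` nor the hull appears: the
unipotent factor lies in the hull automatically, being a quotient of elements of it. -/
theorem proj_eq_iff (g : G) (s : D.S) : D.proj g = s ↔ ∃ a ∈ D.A, ∃ r ∈ D.Sperp,
    IsUnipotentElt ((a * (s : (E →L[ℝ] E)ˣ) * r)⁻¹ * Ad E g) := by
  constructor
  · intro h
    obtain ⟨a, ha, u, hu, hx⟩ := D.exists_eq ⟨Ad E g, Ad_mem_adHull g⟩
    obtain ⟨r, hr, hr'⟩ := D.exists_eq_S (D.projTFun ⟨Ad E g, Ad_mem_adHull g⟩)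
    have hs : D.projSFun (D.projTFun ⟨Ad E g, Ad_mem_adHull g⟩) = s := h
    rw [hs] at hr'
    rw [hr'] at hx
    refine ⟨a, ha, r, hr, ?_⟩
    have e : (a * (s : (E →L[ℝ] E)ˣ) * r)⁻¹ * Ad E g = u := by
      simp only at hx
      rw [hx]; group
    rw [e]
    exact ((D.U_rad u).1 hu).2
  · rintro ⟨a, ha, r, hr, hu⟩
    set u := (a * (s : (E →L[ℝ] E)ˣ) * r)⁻¹ * Ad E g with hudef
    have hT : (s : (E →L[ℝ] E)ˣ) * r ∈ D.T := mul_mem (D.S_le s.2) (D.Sperp_le hr)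
    have huU : u ∈ D.U := by
      refine (D.U_rad u).2 ⟨mul_mem (inv_mem ?_) (Ad_mem_adHull g), hu⟩
      rw [mul_assoc]
      exact mul_mem (D.A_max.prop.2 ha) (D.T_max.prop.2 hT)
    have h1 : D.projTFun ⟨Ad E g, Ad_mem_adHull g⟩ = ⟨_, hT⟩ :=
      D.projTFun_eq ha hT huU (by simp only [hudef]; group)
    change D.projSFun (D.projTFun ⟨Ad E g, Ad_mem_adHull g⟩) = s
    rw [h1]
    exact D.projSFun_eq s.2 hr rfl

/-- The graph is the projection of the closed set `Q` of triples `(g, s)`, `a`, `r` in a σ-compact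
space, hence σ-compact. -/
theorem continuous_proj [LocallyCompactSpace G] [PreconnectedSpace G] : Continuous D.proj := by
  have : SigmaCompactSpace G := sigmaCompactSpace_of_preconnectedSpace G
  have : CompactSpace D.S := isCompact_iff_compactSpace.1 D.S_torus.1
  have : ProperSpace (E →L[ℝ] E) := FiniteDimensional.proper ℝ _
  refine continuous_of_isSigmaCompact_graph D.proj ?_
  let Q : Set ((G × D.S) × (E →L[ℝ] E)ˣ × (E →L[ℝ] E)ˣ) := {p | p.2.1 ∈ D.A ∧ p.2.2 ∈ D.Sperp ∧
    (((((p.2.1 * (p.1.2 : (E →L[ℝ] E)ˣ) * p.2.2)⁻¹ * Ad E p.1.1 : (E →L[ℝ] E)ˣ)) : E →L[ℝ] E)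
      - 1) ^ Module.finrank ℝ E = 0}
  have hQ : IsClosed Q := by
    refine (D.A_max.prop.1.isClosed.preimage (by fun_prop : Continuous
      fun p : (G × D.S) × (E →L[ℝ] E)ˣ × (E →L[ℝ] E)ˣ => p.2.1)).inter
      ((D.Sperp_max.prop.1.1.isClosed.preimage (by fun_prop : Continuous
      fun p : (G × D.S) × (E →L[ℝ] E)ˣ × (E →L[ℝ] E)ˣ => p.2.2)).inter
      (isClosed_eq ?_ continuous_const))
    have hAd := continuous_Ad (E := E) (G := G)
    refine ((Units.continuous_val.comp (Continuous.mul (Continuous.inv ?_) ?_)).sub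
      continuous_const).pow _
    · fun_prop
    · fun_prop
  have himg : {p : G × D.S | D.proj p.1 = p.2} = Prod.fst '' Q := by
    ext ⟨g, s⟩
    simp only [Set.mem_ofPred_eq, D.proj_eq_iff, isUnipotentElt_iff, Set.mem_image]
    constructor
    · rintro ⟨a, ha, r, hr, h⟩
      exact ⟨((g, s), a, r), ⟨ha, hr, h⟩, rfl⟩
    · rintro ⟨⟨p, a, r⟩, ⟨ha, hr, h⟩, rfl⟩
      exact ⟨a, ha, r, hr, h⟩
  rw [himg]
  exact (isSigmaCompact_univ.of_isClosed_subset hQ (Set.subset_univ _)).image continuous_fst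

/-- `σ` as a homomorphism to the algebra of endomorphisms. -/
def sigmaEnd : G →* (E →L[ℝ] E) :=
  (Units.coeHom (E →L[ℝ] E)).comp (D.S.subtype.comp D.sigma)

theorem sigmaEnd_apply (g : G) :
    D.sigmaEnd g = ((D.sigma g : (E →L[ℝ] E)ˣ) : E →L[ℝ] E) := rfl

theorem contMDiff_sigmaEnd [LocallyCompactSpace G] [PreconnectedSpace G] :
    ContMDiff 𝓘(ℝ, E) 𝓘(ℝ, E →L[ℝ] E) ∞ D.sigmaEnd := by
  refine contMDiff_of_continuous ?_
  exact Units.continuous_val.comp (continuous_subtype_val.comp D.continuous_proj.inv)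

end KillingData

/-! ### Smoothness of the action twisted by the projection -/

section ActionSmooth

variable {E : Type*} [NormedAddCommGroup E] [NormedSpace ℝ E] [FiniteDimensional ℝ E]
  {G : Type*} [TopologicalSpace G] [ChartedSpace E G] [Group G] [LieGroup 𝓘(ℝ, E) ∞ G]
  [IsTopologicalGroup G] [T2Space G]

theorem contMDiff_lieExp : ContMDiff 𝓘(ℝ, E) 𝓘(ℝ, E) ∞ (lieExp : E → G) := by
  intro X
  have h2 : Tendsto (fun n : ℕ => ((n : ℝ)⁻¹) • X) atTop (𝓝 0) := by
    have := (tendsto_inv_atTop_nhds_zero_nat (𝕜 := ℝ)).smul_const X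
    simpa using this
  have ho : IsOpen (lieExp ⁻¹' (oneChart E G).source : Set E) :=
    isOpen_oneChart_source.preimage continuous_lieExp
  obtain ⟨n, hn, hn0⟩ := ((h2.eventually (lieExp_preimage_mem_nhds (E := E) (G := G))).and
    (eventually_gt_atTop 0)).exists
  have h3 : ∀ Y : E, (lieExp Y : G) = lieExp ((n : ℝ)⁻¹ • Y) ^ n := fun Y => by
    rw [← lieExp_nsmul, smul_smul, mul_inv_cancel₀ (by positivity), one_smul]
  have h4 : ContMDiffAt 𝓘(ℝ, E) 𝓘(ℝ, E) ∞ (fun Y : E => (n : ℝ)⁻¹ • Y) X :=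
    (contDiff_const_smul ((n : ℝ)⁻¹)).contMDiff.contMDiffAt
  have h5 : ContMDiffAt 𝓘(ℝ, E) 𝓘(ℝ, E) ∞ (lieExp : E → G) ((n : ℝ)⁻¹ • X) :=
    contMDiffOn_lieExp.contMDiffAt (ho.mem_nhds hn)
  exact ((contMDiff_pow n).contMDiffAt.comp X (h5.comp X h4)).congr_of_eventuallyEq (Eventually.of_forall h3)

theorem hasDerivAt_comp_lieExp {F : Type*} [NormedAddCommGroup F] [NormedSpace ℝ F] {ρ : G → F}
    (hρ : ContMDiffAt 𝓘(ℝ, E) 𝓘(ℝ, F) ∞ ρ 1) (X : E) :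
    HasDerivAt (fun t : ℝ => ρ (lieExp (t • X))) ((differential ρ 1 : E →L[ℝ] F) X) 0 := by
  have h1 : HasFDerivAt (fun t : ℝ => oneChart E G (lieExp (t • X)))
      ((1 : ℝ →L[ℝ] ℝ).smulRight X) 0 := by
    simpa using (hasLogVelocityAt_lieExp (G := G) X 0).hasFDerivAt
  have h2 : HasFDerivAt (fun z => ρ ((oneChart E G).symm z)) (differential ρ 1 : E →L[ℝ] F)
      (oneChart E G (lieExp ((0 : ℝ) • X))) := by
    rw [zero_smul, lieExp_zero, differential_one_eq_fderiv' (hρ.mdifferentiableAt (by simp))]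
    exact (eventually_differentiableAt_comp_oneChart_symm hρ).self_of_nhds.hasFDerivAt
  have h3 := (HasFDerivAt.comp (0 : ℝ) h2 h1).hasDerivAt
  simp only [ContinuousLinearMap.comp_apply, ContinuousLinearMap.smulRight_apply,
    one_apply_eq_self, one_smul] at h3
  refine h3.congr_of_eventuallyEq ?_
  have ht : Tendsto (fun t : ℝ => (lieExp (t • X) : G)) (𝓝 0) (𝓝 1) := by
    have hc : Continuous fun t : ℝ => (lieExp (t • X) : G) :=
      continuous_lieExp.comp (by fun_prop)
    simpa using hc.tendsto 0
  filter_upwards [ht.eventually (eventually_oneChart_left_inv (E := E))] with t ht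
  simp only [Function.comp, ht]

theorem subgroup_eq_top_of_mem_nhds [PreconnectedSpace G] {H : Subgroup G}
    (hH : (H : Set G) ∈ 𝓝 1) : H = ⊤ := by
  have ho : IsOpen (H : Set G) := H.isOpen_of_mem_nhds hH
  have h1 := IsClopen.eq_univ ⟨H.isClosed_of_isOpen ho, ho⟩ ⟨1, H.one_mem⟩
  exact SetLike.coe_injective (by rw [h1]; rfl)

namespace KillingData

variable {Γ' : Subgroup G} (D : KillingData E Γ')

/-- `π` as a homomorphism to the algebra of endomorphisms. -/
def projEnd : G →* (E →L[ℝ] E) :=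
  (Units.coeHom (E →L[ℝ] E)).comp (D.S.subtype.comp D.proj)

theorem inv_action_sigma (b : G) : (D.action (D.sigma b))⁻¹ = D.action (D.proj b) := by
  have h : D.sigma b = (D.proj b)⁻¹ := rfl
  rw [h, map_inv, inv_inv]

variable [SimplyConnectedSpace G] [LocallyPathConnectedSpace G]

theorem action_lieExp (s : D.S) (X : E) :
    D.action s (lieExp X) = lieExp (((s : (E →L[ℝ] E)ˣ) : E →L[ℝ] E) X) := by
  have h := D.isLift_action s
  have h1 := map_lieExp (φ := (D.action s : G ≃* G).toMonoidHom) h.1 X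
  have h2 : (differential ((D.action s : G ≃* G).toMonoidHom : G → G) 1 : E →L[ℝ] E)
      = ((s : (E →L[ℝ] E)ˣ) : E →L[ℝ] E) := h.2
  rw [h2] at h1
  exact h1

variable [LocallyCompactSpace G]

theorem contMDiff_projEnd : ContMDiff 𝓘(ℝ, E) 𝓘(ℝ, E →L[ℝ] E) ∞ D.projEnd :=
  contMDiff_of_continuous
    (Units.continuous_val.comp (continuous_subtype_val.comp D.continuous_proj))

/-- The good `a` form a subgroup. It contains a neighbourhood of `1`, since on `exp X` the map is `b
↦ exp (π(b) X)`. -/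
theorem contMDiff_action_left (a : G) :
    ContMDiff 𝓘(ℝ, E) 𝓘(ℝ, E) ∞ fun b : G => D.action (D.proj b) a := by
  let H : Subgroup G :=
    { carrier := {a | ContMDiff 𝓘(ℝ, E) 𝓘(ℝ, E) ∞ fun b : G => D.action (D.proj b) a}
      one_mem' := by
        simp only [Set.mem_ofPred_eq, map_one]
        exact contMDiff_const
      mul_mem' := fun {x y} hx hy => by
        simp only [Set.mem_ofPred_eq, map_mul] at hx hy ⊢
        exact hx.mul hy
      inv_mem' := fun {x} hx => by
        simp only [Set.mem_ofPred_eq, map_inv] at hx ⊢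
        exact hx.inv }
  have hH : H = ⊤ := by
    refine subgroup_eq_top_of_mem_nhds ?_
    filter_upwards [eventually_lieExp_lieLog (E := E) (G := G)] with g hg
    change ContMDiff 𝓘(ℝ, E) 𝓘(ℝ, E) ∞ fun b : G => D.action (D.proj b) g
    rw [← hg]
    simp only [D.action_lieExp]
    exact contMDiff_lieExp.comp (D.contMDiff_projEnd.clm_apply contMDiff_const)
  have : a ∈ H := hH ▸ Subgroup.mem_top a
  exact this

/-- Near `(b₀, 1)` the map is `exp (π(b) log a)`; near `(b₀, a₀)` factor `π(b)(a) = π(b)(a₀) ·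
π(b)(a₀⁻¹ a)`. -/
theorem contMDiff_action : ContMDiff (𝓘(ℝ, E).prod 𝓘(ℝ, E)) 𝓘(ℝ, E) ∞
    fun p : G × G => D.action (D.proj p.1) p.2 := by
  have hone : ∀ b₀ : G, ContMDiffAt (𝓘(ℝ, E).prod 𝓘(ℝ, E)) 𝓘(ℝ, E) ∞
      (fun p : G × G => D.action (D.proj p.1) p.2) (b₀, 1) := by
    intro b₀
    have h1 : ContMDiffAt (𝓘(ℝ, E).prod 𝓘(ℝ, E)) 𝓘(ℝ, E →L[ℝ] E) ∞
        (fun p : G × G => D.projEnd p.1) (b₀, 1) :=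
      (D.contMDiff_projEnd.comp contMDiff_fst).contMDiffAt
    have h2 : ContMDiffAt (𝓘(ℝ, E).prod 𝓘(ℝ, E)) 𝓘(ℝ, E) ∞
        (fun p : G × G => (lieLog p.2 : E)) (b₀, 1) :=
      ContMDiffAt.comp (g := (lieLog : G → E)) (f := Prod.snd) (b₀, (1 : G)) (I' := 𝓘(ℝ, E))
        contMDiffAt_lieLog contMDiffAt_snd
    refine (contMDiff_lieExp.contMDiffAt.comp (b₀, (1 : G))
      (h1.clm_apply h2)).congr_of_eventuallyEq ?_
    have ht : Tendsto (Prod.snd : G × G → G) (𝓝 (b₀, 1)) (𝓝 1) := continuous_snd.tendsto _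
    filter_upwards [ht.eventually (eventually_lieExp_lieLog (E := E) (G := G))] with p hp
    simp only [Function.comp]
    conv_lhs => rw [← hp]
    rw [D.action_lieExp]
    rfl
  rintro ⟨b₀, a₀⟩
  have h1 : ContMDiffAt (𝓘(ℝ, E).prod 𝓘(ℝ, E)) 𝓘(ℝ, E) ∞
      (fun p : G × G => D.action (D.proj p.1) a₀) (b₀, a₀) :=
    ((D.contMDiff_action_left a₀).comp contMDiff_fst).contMDiffAt
  have h2 : ContMDiffAt (𝓘(ℝ, E).prod 𝓘(ℝ, E)) (𝓘(ℝ, E).prod 𝓘(ℝ, E)) ∞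
      (fun p : G × G => (p.1, a₀⁻¹ * p.2)) (b₀, a₀) :=
    (contMDiff_fst.prodMk ((contMDiff_mul_left (I := 𝓘(ℝ, E)) (n := ∞) (a := a₀⁻¹)).comp
      contMDiff_snd)).contMDiffAt
  have h3 := hone b₀
  have e : ((b₀, a₀).1, a₀⁻¹ * (b₀, a₀).2) = (b₀, (1 : G)) := by simp
  rw [← e] at h3
  refine (h1.mul (ContMDiffAt.comp (b₀, a₀) h3 h2)).congr_of_eventuallyEq
    (Eventually.of_forall fun p => ?_)
  simp only [Function.comp, Pi.mul_apply, ← map_mul, mul_inv_cancel_left]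

end KillingData

end ActionSmooth

/-! ### The Lie group `G̃` -/

namespace KillingData

variable {E : Type*} [NormedAddCommGroup E] [NormedSpace ℝ E] [FiniteDimensional ℝ E]
  {G : Type*} [TopologicalSpace G] [ChartedSpace E G] [Group G] [LieGroup 𝓘(ℝ, E) ∞ G]
  [IsTopologicalGroup G] [T2Space G] {Γ' : Subgroup G} (D : KillingData E Γ')

theorem toG_homeoG_symm (g : G) : D.toG (D.homeoG.symm g) = g := D.homeoG.apply_symm_apply g

theorem homeoG_symm_toG (x : D.Gt) : D.homeoG.symm (D.toG x) = x := D.homeoG.symm_apply_apply x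

theorem toG_one : D.toG 1 = 1 := by
  change D.coordG 1 = 1
  simp [coordG]

theorem toG_mul (x y : D.Gt) :
    D.toG (x * y) = D.action (D.proj (D.toG y)) (D.toG x) * D.toG y := by
  obtain ⟨_, a, rfl⟩ := x
  obtain ⟨_, b, rfl⟩ := y
  change D.coordG (D.Delta a * D.Delta b)
    = D.action (D.proj (D.coordG (D.Delta b))) (D.coordG (D.Delta a)) * D.coordG (D.Delta b)
  rw [Delta_mul_Delta, coordG_Delta, coordG_Delta, coordG_Delta, inv_action_sigma]

theorem toG_inv (x : D.Gt) :
    D.toG x⁻¹ = D.action (D.proj (D.toG x)⁻¹) (D.toG x)⁻¹ := by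
  have h := D.toG_mul x⁻¹ x
  rw [inv_mul_cancel, toG_one, eq_comm, mul_eq_one_iff_eq_inv] at h
  have h2 := congrArg (D.action (D.proj (D.toG x))⁻¹) h
  rw [map_inv, MulAut.inv_apply_self] at h2
  rw [h2, map_inv D.proj, map_inv D.action]

theorem toEnd_eq (x : D.Gt) : D.toEnd x = D.sigmaEnd (D.toG x) := by
  obtain ⟨_, a, rfl⟩ := x
  change (((D.Delta a).right : (E →L[ℝ] E)ˣ) : E →L[ℝ] E) = D.sigmaEnd (D.coordG (D.Delta a))
  rw [coordG_Delta, sigmaEnd_apply]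
  simp [Delta, pair]

theorem chartAt_Gt (x : D.Gt) :
    chartAt E x = D.homeoG.toOpenPartialHomeomorph.trans (chartAt E (D.toG x)) := rfl

/-- The homeomorphism with `G` cancels in each transition map, leaving a transition map of `G`. -/
instance isManifold_Gt : IsManifold 𝓘(ℝ, E) ∞ D.Gt where
  compatible := by
    rintro _ _ ⟨c, hc, rfl⟩ ⟨c', hc', rfl⟩
    have h := HasGroupoid.compatible (G := contDiffGroupoid ∞ 𝓘(ℝ, E)) hc hc'
    refine StructureGroupoid.mem_of_eqOnSource _ h ?_
    rw [OpenPartialHomeomorph.trans_symm_eq_symm_trans_symm, OpenPartialHomeomorph.trans_assoc,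
      ← OpenPartialHomeomorph.trans_assoc D.homeoG.toOpenPartialHomeomorph.symm]
    have h2 : D.homeoG.toOpenPartialHomeomorph.symm.trans D.homeoG.toOpenPartialHomeomorph
        = OpenPartialHomeomorph.refl G := by
      rw [← Homeomorph.symm_toOpenPartialHomeomorph, ← Homeomorph.trans_toOpenPartialHomeomorph,
        Homeomorph.symm_trans_self, Homeomorph.refl_toOpenPartialHomeomorph]
    rw [h2, OpenPartialHomeomorph.refl_trans]

theorem extChartAt_Gt_apply (x y : D.Gt) :
    extChartAt 𝓘(ℝ, E) x y = extChartAt 𝓘(ℝ, E) (D.toG x) (D.toG y) := rfl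

theorem extChartAt_Gt_symm_apply (x : D.Gt) (z : E) :
    (extChartAt 𝓘(ℝ, E) x).symm z = D.homeoG.symm ((extChartAt 𝓘(ℝ, E) (D.toG x)).symm z) := rfl

theorem writtenInExtChartAt_toG (x : D.Gt) :
    writtenInExtChartAt 𝓘(ℝ, E) 𝓘(ℝ, E) x D.toG =ᶠ[𝓝 (extChartAt 𝓘(ℝ, E) x x)] id := by
  filter_upwards [extChartAt_target_mem_nhds (I := 𝓘(ℝ, E)) (D.toG x)] with z hz
  simp only [writtenInExtChartAt, Function.comp, extChartAt_Gt_symm_apply, toG_homeoG_symm, id]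
  exact (extChartAt 𝓘(ℝ, E) (D.toG x)).right_inv hz

theorem contMDiff_toG : ContMDiff 𝓘(ℝ, E) 𝓘(ℝ, E) ∞ D.toG := by
  intro x
  refine contMDiffAt_iff.2 ⟨D.homeoG.continuous.continuousAt, ?_⟩
  exact (contDiffAt_id.congr_of_eventuallyEq (D.writtenInExtChartAt_toG x)).contDiffWithinAt

theorem contMDiff_homeoG_symm : ContMDiff 𝓘(ℝ, E) 𝓘(ℝ, E) ∞ D.homeoG.symm := by
  intro g
  refine contMDiffAt_iff.2 ⟨D.homeoG.symm.continuous.continuousAt, ?_⟩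
  refine (contDiffAt_id.congr_of_eventuallyEq ?_).contDiffWithinAt
  filter_upwards [extChartAt_target_mem_nhds (I := 𝓘(ℝ, E)) g] with z hz
  simp only [Function.comp, extChartAt_Gt_apply, toG_homeoG_symm, id]
  exact (extChartAt 𝓘(ℝ, E) g).right_inv hz

theorem differential_toG (x : D.Gt) :
    (differential D.toG x : E →L[ℝ] E) = ContinuousLinearMap.id ℝ E := by
  refine ((D.contMDiff_toG.mdifferentiable (by simp) x).mfderiv :
    differential D.toG x = _).trans ?_
  simp only [modelWithCornersSelf_coe, Set.range_id, fderivWithin_univ]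
  exact (D.writtenInExtChartAt_toG x).fderiv_eq.trans fderiv_id

theorem oneChart_Gt_apply (x : D.Gt) : oneChart E D.Gt x = oneChart E G (D.toG x) := by
  rw [oneChart, extChartAt_Gt_apply, toG_one]
  rfl

theorem oneChart_Gt_symm_apply (z : E) :
    (oneChart E D.Gt).symm z = D.homeoG.symm ((oneChart E G).symm z) := by
  rw [oneChart, extChartAt_Gt_symm_apply, toG_one]
  rfl

theorem oneCoord_Gt : oneCoord E D.Gt = oneCoord E G := by
  rw [oneCoord, oneChart_Gt_apply, toG_one]
  rfl

theorem chartMul_Gt (p : E × E) : chartMul E D.Gt p = oneChart E G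
    (D.action (D.proj ((oneChart E G).symm p.2)) ((oneChart E G).symm p.1)
      * (oneChart E G).symm p.2) := by
  rw [chartMul, oneChart_Gt_apply, toG_mul, oneChart_Gt_symm_apply, oneChart_Gt_symm_apply,
    toG_homeoG_symm, toG_homeoG_symm]

theorem projStar_eq : D.projStar = (differential D.projEnd 1 : E →L[ℝ] (E →L[ℝ] E)) := rfl

theorem sigmaStar_eq : D.sigmaStar = (differential D.sigmaEnd 1 : E →L[ℝ] (E →L[ℝ] E)) := rfl

variable [SimplyConnectedSpace G] [LocallyPathConnectedSpace G]
  [LocallyCompactSpace G]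

theorem contMDiff_toEnd : ContMDiff 𝓘(ℝ, E) 𝓘(ℝ, E →L[ℝ] E) ∞ D.toEnd := by
  have h : D.toEnd = D.sigmaEnd ∘ D.toG := funext D.toEnd_eq
  rw [h]
  exact D.contMDiff_sigmaEnd.comp D.contMDiff_toG

theorem isEmbedding_toEnd_toG : IsEmbedding fun x : D.Gt => (D.toEnd x, D.toG x) := by
  refine IsEmbedding.of_comp
    (D.contMDiff_toEnd.continuous.prodMk D.homeoG.continuous) continuous_snd ?_
  exact D.homeoG.isEmbedding

theorem contMDiff_mul_Gt : ContMDiff (𝓘(ℝ, E).prod 𝓘(ℝ, E)) 𝓘(ℝ, E) ∞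
    fun p : D.Gt × D.Gt => p.1 * p.2 := by
  have h1 : ContMDiff (𝓘(ℝ, E).prod 𝓘(ℝ, E)) 𝓘(ℝ, E) ∞ fun p : D.Gt × D.Gt => D.toG p.1 :=
    D.contMDiff_toG.comp contMDiff_fst
  have h2 : ContMDiff (𝓘(ℝ, E).prod 𝓘(ℝ, E)) 𝓘(ℝ, E) ∞ fun p : D.Gt × D.Gt => D.toG p.2 :=
    D.contMDiff_toG.comp contMDiff_snd
  have h3 : ContMDiff (𝓘(ℝ, E).prod 𝓘(ℝ, E)) 𝓘(ℝ, E) ∞ fun p : D.Gt × D.Gt =>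
      D.action (D.proj (D.toG p.2)) (D.toG p.1) :=
    ContMDiff.comp (g := fun p : G × G => D.action (D.proj p.1) p.2)
      (f := fun p : D.Gt × D.Gt => (D.toG p.2, D.toG p.1)) D.contMDiff_action (h2.prodMk h1)
  have h4 : (fun p : D.Gt × D.Gt => p.1 * p.2) = fun p : D.Gt × D.Gt =>
      D.homeoG.symm (D.action (D.proj (D.toG p.2)) (D.toG p.1) * D.toG p.2) := by
    funext p
    rw [← toG_mul, homeoG_symm_toG]
  rw [h4]
  exact D.contMDiff_homeoG_symm.comp (h3.mul h2)

theorem contMDiff_inv_Gt : ContMDiff 𝓘(ℝ, E) 𝓘(ℝ, E) ∞ fun x : D.Gt => x⁻¹ := by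
  have h0 : ContMDiff 𝓘(ℝ, E) 𝓘(ℝ, E) ∞ fun x : D.Gt => (D.toG x)⁻¹ := D.contMDiff_toG.inv
  have h1 : ContMDiff 𝓘(ℝ, E) 𝓘(ℝ, E) ∞ fun x : D.Gt =>
      D.action (D.proj (D.toG x)⁻¹) (D.toG x)⁻¹ :=
    ContMDiff.comp (g := fun p : G × G => D.action (D.proj p.1) p.2)
      (f := fun x : D.Gt => ((D.toG x)⁻¹, (D.toG x)⁻¹)) D.contMDiff_action (h0.prodMk h0)
  have h4 : (fun x : D.Gt => x⁻¹) = fun x : D.Gt =>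
      D.homeoG.symm (D.action (D.proj (D.toG x)⁻¹) (D.toG x)⁻¹) := by
    funext p
    rw [← toG_inv, homeoG_symm_toG]
  rw [h4]
  exact D.contMDiff_homeoG_symm.comp h1

theorem lieGroup_Gt : LieGroup 𝓘(ℝ, E) ∞ D.Gt where
  contMDiff_mul := D.contMDiff_mul_Gt
  contMDiff_inv := D.contMDiff_inv_Gt

/-! ### The Lie algebra of `G̃` and its bracket -/

theorem sigmaEnd_lieExp (X : E) (t : ℝ) :
    D.sigmaEnd (lieExp (t • X)) = NormedSpace.exp (t • D.sigmaStar X) := by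
  refine eq_exp_of_map_add (f := fun t : ℝ => D.sigmaEnd (lieExp (t • X))) (by simp)
    (fun s t => by rw [lieExp_add_smul, map_mul]) ?_ t
  rw [sigmaStar_eq]
  exact hasDerivAt_comp_lieExp D.contMDiff_sigmaEnd.contMDiffAt X

theorem sigmaStar_mem_linearLieAlgebra (X : E) : D.sigmaStar X ∈ linearLieAlgebra D.S :=
  fun t => ⟨D.sigma (lieExp (t • X)), (D.sigma _).2, D.sigmaEnd_lieExp X t⟩

theorem sigmaEnd_inv (g : G) : D.sigmaEnd g⁻¹ = D.projEnd g := by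
  rw [sigmaEnd_apply, map_inv]
  change (((((D.proj g)⁻¹)⁻¹ : D.S) : (E →L[ℝ] E)ˣ) : E →L[ℝ] E) = _
  rw [inv_inv]
  rfl

/-- Compare derivatives along `exp (tX)` in `σ(g⁻¹) = π(g)`. -/
theorem sigmaStar_eq_neg_projStar (X : E) : D.sigmaStar X = -D.projStar X := by
  have h1 := hasDerivAt_comp_lieExp (D.contMDiff_projEnd.contMDiffAt (x := 1)) X
  have h2 := hasDerivAt_comp_lieExp (D.contMDiff_sigmaEnd.contMDiffAt (x := 1)) (-X)
  simp only [smul_neg, lieExp_neg, sigmaEnd_inv] at h2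
  have h3 := h1.unique h2
  rw [map_neg] at h3
  rw [projStar_eq, sigmaStar_eq, h3, neg_neg]

theorem differential_toEnd_one :
    (differential D.toEnd 1 : E →L[ℝ] (E →L[ℝ] E)) = D.sigmaStar := by
  have h : D.toEnd = D.sigmaEnd ∘ D.toG := funext D.toEnd_eq
  rw [h, differential_comp (E := E) (E' := E) (D.contMDiff_sigmaEnd.mdifferentiable (by simp) _)
    (D.contMDiff_toG.mdifferentiable (by simp) 1), differential_toG, toG_one, sigmaStar_eq]
  exact ContinuousLinearMap.comp_id _

theorem inclStar_eq (v : GroupLieAlgebra 𝓘(ℝ, E) D.Gt) : D.inclStar v = (D.sigmaStar v, v) := by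
  rw [inclStar, differential_toEnd_one, differential_toG]
  rfl

/-- The derivative of the multiplication of `G̃` in the first variable, along the identity. -/
theorem fderiv_chartMul_Gt {z : E} (hz : z ∈ (oneChart E G).target) (X : E) :
    fderiv ℝ (chartMul E D.Gt) (oneCoord E G, z) (X, 0)
      = fderiv ℝ (chartMul E G) (oneCoord E G, z) (D.projEnd ((oneChart E G).symm z) X, 0) := by
  have := D.lieGroup_Gt
  set s : D.S := D.proj ((oneChart E G).symm z)
  set φ : G →* G := (D.action s : G ≃* G).toMonoidHom
  have hφ : ContMDiff 𝓘(ℝ, E) 𝓘(ℝ, E) ∞ φ := (D.isLift_action s).1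
  have hφd : (differential φ 1 : E →L[ℝ] E) = D.projEnd ((oneChart E G).symm z) :=
    (D.isLift_action s).2
  have h1 := hasFDerivAt_oneChart_monoidHom hφ
  rw [hφd] at h1
  have e : oneChart E G (φ ((oneChart E G).symm (oneCoord E G))) = oneCoord E G := by
    rw [oneChart_symm_oneCoord, map_one]; rfl
  have h2 := hasFDerivAt_chartMul_left (G := G) hz
  rw [← e] at h2
  have h3 := HasFDerivAt.comp (oneCoord E G) h2 h1
  rw [e] at h3
  have hz' : z ∈ (oneChart E D.Gt).target := by
    have : (oneChart E D.Gt).target = (oneChart E G).target := by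
      rw [oneChart, oneChart, ← D.toG_one]
      simp only [extChartAt, chartAt_Gt]
      simp
    rwa [this]
  have h4 := hasFDerivAt_chartMul_left (G := D.Gt) hz'
  rw [oneCoord_Gt] at h4
  have h5 := h4.unique (h3.congr_of_eventuallyEq ?_)
  · have h6 := congrArg (fun T : E →L[ℝ] E => T X) h5
    simpa using h6
  · have ht : Tendsto (fun x => φ ((oneChart E G).symm x)) (𝓝 (oneCoord E G)) (𝓝 1) := by
      have := (hφ.continuous.tendsto 1).comp (tendsto_oneChart_symm (E := E) (G := G))
      rwa [map_one] at this
    filter_upwards [ht.eventually (eventually_oneChart_left_inv (E := E))] with x hx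
    rw [chartMul_Gt]
    simp only [Function.comp, chartMul, hx]
    rfl

/-- Differentiate `fderiv_chartMul_Gt` at `z = e`, the identity coordinate, along `Y`. The point
moves as in `G`; the vector `π(z) X` moves too and contributes `π_*(Y) X`. -/
theorem mulHessian_Gt (X Y : E) : mulHessian E D.Gt (0, Y) (X, 0)
    = mulHessian E G (0, Y) (X, 0) + D.projStar Y X := by
  have := D.lieGroup_Gt
  have hr : HasFDerivAt (fun z : E => (oneCoord E G, z)) (ContinuousLinearMap.inr ℝ E E)
      (oneCoord E G) := hasFDerivAt_prodMk_right _ _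
  have h1 := hasFDerivAt_fderiv_chartMul (E := E) (G := D.Gt)
  rw [oneCoord_Gt] at h1
  have h2 := (HasFDerivAt.comp (f := fun z : E => (oneCoord E G, z)) (oneCoord E G) h1 hr).clm_apply
    (hasFDerivAt_const ((X, 0) : E × E) (oneCoord E G))
  have h3 : HasFDerivAt (fun z => D.projEnd ((oneChart E G).symm z)) D.projStar (oneCoord E G) := by
    have hc := D.contMDiff_projEnd.contMDiffAt (x := (1 : G))
    rw [projStar_eq, differential_one_eq_fderiv' (hc.mdifferentiableAt (by simp))]
    exact (eventually_differentiableAt_comp_oneChart_symm hc).self_of_nhds.hasFDerivAt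
  have h4 := h3.clm_apply (hasFDerivAt_const X (oneCoord E G))
  have h5 := (HasFDerivAt.comp (f := fun z : E => (oneCoord E G, z)) (oneCoord E G)
    (hasFDerivAt_fderiv_chartMul (E := E) (G := G)) hr).clm_apply
    (h4.prodMk (hasFDerivAt_const (0 : E) (oneCoord E G)))
  have h6 := h2.unique (h5.congr_of_eventuallyEq ?_)
  · have h7 := congrArg (fun T : E →L[ℝ] E => T Y) h6
    simpa [oneChart_symm_oneCoord, hasFDerivAt_chartMul.fderiv, add_comm] using h7
  · filter_upwards [oneChart_target_mem_nhds (E := E) (G := G)] with z hz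
    exact D.fderiv_chartMul_Gt hz X

theorem sigmaStar_congr {X Y : E} (h : ∀ t : ℝ, D.sigma (lieExp (t • X)) = D.sigma (lieExp (t • Y))) :
    D.sigmaStar X = D.sigmaStar Y := by
  have h1 := hasDerivAt_comp_lieExp (D.contMDiff_sigmaEnd.contMDiffAt (x := 1)) X
  have h2 := hasDerivAt_comp_lieExp (D.contMDiff_sigmaEnd.contMDiffAt (x := 1)) Y
  simp only [sigmaEnd_apply, h] at h1
  exact h1.unique h2

/-- If `σ_*` is invariant under a one-parameter group, it kills the image of the generator. -/
theorem sigmaStar_apply_eq_zero {A : E →L[ℝ] E} {Y : E}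
    (h : ∀ t : ℝ, D.sigmaStar (NormedSpace.exp (t • A) Y) = D.sigmaStar Y) :
    D.sigmaStar (A Y) = 0 := by
  have h1 := hasDerivAt_exp_smul_const (𝕂 := ℝ) A (0 : ℝ)
  have h2 := D.sigmaStar.hasFDerivAt.comp_hasDerivAt (0 : ℝ)
    (h1.clm_apply (hasDerivAt_const (0 : ℝ) Y))
  simp only [Function.comp_def, h] at h2
  have h3 := h2.unique (hasDerivAt_const (0 : ℝ) (D.sigmaStar Y))
  simpa using h3

theorem sigma_conj (g x : G) : D.sigma (g * x * g⁻¹) = D.sigma x := by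
  rw [map_mul, map_mul, map_inv, mul_inv_eq_iff_eq_mul]
  exact Subtype.ext (D.T_comm (D.S_le (D.sigma g).2) (D.S_le (D.sigma x).2))

/-- Since `S` is abelian, `σ` is conjugation invariant, so `σ_*` is unchanged by `Ad (exp (tX)) =
exp (t ad X)`. -/
theorem sigmaStar_adCLM (X Y : E) : D.sigmaStar (adCLM E G X Y) = 0 := by
  refine D.sigmaStar_apply_eq_zero fun t => D.sigmaStar_congr fun s => ?_
  rw [← map_smul, ← Ad_lieExp_smul, ← conj_lieExp, sigma_conj]

/-- Same argument with the action of `σ(exp (tX)) = exp (t σ_*(X))`, under which `σ` is invariant by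
`sigma_action`. -/
theorem sigmaStar_sigmaStar (X Y : E) : D.sigmaStar (D.sigmaStar X Y) = 0 := by
  refine D.sigmaStar_apply_eq_zero fun t => D.sigmaStar_congr fun s => ?_
  rw [← map_smul, ← sigmaEnd_lieExp, sigmaEnd_apply, ← action_lieExp, sigma_action]

/-- The bracket of `G̃` on the underlying vector space of the Lie algebra of `G`. -/
def bracketTwist (X Y : E) : E := adCLM E G X Y + D.sigmaStar X Y - D.sigmaStar Y X

theorem mulHessian_Gt_sub (X Y : E) : mulHessian E D.Gt (X, 0) (0, Y)
    - mulHessian E D.Gt (Y, 0) (0, X) = D.bracketTwist X Y := by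
  have := D.lieGroup_Gt
  rw [mulHessian_symm, mulHessian_symm (Y, (0 : E)), mulHessian_Gt, mulHessian_Gt, bracketTwist,
    adCLM_apply_eq_mulHessian, sigmaStar_eq_neg_projStar, sigmaStar_eq_neg_projStar,
    mulHessian_symm (0, Y), mulHessian_symm (0, X)]
  simp only [neg_apply]
  abel

theorem sigmaStar_bracketTwist (X Y : E) : D.sigmaStar (D.bracketTwist X Y) = 0 := by
  rw [bracketTwist, map_sub, map_add, sigmaStar_adCLM, sigmaStar_sigmaStar, sigmaStar_sigmaStar]
  simp

theorem inclStar_bracket (X Y : GroupLieAlgebra 𝓘(ℝ, E) G) (v w : GroupLieAlgebra 𝓘(ℝ, E) D.Gt)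
    (hv : D.inclStar v = (D.sigmaStar X, X)) (hw : D.inclStar w = (D.sigmaStar Y, Y)) :
    D.inclStar ⁅v, w⁆
      = (0, ⁅X, Y⁆ + adAct (D.sigmaStar X) Y - adAct (D.sigmaStar Y) X) := by
  have := D.lieGroup_Gt
  rw [inclStar_eq] at hv hw ⊢
  have hv' : (v : E) = X := congrArg Prod.snd hv
  have hw' : (w : E) = Y := congrArg Prod.snd hw
  have key : ⁅v, w⁆ = bracketTwist D X Y := by
    refine (bracket_eq_mulHessian v w).trans ?_
    rw [hv', hw']
    exact D.mulHessian_Gt_sub X Y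
  rw [key]
  refine Prod.ext (D.sigmaStar_bracketTwist X Y) ?_
  rw [← adCLM_apply]
  rfl

end KillingData

end Nilshadow

end

/-! ### The theorem -/

theorem mainTheorem2 {E : Type*} [NormedAddCommGroup E] [NormedSpace ℝ E] [FiniteDimensional ℝ E]
    {G : Type*} [TopologicalSpace G] [ChartedSpace E G] [Group G] [LieGroup 𝓘(ℝ, E) ∞ G]
    [SimplyConnectedSpace G] [Group.IsSolvable G]
    (Γ : Subgroup G) [DiscreteTopology Γ] [CompactSpace (G ⧸ Γ)]
    (Γ' : Subgroup G) (hΓ' : Γ' ≤ Γ) (hindex : Γ'.relIndex Γ ≠ 0)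
    (hconn : IsConnected (Nilshadow.adHullOf E Γ' : Set (E →L[ℝ] E)ˣ))
    (D : Nilshadow.KillingData E Γ') :
    -- the torus `S` acts on `G`, lifting its action on `𝔤`
    D.IsLift D.action ∧
    -- `G̃ = Δ(G)` is a Lie group, embedded in `S ⋉ G`
    LieGroup 𝓘(ℝ, E) ∞ D.Gt ∧
    ContMDiff 𝓘(ℝ, E) 𝓘(ℝ, E →L[ℝ] E) ∞ D.toEnd ∧
    ContMDiff 𝓘(ℝ, E) 𝓘(ℝ, E) ∞ D.toG ∧
    Topology.IsEmbedding (fun x : D.Gt => (D.toEnd x, D.toG x)) ∧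
    -- `σ` is smooth and `σ_*` takes its values in the Lie algebra `𝔰` of `S`
    ContMDiff 𝓘(ℝ, E) 𝓘(ℝ, E →L[ℝ] E) ∞
      (fun g : G => ((D.sigma g : (E →L[ℝ] E)ˣ) : E →L[ℝ] E)) ∧
    (∀ X : GroupLieAlgebra 𝓘(ℝ, E) G, D.sigmaStar X ∈ Nilshadow.linearLieAlgebra D.S) ∧
    -- the Lie algebra of `G̃` is `{(σ_*(X), X) : X ∈ 𝔤}`
    Function.Injective D.inclStar ∧
    Set.range D.inclStar = {p | ∃ X : GroupLieAlgebra 𝓘(ℝ, E) G, p = (D.sigmaStar X, X)} ∧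
    -- its bracket
    (∀ (X Y : GroupLieAlgebra 𝓘(ℝ, E) G) (v w : GroupLieAlgebra 𝓘(ℝ, E) D.Gt),
      D.inclStar v = (D.sigmaStar X, X) → D.inclStar w = (D.sigmaStar Y, Y) →
      D.inclStar ⁅v, w⁆ = (0, ⁅X, Y⁆ + Nilshadow.adAct (D.sigmaStar X) Y - Nilshadow.adAct (D.sigmaStar Y) X)) ∧
    -- the same in terms of `X_𝔰 = π_*(X)`
    (∀ X : GroupLieAlgebra 𝓘(ℝ, E) G, D.sigmaStar X = -D.projStar X) ∧
    (∀ (X Y : GroupLieAlgebra 𝓘(ℝ, E) G) (v w : GroupLieAlgebra 𝓘(ℝ, E) D.Gt),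
      D.inclStar v = (-D.projStar X, X) → D.inclStar w = (-D.projStar Y, Y) →
      D.inclStar ⁅v, w⁆ = (0, ⁅X, Y⁆ - Nilshadow.adAct (D.projStar X) Y + Nilshadow.adAct (D.projStar Y) X)) := by
  have : IsTopologicalGroup G := topologicalGroup_of_lieGroup 𝓘(ℝ, E) ∞
  -- For a topological group this gives the Hausdorff property, needed for uniqueness of integral
  -- curves.
  have : T1Space G := ChartedSpace.t1Space E G
  have : LocallyCompactSpace G := ChartedSpace.locallyCompactSpace E G
  have : LocallyPathConnectedSpace G := ChartedSpace.locallyPathConnectedSpace E G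
  refine ⟨D.isLift_action, D.lieGroup_Gt, D.contMDiff_toEnd, D.contMDiff_toG,
    D.isEmbedding_toEnd_toG, D.contMDiff_sigmaEnd, D.sigmaStar_mem_linearLieAlgebra, ?_, ?_,
    D.inclStar_bracket, D.sigmaStar_eq_neg_projStar, ?_⟩
  · intro v w h
    rw [D.inclStar_eq, D.inclStar_eq] at h
    exact congrArg Prod.snd h
  · ext p
    constructor
    · rintro ⟨v, rfl⟩
      exact ⟨v, D.inclStar_eq v⟩
    · rintro ⟨X, rfl⟩
      exact ⟨X, D.inclStar_eq X⟩
  · intro X Y v w hv hw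
    have hS : ∀ Z : GroupLieAlgebra 𝓘(ℝ, E) G, D.sigmaStar Z = -D.projStar Z :=
      D.sigmaStar_eq_neg_projStar
    rw [← hS] at hv hw
    have hA : ∀ Z W : GroupLieAlgebra 𝓘(ℝ, E) G,
        Nilshadow.adAct (D.sigmaStar Z) W = -Nilshadow.adAct (D.projStar Z) W := fun Z W => by
      rw [hS]
      rfl
    rw [D.inclStar_bracket X Y v w hv hw, hA, hA, sub_neg_eq_add, ← sub_eq_add_neg]
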